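/- Let $\alpha>1$ and $\beta\in\mathbb R$. Let $L^2(2)$ be the Hilbert space of functions $f:\mathbb R^2\to\mathbb C$ with $$\|f\|_{L^2(2)}=\Big(\int_{\mathbb R^2}(1+|x|^2)^2|f(x)|^2\,dx\Big)^{1/2}<\infty ,$$ and write $\hat f(p)=\int_{\mathbb R^2} f(x)e^{-ix\cdot p}\,dx$. Let $|\nabla|^\alpha$ be the Fourier multiplier with symbol $|p|^\alpha$, let $G$ be the function with $\hat G(p)=e^{-|p|^\alpha}$, put $a(\tau)=1-e^{-\tau}$, and let $$\mathcal L f=-|\nabla|^\alpha f+\frac1\alpha\,\xi\cdot\nabla f+\Big(1+\frac{\beta-1}{\alpha}\Big)f ,$$ understood in the sense of distributions, on the domain of all $f\in L^2(2)$ with $\mathcal Lf\in L^2(2)$. Then: 1. $\mathcal L$ generates a $C_0$ semigroup $(e^{\tau\mathcal L})_{\tau\ge0}$ on $L^2(2)$, and for every $\epsilon>0$ there is a constant $C>0$ (depending only on $\alpha,\beta,\epsilon$) such that for all $f\in L^2(2)$ with $\int_{\mathbb R^2} f\,dx=0$, all $\gamma\in\mathbb N^2$ with $|\gamma|\le1$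 and all $\tau>0$, the weak derivative $\nabla^\gamma(e^{\tau\mathcal L}f)$ exists in $L^2(2)$ and $$\|\nabla^\gamma(e^{\tau\mathcal L}f)\|_{L^2(2)}\le C\,\frac{e^{(1-\frac{4-\beta}{\alpha}+\epsilon)\tau}}{a(\tau)^{|\gamma|/\alpha}}\,\|f\|_{L^2(2)} ;$$ moreover $\|\nabla^\gamma(e^{\tau\mathcal L}f)\|_{L^2(2)}\le C\,\tau^{-|\gamma|/\alpha}\|f\|_{L^2(2)}$ if $\tau\le1$, and $\|\nabla^\gamma(e^{\tau\mathcal L}f)\|_{L^2(2)}\le C\,e^{(1-\frac{4-\beta}{\alpha}+\epsilon)\tau}\|f\|_{L^2(2)}$ if $\tau>1$. 2. With $\lambda_0=1-\frac{3-\beta}{\alpha}$, the spectrum of $\mathcal L$ on $L^2(2)$ is $$\sigma(\mathcal L)=\{\lambda_0\}\cup\Big\{\lambda\in\mathbb C:\ \mathrm{Re}\,\lambda\le 1-\frac{4-\beta}{\alpha}\Big\},$$ and the half-plane on the right is the essential spectrum of $\mathcal L$ (the spectrum without the isolated points whose Riesz projection has finite rank). 3. $\lambda_0$ is a simple eigenvalue: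 $0\ne G\in L^2(2)$, the eigenspace $\{f:\mathcal Lf=\lambda_0f\}$ is spanned by $G$, and the Riesz projection of $\lambda_0$ is the rank-one operator $$\frac1{2\pi i}\oint_{|\lambda-\lambda_0|=r}(\lambda-\mathcal L)^{-1}f\,d\lambda=\Big(\int_{\mathbb R^2}f\,dx\Big)G\qquad\Big(f\in L^2(2),\ 0<r<\frac1\alpha\Big).$$ -/

import Mathlib

open MeasureTheory Filter Topology
open scoped SchwartzMap ContDiff

noncomputable section

namespace ScaledVariables

/-- The plane `ℝ²` with its Euclidean norm. -/
abbrev Plane := EuclideanSpace ℝ (Fin 2)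

/-! ### The weighted space `L²(2)` -/

/-- The measure `(1 + |x|²)² dx`. -/
def wMeasure : Measure Plane :=
  (volume : Measure Plane).withDensity fun x => ENNReal.ofReal ((1 + ‖x‖ ^ 2) ^ 2)

/-- The Hilbert space `L²(2)` of complex-valued functions `f` with
`‖f‖² = ∫ (1 + |x|²)² |f(x)|² dx < ∞`.  The measure `wMeasure` and Lebesgue measure have the same
null sets, so that elements of this space are Lebesgue classes of functions. -/
abbrev L22 := Lp ℂ 2 wMeasure

/-! ### Fourier transform, fractional Laplacian, the profile `G` -/

/-- `f̂(p) = ∫ f(x) e^{-i x·p} dx`. -/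
def fourierHat (f : Plane → ℂ) (p : Plane) : ℂ :=
  ∫ x : Plane, Complex.exp (-(Complex.I * (inner ℝ x p : ℝ))) * f x

/-- The inverse transform `(2π)⁻² ∫ h(p) e^{i x·p} dp`. -/
def fourierInvHat (h : Plane → ℂ) (x : Plane) : ℂ :=
  ((2 * Real.pi : ℝ) : ℂ)⁻¹ ^ 2 *
    ∫ p : Plane, Complex.exp (Complex.I * (inner ℝ x p : ℝ)) * h p

/-- `|∇|^a φ`, the Fourier multiplier with symbol `|p|^a`. -/
def fracLap (a : ℝ) (φ : Plane → ℂ) : Plane → ℂ :=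
  fourierInvHat fun p => ((‖p‖ ^ a : ℝ) : ℂ) * fourierHat φ p

/-- The function `G` with `Ĝ(p) = e^{-|p|^α}`. -/
def profileG (α : ℝ) : Plane → ℂ :=
  fourierInvHat fun p => ((Real.exp (-(‖p‖ ^ α)) : ℝ) : ℂ)

/-! ### Weak derivatives -/

/-- The partial derivative `∂_j φ`. -/
def pderiv (j : Fin 2) (φ : Plane → ℂ) (x : Plane) : ℂ :=
  fderiv ℝ φ x (EuclideanSpace.single j 1)

/-- The classical derivative `∂^γ φ = ∂₁^{γ₁} ∂₂^{γ₂} φ`. -/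
def multiDeriv (γ : Fin 2 → ℕ) (φ : Plane → ℂ) : Plane → ℂ :=
  (pderiv 0)^[γ 0] ((pderiv 1)^[γ 1] φ)

/-- `g = ∇^γ u` in the sense of distributions. -/
def IsWeakDeriv (γ : Fin 2 → ℕ) (u g : Plane → ℂ) : Prop :=
  ∀ φ : Plane → ℂ, ContDiff ℝ ∞ φ → HasCompactSupport φ →
    ∫ x, u x * multiDeriv γ φ x = (-1) ^ (γ 0 + γ 1) * ∫ x, g x * φ x

/-! ### The operator `𝓛 = -|∇|^α + (1/α) ξ·∇ + (1 + (β-1)/α)` -/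

/-- The formal transpose of `𝓛` on a test function:
`-|∇|^α φ - (1/α) ∇·(ξ φ) + (1 + (β-1)/α) φ`, where `∇·(ξ φ) = 2 φ + ξ·∇φ` on the plane. -/
def formalTranspose (α β : ℝ) (φ : Plane → ℂ) (x : Plane) : ℂ :=
  -fracLap α φ x - ((1 / α : ℝ) : ℂ) * (2 * φ x + fderiv ℝ φ x x)
    + ((1 + (β - 1) / α : ℝ) : ℂ) * φ x

/-- `𝓛 f = g` in the sense of (tempered) distributions. -/
def IsScaledL (α β : ℝ) (f g : Plane → ℂ) : Prop :=
  ∀ φ : 𝓢(Plane, ℂ), ∫ x, g x * φ x = ∫ x, f x * formalTranspose α β φ x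

theorem wMeasure_ac : (volume : Measure Plane) ≪ wMeasure := by
  apply withDensity_absolutelyContinuous'
  · exact Measurable.aemeasurable (by fun_prop)
  · refine Eventually.of_forall fun x => ?_
    have : (0 : ℝ) < (1 + ‖x‖ ^ 2) ^ 2 := by positivity
    exact (ENNReal.ofReal_pos.2 this).ne'

theorem ae_volume_iff {P : Plane → Prop} :
    (∀ᵐ x ∂wMeasure, P x) ↔ ∀ᵐ x ∂(volume : Measure Plane), P x :=
  ⟨fun h => wMeasure_ac.ae_le h, fun h => (withDensity_absolutelyContinuous _ _).ae_le h⟩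

theorem integrable_L22 (f : L22) : Integrable (fun x => f x) (volume : Measure Plane) := by
  have hm : StronglyMeasurable (f : Plane → ℂ) := Lp.stronglyMeasurable f
  have h2 : Integrable (fun x => ‖f x‖ ^ 2) wMeasure :=
    (memLp_two_iff_integrable_sq_norm hm.aestronglyMeasurable).1 (Lp.memLp f)
  unfold wMeasure at h2
  rw [integrable_withDensity_iff_integrable_smul' (by fun_prop) (by simp)] at h2
  have h4 : Integrable (fun x : Plane => ((1 : ℝ) + ‖x‖ ^ 2) ^ (-(4 : ℝ) / 2)) volume :=
    integrable_rpow_neg_one_add_norm_sq (by simp; norm_num)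
  refine (h2.add h4).mono' hm.aestronglyMeasurable (Eventually.of_forall fun x => ?_)
  have hw : (0 : ℝ) < 1 + ‖x‖ ^ 2 := by positivity
  have e : ((1 : ℝ) + ‖x‖ ^ 2) ^ (-(4 : ℝ) / 2) = ((1 + ‖x‖ ^ 2) ^ 2)⁻¹ := by
    rw [show (-(4 : ℝ) / 2) = -((2 : ℕ) : ℝ) by norm_num, Real.rpow_neg hw.le, Real.rpow_natCast]
  simp only [Pi.add_apply, smul_eq_mul]
  rw [e, ENNReal.toReal_ofReal (by positivity)]
  set w : ℝ := (1 + ‖x‖ ^ 2) ^ 2 with hwdef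
  have hwp : 0 < w := by positivity
  have key : ‖f x‖ * w ≤ (w * ‖f x‖ ^ 2 + w⁻¹) * w := by
    rw [add_mul, inv_mul_cancel₀ hwp.ne']
    nlinarith [sq_nonneg (w * ‖f x‖ - 1), mul_nonneg hwp.le (norm_nonneg (f x))]
  exact le_of_mul_le_mul_right key hwp

theorem fourierInvHat_norm_le (h : Plane → ℂ) (x : Plane) :
    ‖fourierInvHat h x‖ ≤ ‖((2 * Real.pi : ℝ) : ℂ)⁻¹ ^ 2‖ * ∫ p, ‖h p‖ := by
  rw [fourierInvHat, norm_mul]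
  gcongr
  refine (norm_integral_le_integral_norm _).trans_eq ?_
  congr 1
  ext p
  rw [norm_mul, mul_comm Complex.I, Complex.norm_exp_ofReal_mul_I, one_mul]

theorem stronglyMeasurable_fourierHat {f : Plane → ℂ} (hf : StronglyMeasurable f) :
    StronglyMeasurable (fourierHat f) := by
  have : StronglyMeasurable (Function.uncurry fun p x : Plane =>
      Complex.exp (-(Complex.I * (inner ℝ x p : ℝ))) * f x) := by
    refine StronglyMeasurable.mul (Continuous.stronglyMeasurable (by fun_prop)) ?_
    exact hf.comp_measurable measurable_snd
  exact this.integral_prod_right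

theorem stronglyMeasurable_fourierInvHat {h : Plane → ℂ} (hh : StronglyMeasurable h) :
    StronglyMeasurable (fourierInvHat h) := by
  have : StronglyMeasurable (Function.uncurry fun x p : Plane =>
      Complex.exp (Complex.I * (inner ℝ x p : ℝ)) * h p) := by
    refine StronglyMeasurable.mul (Continuous.stronglyMeasurable (by fun_prop)) ?_
    exact hh.comp_measurable measurable_snd
  exact this.integral_prod_right.const_mul _

theorem stronglyMeasurable_formalTranspose (α β : ℝ) (φ : 𝓢(Plane, ℂ)) :
    StronglyMeasurable (formalTranspose α β φ) := by
  have h1 : StronglyMeasurable (φ : Plane → ℂ) := φ.continuous.stronglyMeasurable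
  have h2 : StronglyMeasurable (fracLap α φ) := by
    refine stronglyMeasurable_fourierInvHat (StronglyMeasurable.mul ?_
      (stronglyMeasurable_fourierHat h1))
    exact Measurable.stronglyMeasurable (by fun_prop)
  have h3 : StronglyMeasurable (fun x : Plane => fderiv ℝ φ x x) := by
    have : Continuous (fderiv ℝ (φ : Plane → ℂ)) := (φ.smooth 1).continuous_fderiv (by simp)
    exact (this.clm_apply continuous_id).stronglyMeasurable
  exact (h2.neg.sub (((h1.const_mul 2).add h3).const_mul _)).add (h1.const_mul _)

theorem exists_bound_formalTranspose (α β : ℝ) (φ : 𝓢(Plane, ℂ)) :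
    ∃ C, ∀ x, ‖formalTranspose α β φ x‖ ≤ C := by
  obtain ⟨C0, -, h0⟩ := φ.decay 0 0
  obtain ⟨C1, -, h1⟩ := φ.decay 1 1
  simp only [pow_zero, norm_iteratedFDeriv_zero, one_mul, pow_one,
    norm_iteratedFDeriv_one] at h0 h1
  refine ⟨‖((2 * Real.pi : ℝ) : ℂ)⁻¹ ^ 2‖ * (∫ p, ‖((‖p‖ ^ α : ℝ) : ℂ) * fourierHat φ p‖)
    + ‖((1 / α : ℝ) : ℂ)‖ * (2 * C0 + C1) + ‖((1 + (β - 1) / α : ℝ) : ℂ)‖ * C0, fun x => ?_⟩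
  have hf : ‖fderiv ℝ φ x x‖ ≤ C1 :=
    ((fderiv ℝ φ x).le_opNorm x).trans (by rw [mul_comm]; exact h1 x)
  refine (norm_add_le _ _).trans (add_le_add ((norm_sub_le _ _).trans (add_le_add ?_ ?_)) ?_)
  · rw [norm_neg]
    exact fourierInvHat_norm_le _ x
  · rw [norm_mul]
    gcongr
    refine (norm_add_le _ _).trans (add_le_add ?_ hf)
    rw [norm_mul, Complex.norm_ofNat]
    gcongr
    exact h0 x
  · rw [norm_mul]
    gcongr
    exact h0 x

theorem integrable_mul_formalTranspose (α β : ℝ) (f : L22) (φ : 𝓢(Plane, ℂ)) :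
    Integrable (fun x => f x * formalTranspose α β φ x) (volume : Measure Plane) := by
  obtain ⟨C, hC⟩ := exists_bound_formalTranspose α β φ
  exact (integrable_L22 f).mul_bdd (c := C)
    (stronglyMeasurable_formalTranspose α β φ).aestronglyMeasurable (Eventually.of_forall hC)

theorem integrable_mul_schwartz (f : L22) (φ : 𝓢(Plane, ℂ)) :
    Integrable (fun x => f x * φ x) (volume : Measure Plane) := by
  obtain ⟨C, -, hC⟩ := φ.decay 0 0
  simp only [pow_zero, norm_iteratedFDeriv_zero, one_mul] at hC
  exact (integrable_L22 f).mul_bdd (c := C)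
    φ.continuous.aestronglyMeasurable (Eventually.of_forall hC)

theorem coeFn_add_volume (f g : L22) :
    (fun x => (f + g : L22) x) =ᵐ[(volume : Measure Plane)] fun x => f x + g x :=
  ae_volume_iff.1 (Lp.coeFn_add f g)

theorem coeFn_smul_volume (c : ℂ) (f : L22) :
    (fun x => (c • f : L22) x) =ᵐ[(volume : Measure Plane)] fun x => c * f x :=
  ae_volume_iff.1 (Lp.coeFn_smul c f)

theorem integral_add_mul (f g : L22) {ψ : Plane → ℂ}
    (hf : Integrable (fun x => f x * ψ x) (volume : Measure Plane))
    (hg : Integrable (fun x => g x * ψ x) (volume : Measure Plane)) :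
    ∫ x, (f + g : L22) x * ψ x = (∫ x, f x * ψ x) + ∫ x, g x * ψ x := by
  rw [← integral_add hf hg]
  refine integral_congr_ae ?_
  filter_upwards [coeFn_add_volume f g] with x hx
  rw [hx, add_mul]

theorem integral_smul_mul (c : ℂ) (f : L22) (ψ : Plane → ℂ) :
    ∫ x, (c • f : L22) x * ψ x = c * ∫ x, f x * ψ x := by
  rw [← integral_const_mul]
  refine integral_congr_ae ?_
  filter_upwards [coeFn_smul_volume c f] with x hx
  rw [hx, mul_assoc]

theorem IsScaledL.add {α β : ℝ} {f g f' g' : L22} (h : IsScaledL α β f g)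
    (h' : IsScaledL α β f' g') : IsScaledL α β (f + f' : L22) (g + g' : L22) := fun φ => by
  rw [integral_add_mul _ _ (integrable_mul_schwartz _ φ) (integrable_mul_schwartz _ φ),
    integral_add_mul _ _ (integrable_mul_formalTranspose _ _ _ φ)
      (integrable_mul_formalTranspose _ _ _ φ), h φ, h' φ]

theorem IsScaledL.smul {α β : ℝ} {f g : L22} (c : ℂ) (h : IsScaledL α β f g) :
    IsScaledL α β (c • f : L22) (c • g : L22) := fun φ => by
  rw [integral_smul_mul, integral_smul_mul, h φ]

theorem IsScaledL.zero (α β : ℝ) : IsScaledL α β (0 : L22) (0 : L22) := fun φ => by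
  have e : (0 : L22) = (0 : ℂ) • (0 : L22) := by simp
  rw [e, integral_smul_mul, integral_smul_mul, zero_mul, zero_mul]

theorem IsScaledL.unique {α β : ℝ} {f g g' : L22} (h : IsScaledL α β f g)
    (h' : IsScaledL α β f g') : g = g' := by
  refine Lp.ext (ae_volume_iff.2 ?_)
  refine ae_eq_of_integral_contDiff_smul_eq (integrable_L22 g).locallyIntegrable
    (integrable_L22 g').locallyIntegrable fun ψ hψ hc => ?_
  have h1 : HasCompactSupport fun x => (ψ x : ℂ) := hc.comp_left (g := ((↑) : ℝ → ℂ)) (by simp)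
  have h2 : ContDiff ℝ ∞ fun x => (ψ x : ℂ) := Complex.ofRealCLM.contDiff.comp hψ
  have e := (h (h1.toSchwartzMap h2)).trans (h' (h1.toSchwartzMap h2)).symm
  simpa [mul_comm] using e

/-- The operator `𝓛` on `L²(2)`, with its maximal domain `{f ∈ L²(2) : 𝓛 f ∈ L²(2)}`. -/
def scaledL (α β : ℝ) : L22 →ₗ.[ℂ] L22 where
  domain :=
    { carrier := {f | ∃ g : L22, IsScaledL α β f g}
      add_mem' := fun ⟨g, hg⟩ ⟨g', hg'⟩ => ⟨g + g', hg.add hg'⟩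
      zero_mem' := ⟨0, IsScaledL.zero α β⟩
      smul_mem' := fun c _ ⟨g, hg⟩ => ⟨c • g, hg.smul c⟩ }
  toFun :=
    { toFun := fun f => Classical.choose f.2
      map_add' := fun f f' => (Classical.choose_spec (f + f').2).unique
        ((Classical.choose_spec f.2).add (Classical.choose_spec f'.2))
      map_smul' := fun c f => (Classical.choose_spec (c • f).2).unique
        ((Classical.choose_spec f.2).smul c) }

end ScaledVariables

/-! ### Semigroups and spectra of unbounded operators -/

namespace UnboundedOp

variable {X : Type*} [NormedAddCommGroup X] [NormedSpace ℂ X]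

/-- `(S τ)_{τ ≥ 0}` is a `C₀` semigroup whose infinitesimal generator is `A` (equality of domains
included); that is, `S τ = e^{τ A}`. The values of `S` at negative times play no role. -/
structure GeneratesC0 (A : X →ₗ.[ℂ] X) (S : ℝ → X →L[ℂ] X) : Prop where
  map_zero : S 0 = ContinuousLinearMap.id ℂ X
  map_add : ∀ s t : ℝ, 0 ≤ s → 0 ≤ t → S (s + t) = (S s).comp (S t)
  continuous_at_zero : ∀ x : X, Tendsto (fun t => S t x) (𝓝[>] 0) (𝓝 x)
  generator : ∀ x y : X, (∃ h : x ∈ A.domain, A ⟨x, h⟩ = y) ↔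
    Tendsto (fun t : ℝ => ((t⁻¹ : ℝ) : ℂ) • (S t x - x)) (𝓝[>] 0) (𝓝 y)

/-- `R` is a bounded two-sided inverse of `z - A : D(A) → X`. -/
def IsResolventAt (A : X →ₗ.[ℂ] X) (z : ℂ) (R : X →L[ℂ] X) : Prop :=
  ∀ x y : X, R y = x ↔ ∃ h : x ∈ A.domain, z • x - A ⟨x, h⟩ = y

/-- The resolvent set of `A`. -/
def resolventSet (A : X →ₗ.[ℂ] X) : Set ℂ := {z | ∃ R, IsResolventAt A z R}

/-- The spectrum of `A`. -/
def spectrum (A : X →ₗ.[ℂ] X) : Set ℂ := (resolventSet A)ᶜ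

open Classical in
/-- The resolvent `(z - A)⁻¹`, extended by `0` off the resolvent set. -/
def resolvent (A : X →ₗ.[ℂ] X) (z : ℂ) : X →L[ℂ] X :=
  if h : z ∈ resolventSet A then Classical.choose h else 0

/-- The Riesz projection `(2πi)⁻¹ ∮_{|w - z| = r} (w - A)⁻¹ dw`. -/
def rieszProjection (A : X →ₗ.[ℂ] X) (z : ℂ) (r : ℝ) : X →L[ℂ] X :=
  (2 * Real.pi * Complex.I : ℂ)⁻¹ • ∮ w in C(z, r), resolvent A w

/-- The discrete spectrum: isolated points of the spectrum whose Riesz projection has finite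
rank. -/
def discreteSpectrum (A : X →ₗ.[ℂ] X) : Set ℂ :=
  {z | ∃ r : ℝ, 0 < r ∧ Metric.closedBall z r ∩ spectrum A = {z} ∧
    FiniteDimensional ℂ (rieszProjection A z r).range}

/-- The essential spectrum: the complement of the discrete spectrum in the spectrum. -/
def essentialSpectrum (A : X →ₗ.[ℂ] X) : Set ℂ := spectrum A \ discreteSpectrum A

end UnboundedOp

end

/-! On the Fourier side the operator is the first order operator `-|p|^α - (1/α) p·∇ + λ₀`, because
the transform of `ξ·∇f` is `-2 f̂ - p·∇f̂` and `1 + (β-1)/α - 2/α = λ₀`. Characteristics solve the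
evolution explicitly: `f̂(p)` becomes `e^{λ₀t} e^{-a(t)|p|^α} f̂(e^{-t/α}p)`. In physical space this
is a convolution of a dilated `G` with a dilated `f` (`flow`), which is bounded on `L²(2)` by
Young's inequality. Here `α > 1` enters: multiplication of `G` by `1 + |x|²` produces a singularity
`|p|^{α-2}` at the origin of the Fourier side, which is square integrable in the plane exactly for
`α > 1`.

The generator of `flow` equals `𝓛` on its maximal domain (`isScaledL_iff_inGenerator`). One
inclusion comes from testing against Schwartz functions and transposing the flow. The other is the
usual maximality argument: far to the right `z` minus the generator is onto, by the Laplace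
transform, while `z - 𝓛` is injective for `Re z > λ₀` (`eq_zero_of_isScaledL_smul`).

The decay rests on `exists_eLpNorm_conv_le`. If `∫ h = 0`, then `|ĥ(p)| ≤ 2|p|^s ‖|x|^s h‖₁`, and `K
* h` is controlled by `‖|x|² h‖₂` and `‖|x|^s h‖₁` alone. For `h` the dilation of `f` by a factor
comparable to `e^{t/α}`, these shrink like `e^{-t/α}` and `e^{-st/α}`. The weight `|x|^s` embeds
`L²(2)` in `L¹` only for `s < 1`, which is the origin of `ε`. A derivative replaces `e^{-|p|^α}` by
`i p_j e^{-|p|^α}` and costs a factor `a(t)^{-1/α}`.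

For the spectrum, `f = (∫f) G + Qf` splits the flow. The mean evolves by `e^{λ₀t}`, and on the range
of `Q` the Laplace transform converges and is holomorphic for `Re z > λ₀ - s/α`
(`exists_reduced_resolvent`). The resolvent is thus `(z-λ₀)⁻¹ P` plus a holomorphic term, which
yields the Riesz projection and the simplicity of `λ₀`. For `Re z < λ₀ - 1/α` the function with
transform `|p|^{α(λ₀-z)} e^{-|p|^α}` is an eigenvector in `L²(2)` (`exists_eigenvector`). The
spectrum is closed, so it contains the boundary line as well, and no point of the half-plane is
isolated. -/

noncomputable section

/-! ### Abstract `C₀` semigroups, Laplace transforms and holomorphy. -/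

namespace UnboundedOp

variable {X : Type*} [NormedAddCommGroup X] [NormedSpace ℂ X]

/-- `(x, y)` belongs to the graph of the infinitesimal generator of `S`. -/
def InGenerator (S : ℝ → X →L[ℂ] X) (x y : X) : Prop :=
  Tendsto (fun t : ℝ => ((t⁻¹ : ℝ) : ℂ) • (S t x - x)) (𝓝[>] 0) (𝓝 y)

/-- A `C₀` semigroup with growth bound `‖S t‖ ≤ M e^{κ t}`. -/
structure IsC0Semigroup (S : ℝ → X →L[ℂ] X) (M κ : ℝ) : Prop where
  orbit_zero : S 0 = ContinuousLinearMap.id ℂ X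
  orbit_add : ∀ s t : ℝ, 0 ≤ s → 0 ≤ t → S (s + t) = (S s).comp (S t)
  continuous_at_zero : ∀ x : X, Tendsto (fun t => S t x) (𝓝[>] 0) (𝓝 x)
  bound : ∀ t : ℝ, 0 ≤ t → ‖S t‖ ≤ M * Real.exp (κ * t)

theorem InGenerator.unique {S : ℝ → X →L[ℂ] X} {x y y' : X} (h : InGenerator S x y)
    (h' : InGenerator S x y') : y = y' :=
  tendsto_nhds_unique h h'

theorem inGenerator_of_hasDerivWithinAt {S : ℝ → X →L[ℂ] X} {x y : X} {U : ℝ → X}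
    (hU : ∀ t : ℝ, 0 < t → S t x = U t) (h0 : U 0 = x)
    (hd : HasDerivWithinAt U y (Set.Ici 0) 0) : InGenerator S x y := by
  have := (hasDerivWithinAt_iff_tendsto_slope' (s := Set.Ioi (0 : ℝ)) (by simp)).1
    (hd.mono Set.Ioi_subset_Ici_self)
  refine this.congr' ?_
  filter_upwards [self_mem_nhdsWithin] with t ht
  rw [slope_def_module, sub_zero, h0, hU t ht, Complex.coe_smul]

namespace IsC0Semigroup

variable {S : ℝ → X →L[ℂ] X} {M κ : ℝ}

theorem map_add_apply (hS : IsC0Semigroup S M κ) {s t : ℝ} (hs : 0 ≤ s) (ht : 0 ≤ t) (x : X) :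
    S (s + t) x = S s (S t x) := by
  rw [hS.orbit_add s t hs ht, ContinuousLinearMap.comp_apply]

theorem map_map_comm (hS : IsC0Semigroup S M κ) {s t : ℝ} (hs : 0 ≤ s) (ht : 0 ≤ t) (x : X) :
    S s (S t x) = S t (S s x) := by
  rw [← hS.map_add_apply hs ht, ← hS.map_add_apply ht hs, add_comm]

theorem map_zero_apply (hS : IsC0Semigroup S M κ) (x : X) : S 0 x = x := by
  rw [hS.orbit_zero, ContinuousLinearMap.id_apply]

theorem const_nonneg (hS : IsC0Semigroup S M κ) : 0 ≤ M := by
  have := hS.bound 0 le_rfl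
  simp only [mul_zero, Real.exp_zero, mul_one] at this
  exact (norm_nonneg _).trans this

theorem norm_le_on_Icc (hS : IsC0Semigroup S M κ) {t b : ℝ} (ht : 0 ≤ t) (hb : t ≤ b) :
    ‖S t‖ ≤ M * Real.exp (|κ| * b) := by
  refine (hS.bound t ht).trans (mul_le_mul_of_nonneg_left (Real.exp_le_exp.2 ?_) hS.const_nonneg)
  exact (mul_le_mul_of_nonneg_right (le_abs_self κ) ht).trans
    (mul_le_mul_of_nonneg_left hb (abs_nonneg κ))

/-- The absolute value makes a two-sided limit out of a one-sided one, so that it can be composed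
with a time difference of either sign. -/
theorem tendsto_norm_sub (hS : IsC0Semigroup S M κ) (x : X) :
    Tendsto (fun t : ℝ => ‖S |t| x - x‖) (𝓝 0) (𝓝 0) := by
  have h1 : Tendsto (fun t => ‖S t x - x‖) (𝓝[≥] 0) (𝓝 0) := by
    rw [← Set.Ioi_union_left, nhdsWithin_union]
    refine Tendsto.sup ?_ ?_
    · simpa using ((hS.continuous_at_zero x).sub_const x).norm
    · rw [nhdsWithin_singleton]
      refine (tendsto_pure_nhds _ _).mono_right ?_
      rw [hS.map_zero_apply, sub_self, norm_zero]
  refine h1.comp (tendsto_nhdsWithin_iff.2 ⟨?_, Eventually.of_forall fun t => abs_nonneg t⟩)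
  simpa using (continuous_abs.tendsto (0 : ℝ))

/-- Orbits are continuous on `[0, ∞)`. -/
theorem continuousOn_orbit (hS : IsC0Semigroup S M κ) (x : X) :
    ContinuousOn (fun t => S t x) (Set.Ici 0) := by
  intro t ht
  rw [Set.mem_Ici] at ht
  have key : ∀ s : ℝ, 0 ≤ s → s ≤ t + 1 →
      ‖S s x - S t x‖ ≤ M * Real.exp (|κ| * (t + 1)) * ‖S |s - t| x - x‖ := by
    -- Factoring out the operator at the earlier time treats left and right continuity together.
    have main : ∀ p q : ℝ, 0 ≤ p → p ≤ q → p ≤ t + 1 →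
        ‖S q x - S p x‖ ≤ M * Real.exp (|κ| * (t + 1)) * ‖S (q - p) x - x‖ := by
      intro p q hp hpq hpt
      have e : S q x - S p x = S p (S (q - p) x - x) := by
        rw [map_sub, ← hS.map_add_apply hp (sub_nonneg.2 hpq), add_sub_cancel]
      rw [e]
      refine ((S p).le_opNorm _).trans ?_
      gcongr
      exact hS.norm_le_on_Icc hp hpt
    intro s hs hst
    rcases le_total s t with h | h
    · rw [norm_sub_rev, abs_sub_comm, abs_of_nonneg (sub_nonneg.2 h)]
      exact main s t hs h hst
    · rw [abs_of_nonneg (sub_nonneg.2 h)]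
      exact main t s ht h (by linarith)
  have hlim : Tendsto (fun s => M * Real.exp (|κ| * (t + 1)) * ‖S |s - t| x - x‖) (𝓝 t) (𝓝 0) := by
    have h2 : Tendsto (fun s : ℝ => s - t) (𝓝 t) (𝓝 0) := by
      simpa using (tendsto_id (x := 𝓝 t)).sub_const t
    simpa using ((hS.tendsto_norm_sub x).comp h2).const_mul (M * Real.exp (|κ| * (t + 1)))
  refine tendsto_iff_norm_sub_tendsto_zero.2 ?_
  refine tendsto_of_tendsto_of_tendsto_of_le_of_le' tendsto_const_nhds
    (hlim.mono_left nhdsWithin_le_nhds) (Eventually.of_forall fun s => norm_nonneg _) ?_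
  filter_upwards [self_mem_nhdsWithin, mem_nhdsWithin_of_mem_nhds (Iic_mem_nhds (lt_add_one t))]
    with s hs hs'
  exact key s hs hs'

variable {Q : X →L[ℂ] X} {N ν : ℝ}

theorem continuousOn_laplace_integrand (hS : IsC0Semigroup S M κ) (z : ℂ) (x : X) :
    ContinuousOn (fun t : ℝ => Complex.exp (-(z * t)) • S t x) (Set.Ici 0) :=
  (Continuous.continuousOn (by fun_prop)).smul (hS.continuousOn_orbit x)

/-- The growth is measured on `S t ∘ Q` rather than on `S t`, so that the same lemmas give the full
resolvent for `Q = id` and, for a spectral projection `Q`, the reduced resolvent in a larger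
half-plane. -/
theorem norm_laplace_integrand_le (hb : ∀ t : ℝ, 0 ≤ t → ‖(S t).comp Q‖ ≤ N * Real.exp (ν * t))
    (z : ℂ) (x : X) {t : ℝ} (ht : 0 ≤ t) :
    ‖Complex.exp (-(z * t)) • S t (Q x)‖ ≤ N * ‖x‖ * Real.exp ((ν - z.re) * t) := by
  rw [norm_smul, Complex.norm_exp]
  have e : (-(z * t)).re = -(z.re * t) := by simp
  rw [e]
  calc Real.exp (-(z.re * t)) * ‖S t (Q x)‖
      ≤ Real.exp (-(z.re * t)) * (N * Real.exp (ν * t) * ‖x‖) := by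
        gcongr
        exact (((S t).comp Q).le_opNorm x).trans (by gcongr; exact hb t ht)
    _ = N * ‖x‖ * (Real.exp (-(z.re * t)) * Real.exp (ν * t)) := by ring
    _ = _ := by rw [← Real.exp_add]; ring_nf

theorem integrableOn_laplace_integrand (hS : IsC0Semigroup S M κ)
    (hb : ∀ t : ℝ, 0 ≤ t → ‖(S t).comp Q‖ ≤ N * Real.exp (ν * t)) {z : ℂ} (hz : ν < z.re) (x : X) :
    IntegrableOn (fun t : ℝ => Complex.exp (-(z * t)) • S t (Q x)) (Set.Ioi 0) := by
  refine Integrable.mono' ((integrableOn_exp_mul_Ioi (sub_neg.2 hz) 0).const_mul (N * ‖x‖))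
    (((hS.continuousOn_laplace_integrand z (Q x)).mono
      Set.Ioi_subset_Ici_self).aestronglyMeasurable measurableSet_Ioi) ?_
  filter_upwards [ae_restrict_mem measurableSet_Ioi] with t ht
  exact norm_laplace_integrand_le hb z x (le_of_lt ht)

/-- The Laplace transform `∫₀^∞ e^{-z t} S t Q dt` as a bounded operator. -/
theorem exists_laplace (hS : IsC0Semigroup S M κ)
    (hb : ∀ t : ℝ, 0 ≤ t → ‖(S t).comp Q‖ ≤ N * Real.exp (ν * t)) {z : ℂ} (hz : ν < z.re) :
    ∃ R : X →L[ℂ] X, (∀ x, R x = ∫ t in Set.Ioi (0 : ℝ), Complex.exp (-(z * t)) • S t (Q x)) ∧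
      ‖R‖ ≤ N / (z.re - ν) := by
  have hN : 0 ≤ N := by
    have := (norm_nonneg _).trans (hb 0 le_rfl)
    simpa using this
  let R₀ : X →ₗ[ℂ] X :=
    { toFun := fun x => ∫ t in Set.Ioi (0 : ℝ), Complex.exp (-(z * t)) • S t (Q x)
      map_add' := fun x y => by
        rw [← integral_add (hS.integrableOn_laplace_integrand hb hz x)
          (hS.integrableOn_laplace_integrand hb hz y)]
        refine integral_congr_ae (Eventually.of_forall fun t => ?_)
        change _ • S t (Q (x + y)) = _ • S t (Q x) + _ • S t (Q y)
        rw [map_add, map_add, smul_add]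
      map_smul' := fun c x => by
        rw [RingHom.id_apply, ← integral_smul]
        refine integral_congr_ae (Eventually.of_forall fun t => ?_)
        change _ • S t (Q (c • x)) = c • _ • S t (Q x)
        rw [map_smul, map_smul, smul_comm] }
  have hR : ∀ x, ‖R₀ x‖ ≤ N / (z.re - ν) * ‖x‖ := fun x => by
    have h1 : ‖R₀ x‖ ≤ ∫ t in Set.Ioi (0 : ℝ), N * ‖x‖ * Real.exp ((ν - z.re) * t) := by
      refine norm_integral_le_of_norm_le
        ((integrableOn_exp_mul_Ioi (sub_neg.2 hz) 0).const_mul (N * ‖x‖)) ?_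
      filter_upwards [ae_restrict_mem measurableSet_Ioi] with t ht
      exact norm_laplace_integrand_le hb z x (le_of_lt ht)
    rw [integral_const_mul, integral_exp_mul_Ioi (sub_neg.2 hz)] at h1
    refine h1.trans_eq ?_
    have : ν - z.re ≠ 0 := (sub_neg.2 hz).ne
    have : z.re - ν ≠ 0 := (sub_pos.2 hz).ne'
    rw [mul_zero, Real.exp_zero]
    rw [show ν - z.re = -(z.re - ν) by ring, neg_div_neg_eq]
    ring
  exact ⟨R₀.mkContinuous _ hR, fun x => rfl,
    R₀.mkContinuous_norm_le (div_nonneg hN (sub_pos.2 hz).le) hR⟩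

variable [CompleteSpace X] {R : X →L[ℂ] X} {z : ℂ}

/-- Shifting the integration variable gives `S h (R x) = e^{zh} (R x - ∫₀^h e^{-zt} S t (Q x) dt)`,
and the right side can be differentiated at `h = 0` by the fundamental theorem of calculus. -/
theorem inGenerator_laplace (hS : IsC0Semigroup S M κ)
    (hb : ∀ t : ℝ, 0 ≤ t → ‖(S t).comp Q‖ ≤ N * Real.exp (ν * t)) (hz : ν < z.re)
    (hR : ∀ x, R x = ∫ t in Set.Ioi (0 : ℝ), Complex.exp (-(z * t)) • S t (Q x)) (x : X) :
    InGenerator S (R x) (z • R x - Q x) := by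
  set g : ℝ → X := fun t => Complex.exp (-(z * t)) • S t (Q x) with hg
  have hgi : IntegrableOn g (Set.Ioi 0) := hS.integrableOn_laplace_integrand hb hz x
  have hgc : ContinuousOn g (Set.Ici 0) := hS.continuousOn_laplace_integrand z (Q x)
  have hd : HasDerivWithinAt (fun h : ℝ => Complex.exp (z * h) • (R x - ∫ t in (0 : ℝ)..h, g t))
      (z • R x - Q x) (Set.Ici 0) 0 := by
    have h1 : HasDerivWithinAt (fun h : ℝ => ∫ t in (0 : ℝ)..h, g t) (g 0) (Set.Ici 0) 0 := by
      refine intervalIntegral.integral_hasDerivWithinAt_right (t := Set.Ioi 0) (by simp) ?_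
        ((hgc 0 (by simp)).mono Set.Ioi_subset_Ici_self)
      exact (hgc.mono Set.Ioi_subset_Ici_self).stronglyMeasurableAtFilter_nhdsWithin measurableSet_Ioi 0
    have h2 : HasDerivAt (fun h : ℝ => Complex.exp (z * h)) z 0 := by
      have := ((Complex.ofRealCLM.hasDerivAt (x := (0 : ℝ))).const_mul z).cexp
      simpa using this
    have h3 := h2.hasDerivWithinAt.smul (h1.const_sub (R x))
    have e0 : g 0 = Q x := by
      change Complex.exp (-(z * ((0 : ℝ) : ℂ))) • S 0 (Q x) = Q x
      rw [hS.map_zero_apply, Complex.ofReal_zero, mul_zero, neg_zero, Complex.exp_zero, one_smul]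
    have e1 : z • R x - Q x = Complex.exp (z * ((0 : ℝ) : ℂ)) • -g 0 +
        z • (R x - ∫ t in (0 : ℝ)..0, g t) := by
      rw [e0, Complex.ofReal_zero, mul_zero, Complex.exp_zero, one_smul,
        intervalIntegral.integral_same, sub_zero]
      abel
    rw [e1]
    exact h3
  refine inGenerator_of_hasDerivWithinAt (fun h hh => ?_) (by simp) hd
  have e1 : S h (R x) = ∫ t in Set.Ioi (0 : ℝ), Complex.exp (z * h) • g (t + h) := by
    rw [hR, ← ContinuousLinearMap.integral_comp_comm _ hgi]
    refine setIntegral_congr_fun measurableSet_Ioi fun t ht => ?_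
    simp only [hg]
    rw [map_smul, ← hS.map_add_apply hh.le (le_of_lt ht), add_comm h t, smul_smul,
      ← Complex.exp_add]
    congr 2
    push_cast
    ring
  have e2 : ∫ t in Set.Ioi (0 : ℝ), g (t + h) = ∫ t in Set.Ioi h, g t := by
    have := (measurePreserving_add_right volume h).setIntegral_preimage_emb
      (measurableEmbedding_addRight h) g (Set.Ioi h)
    rw [← this]
    congr 2
    ext t
    simp
  rw [e1, integral_smul, e2, hR x, ← intervalIntegral.integral_Ioi_sub_Ioi hgi hh.le]
  congr 1
  rw [sub_sub_cancel]

theorem laplace_comm (hS : IsC0Semigroup S M κ)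
    (hb : ∀ t : ℝ, 0 ≤ t → ‖(S t).comp Q‖ ≤ N * Real.exp (ν * t)) (hz : ν < z.re)
    (hR : ∀ x, R x = ∫ t in Set.Ioi (0 : ℝ), Complex.exp (-(z * t)) • S t (Q x))
    {A : X →L[ℂ] X} (hA : ∀ t, 0 ≤ t → ∀ x, A (S t (Q x)) = S t (Q (A x))) (x : X) :
    R (A x) = A (R x) := by
  rw [hR, hR, ← ContinuousLinearMap.integral_comp_comm _
    (hS.integrableOn_laplace_integrand hb hz x)]
  refine setIntegral_congr_fun measurableSet_Ioi fun t ht => ?_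
  simp only [map_smul]
  rw [hA t (le_of_lt ht)]

/-- `R` commutes with `S t`, hence maps the difference quotients of `x` to those of `R x`. So `R y`
is the value of the generator at `R x`, which `inGenerator_laplace` has already computed. -/
theorem laplace_apply_generator (hS : IsC0Semigroup S M κ)
    (hb : ∀ t : ℝ, 0 ≤ t → ‖(S t).comp Q‖ ≤ N * Real.exp (ν * t)) (hz : ν < z.re)
    (hQ : ∀ t : ℝ, 0 ≤ t → ∀ x, S t (Q x) = Q (S t x))
    (hR : ∀ x, R x = ∫ t in Set.Ioi (0 : ℝ), Complex.exp (-(z * t)) • S t (Q x)) {x y : X}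
    (hxy : InGenerator S x y) : R y = z • R x - Q x := by
  have h1 : InGenerator S (R x) (R y) := by
    refine ((R.continuous.tendsto y).comp hxy).congr' ?_
    filter_upwards [self_mem_nhdsWithin] with t ht
    have ht' : 0 ≤ t := le_of_lt ht
    have : R (S t x) = S t (R x) := hS.laplace_comm hb hz hR (fun s hs x => by
      rw [hS.map_map_comm ht' hs, hQ t ht']) x
    simp only [Function.comp_apply, map_smul, map_sub, this]
  exact h1.unique (hS.inGenerator_laplace hb hz hR x)

/-- The resolvent identity for Laplace transforms. -/
theorem laplace_sub_laplace (hS : IsC0Semigroup S M κ)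
    (hb : ∀ t : ℝ, 0 ≤ t → ‖(S t).comp Q‖ ≤ N * Real.exp (ν * t))
    (hQ : ∀ t : ℝ, 0 ≤ t → ∀ x, S t (Q x) = Q (S t x)) (hQQ : ∀ x, Q (Q x) = Q x)
    (hz : ν < z.re)
    (hR : ∀ x, R x = ∫ t in Set.Ioi (0 : ℝ), Complex.exp (-(z * t)) • S t (Q x))
    {w : ℂ} {R' : X →L[ℂ] X} (hw : ν < w.re)
    (hR' : ∀ x, R' x = ∫ t in Set.Ioi (0 : ℝ), Complex.exp (-(w * t)) • S t (Q x)) :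
    R - R' = (w - z) • R'.comp R := by
  ext x
  have h1 := hS.laplace_apply_generator hb hw hQ hR' (hS.inGenerator_laplace hb hz hR x)
  have h2 : R' (Q x) = R' x := by rw [hR', hR', hQQ]
  have h3 : Q (R x) = R x := by
    rw [← hS.laplace_comm hb hz hR (fun t ht x => by rw [← hQ t ht]), hR, hR, hQQ]
  rw [map_sub, map_smul, h2, h3] at h1
  simp only [_root_.sub_apply, _root_.smul_apply,
    ContinuousLinearMap.comp_apply, sub_smul]
  rw [sub_eq_sub_iff_add_eq_add] at h1 ⊢
  rw [add_comm, h1]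

end IsC0Semigroup

/-- A locally bounded family satisfying the resolvent identity is holomorphic. -/
theorem differentiableOn_of_resolvent_identity [CompleteSpace X] {U : Set ℂ} (hU : IsOpen U)
    {F : ℂ → X →L[ℂ] X}
    (hF : ∀ z ∈ U, ∀ w ∈ U, F z - F w = (w - z) • (F w).comp (F z))
    (hb : ∀ w ∈ U, ∃ C, ∀ᶠ z in 𝓝 w, ‖F z‖ ≤ C) : DifferentiableOn ℂ F U := by
  intro w hw
  have hUw : ∀ᶠ z in 𝓝 w, z ∈ U := hU.mem_nhds hw
  have hc : Tendsto F (𝓝 w) (𝓝 (F w)) := by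
    obtain ⟨C, hC⟩ := hb w hw
    refine tendsto_iff_norm_sub_tendsto_zero.2 ?_
    have hlim : Tendsto (fun z => ‖w - z‖ * (‖F w‖ * C)) (𝓝 w) (𝓝 0) := by
      have : Tendsto (fun z => ‖w - z‖) (𝓝 w) (𝓝 0) := by
        simpa using (tendsto_const_nhds (x := w) (f := 𝓝 w)).sub tendsto_id |>.norm
      simpa using this.mul_const (‖F w‖ * C)
    refine tendsto_of_tendsto_of_tendsto_of_le_of_le' tendsto_const_nhds hlim
      (Eventually.of_forall fun _ => norm_nonneg _) ?_
    filter_upwards [hC, hUw] with z hz hzU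
    rw [hF z hzU w hw, norm_smul]
    gcongr
    exact ((F w).opNorm_comp_le (F z)).trans (by gcongr)
  have hd : HasDerivAt F (-(F w).comp (F w)) w := by
    rw [hasDerivAt_iff_tendsto_slope]
    have h1 : Tendsto (fun z => -(F w).comp (F z)) (𝓝[≠] w) (𝓝 (-(F w).comp (F w))) := by
      have : Continuous fun T : X →L[ℂ] X => -(F w).comp T := by fun_prop
      exact (this.tendsto _).comp (hc.mono_left nhdsWithin_le_nhds)
    refine h1.congr' ?_
    filter_upwards [self_mem_nhdsWithin, mem_nhdsWithin_of_mem_nhds hUw] with z hz hzU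
    have hne : z - w ≠ 0 := sub_ne_zero.2 hz
    rw [slope_def_module, hF z hzU w hw, smul_smul, ← neg_sub z w, mul_neg, inv_mul_cancel₀ hne,
      neg_one_smul]
  exact hd.differentiableAt.differentiableWithinAt

end UnboundedOp

/-! ### The Fourier transform in the given normalisation: inversion, scaling, Plancherel. -/

namespace ScaledVariables

open scoped FourierTransform

/-! ### The Fourier transform on the plane -/

theorem fourierHat_eq (f : Plane → ℂ) (p : Plane) :
    fourierHat f p = 𝓕 f ((2 * Real.pi)⁻¹ • p) := by
  rw [fourierHat, Real.fourier_eq']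
  congr 1
  ext x
  rw [smul_eq_mul]
  congr 2
  rw [real_inner_smul_right]
  have : (Real.pi : ℂ) ≠ 0 := by exact_mod_cast Real.pi_ne_zero
  push_cast
  field_simp

theorem fourierInvHat_eq (h : Plane → ℂ) (x : Plane) :
    fourierInvHat h x = 𝓕⁻ (fun q : Plane => h ((2 * Real.pi) • q)) x := by
  have hpi : (Real.pi : ℂ) ≠ 0 := by exact_mod_cast Real.pi_ne_zero
  have e : ∀ q : Plane, Complex.exp (((2 * Real.pi * inner ℝ q x : ℝ) : ℂ) * Complex.I) •
      h ((2 * Real.pi) • q) = (fun p : Plane => Complex.exp (Complex.I * (inner ℝ x p : ℝ)) * h p)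
        ((2 * Real.pi) • q) := by
    intro q
    simp only [smul_eq_mul, real_inner_smul_right]
    congr 2
    rw [real_inner_comm]
    ring
  rw [Real.fourierInv_eq']
  simp_rw [e]
  refine Eq.trans ?_ (Measure.integral_comp_smul volume (fun p : Plane =>
    Complex.exp (Complex.I * (inner ℝ x p : ℝ)) * h p) (2 * Real.pi)).symm
  rw [fourierInvHat, ← Complex.coe_smul, smul_eq_mul]
  congr 1
  rw [abs_of_pos (by positivity)]
  simp
  ring

theorem integrable_exp_mul {f : Plane → ℂ} (hf : Integrable f) (p : Plane) :
    Integrable fun x : Plane => Complex.exp (-(Complex.I * (inner ℝ x p : ℝ))) * f x := by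
  refine hf.bdd_mul (c := 1) (Continuous.aestronglyMeasurable (by fun_prop))
    (Eventually.of_forall fun x => ?_)
  rw [Complex.norm_exp]
  simp

theorem norm_exp_neg_I_mul (t : ℝ) : ‖Complex.exp (-(Complex.I * (t : ℂ)))‖ = 1 := by
  rw [Complex.norm_exp]
  simp

theorem norm_exp_I_mul (t : ℝ) : ‖Complex.exp (Complex.I * (t : ℂ))‖ = 1 := by
  rw [Complex.norm_exp]
  simp

theorem fourierHat_congr_ae {f g : Plane → ℂ} (h : f =ᵐ[volume] g) :
    fourierHat f = fourierHat g := by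
  ext p
  refine integral_congr_ae ?_
  filter_upwards [h] with x hx
  rw [hx]

theorem continuous_fourierHat {f : Plane → ℂ} (hf : Integrable f) : Continuous (fourierHat f) := by
  refine continuous_of_dominated (bound := fun x => ‖f x‖) (fun p => ?_) (fun p => ?_) hf.norm ?_
  · exact (integrable_exp_mul hf p).aestronglyMeasurable
  · exact Eventually.of_forall fun x => by rw [norm_mul, norm_exp_neg_I_mul, one_mul]
  · exact Eventually.of_forall fun x => by fun_prop

theorem continuous_fourierInvHat {h : Plane → ℂ} (hh : Integrable h) :
    Continuous (fourierInvHat h) := by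
  refine continuous_const.mul (continuous_of_dominated (bound := fun x => ‖h x‖) (fun p => ?_)
    (fun p => ?_) hh.norm ?_)
  · exact (Continuous.aestronglyMeasurable (by fun_prop)).mul hh.aestronglyMeasurable
  · exact Eventually.of_forall fun x => by rw [norm_mul, norm_exp_I_mul, one_mul]
  · exact Eventually.of_forall fun x => by fun_prop

theorem fourierHat_zero (f : Plane → ℂ) : fourierHat f 0 = ∫ x, f x := by
  simp [fourierHat]

/-- The multiplication formula `∫ f̂ ψ = ∫ f ψ̂`. -/
theorem integral_fourierHat_mul {f ψ : Plane → ℂ} (hf : Integrable f) (hψ : Integrable ψ) :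
    ∫ p, fourierHat f p * ψ p = ∫ x, f x * fourierHat ψ x := by
  have hi : Integrable (Function.uncurry fun p x : Plane =>
      Complex.exp (-(Complex.I * (inner ℝ x p : ℝ))) * (ψ p * f x)) (volume.prod volume) := by
    refine (hψ.mul_prod hf).bdd_mul (c := 1) (Continuous.aestronglyMeasurable (by fun_prop))
      (Eventually.of_forall fun z => ?_)
    rw [norm_exp_neg_I_mul]
  have := integral_integral_swap hi
  calc ∫ p, fourierHat f p * ψ p
      = ∫ p, ∫ x, Complex.exp (-(Complex.I * (inner ℝ x p : ℝ))) * (ψ p * f x) := by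
        congr 1
        ext p
        rw [fourierHat, ← integral_mul_const]
        congr 1
        ext x
        ring
    _ = ∫ x, ∫ p, Complex.exp (-(Complex.I * (inner ℝ x p : ℝ))) * (ψ p * f x) := this
    _ = _ := by
        congr 1
        ext x
        rw [fourierHat, ← integral_const_mul]
        congr 1
        ext p
        rw [real_inner_comm]
        ring

theorem fourierHat_fourierInvHat {h : Plane → ℂ} (hc : Continuous h) (hi : Integrable h)
    (hi' : Integrable (fourierInvHat h)) : fourierHat (fourierInvHat h) = h := by
  have hpi : (2 * Real.pi) ≠ 0 := by positivity
  set k : Plane → ℂ := fun q => h ((2 * Real.pi) • q) with hk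
  have e : fourierInvHat h = 𝓕⁻ k := funext fun x => fourierInvHat_eq h x
  have hkc : Continuous k := hc.comp (by fun_prop)
  have hki : Integrable k := hi.comp_smul hpi
  have hki' : Integrable (𝓕 k) := by
    rw [e] at hi'
    have := hi'.comp_neg
    refine this.congr (Eventually.of_forall fun x => ?_)
    simp only [Real.fourierInv_eq_fourier_neg, neg_neg]
  ext p
  rw [fourierHat_eq, e, hkc.fourier_fourierInv_eq hki hki', hk]
  simp only [smul_smul, mul_inv_cancel₀ hpi, one_smul]

/-- Dilation of the plane as a linear homeomorphism. -/
def dilEquiv (c : ℝ) (hc : c ≠ 0) : Plane ≃L[ℝ] Plane :=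
  (LinearEquiv.smulOfNeZero ℝ Plane c hc).toContinuousLinearEquiv

theorem dilEquiv_apply (c : ℝ) (hc : c ≠ 0) (x : Plane) : dilEquiv c hc x = c • x := rfl

/-- Every Schwartz function is the Fourier transform of a Schwartz function. -/
theorem exists_schwartz_fourierHat_eq (φ : 𝓢(Plane, ℂ)) :
    ∃ ψ : 𝓢(Plane, ℂ), fourierHat ψ = φ := by
  have hpi : (2 * Real.pi) ≠ 0 := by positivity
  refine ⟨𝓕⁻ (SchwartzMap.compCLMOfContinuousLinearEquiv ℂ (dilEquiv _ hpi) φ), ?_⟩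
  ext p
  rw [fourierHat_eq, ← SchwartzMap.fourier_coe, FourierTransform.fourier_fourierInv_eq]
  simp only [SchwartzMap.compCLMOfContinuousLinearEquiv_apply, Function.comp_apply, dilEquiv_apply,
    smul_smul, mul_inv_cancel₀ hpi, one_smul]

/-- The Fourier transform of a Schwartz function is a Schwartz function. -/
theorem exists_schwartz_eq_fourierHat (ψ : 𝓢(Plane, ℂ)) :
    ∃ φ : 𝓢(Plane, ℂ), fourierHat ψ = φ := by
  have hpi : (2 * Real.pi)⁻¹ ≠ 0 := by positivity
  refine ⟨SchwartzMap.compCLMOfContinuousLinearEquiv ℂ (dilEquiv _ hpi) (𝓕 ψ), ?_⟩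
  ext p
  rw [fourierHat_eq, ← SchwartzMap.fourier_coe]
  simp only [SchwartzMap.compCLMOfContinuousLinearEquiv_apply, Function.comp_apply, dilEquiv_apply]

/-- A locally integrable function is determined by its integrals against Schwartz functions. -/
theorem ae_eq_of_integral_mul_schwartz {f g : Plane → ℂ} (hf : LocallyIntegrable f)
    (hg : LocallyIntegrable g) (h : ∀ φ : 𝓢(Plane, ℂ), ∫ x, f x * φ x = ∫ x, g x * φ x) :
    f =ᵐ[volume] g := by
  refine ae_eq_of_integral_contDiff_smul_eq hf hg fun ψ hψ hc => ?_
  have h1 : HasCompactSupport fun x => (ψ x : ℂ) := hc.comp_left (g := ((↑) : ℝ → ℂ)) (by simp)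
  have h2 : ContDiff ℝ ∞ fun x => (ψ x : ℂ) := Complex.ofRealCLM.contDiff.comp hψ
  simpa [mul_comm] using h (h1.toSchwartzMap h2)

theorem ae_eq_of_fourierHat_eq {f g : Plane → ℂ} (hf : Integrable f) (hg : Integrable g)
    (h : fourierHat f = fourierHat g) : f =ᵐ[volume] g := by
  refine ae_eq_of_integral_mul_schwartz hf.locallyIntegrable hg.locallyIntegrable fun φ => ?_
  obtain ⟨ψ, hψ⟩ := exists_schwartz_fourierHat_eq φ
  rw [← hψ, ← integral_fourierHat_mul hf ψ.integrable, ← integral_fourierHat_mul hg ψ.integrable, h]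

/-- The Fourier transform takes convolutions to products. -/
theorem fourierHat_convolution {f g : Plane → ℂ} (hf : Integrable f) (hg : Integrable g)
    (p : Plane) : fourierHat (convolution f g (ContinuousLinearMap.mul ℂ ℂ) volume) p =
      fourierHat f p * fourierHat g p := by
  simp only [fourierHat_eq]
  exact Real.fourier_mul_convolution_eq hf hg _

/-! ### Dilations and `Lᵖ` norms -/

theorem eLpNorm_comp_smul (f : Plane → ℂ) {c : ℝ} (hc : 0 < c) {q : ENNReal} (hq : q ≠ ⊤) :
    eLpNorm (fun x : Plane => f (c • x)) q volume =
      ENNReal.ofReal ((c ^ 2)⁻¹) ^ (1 / q).toReal * eLpNorm f q volume := by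
  have h := (measurableEmbedding_const_smul₀ (α := Plane) hc.ne').eLpNorm_map_measure
    (g := f) (p := q) (μ := volume)
  rw [Measure.map_addHaar_smul _ hc.ne', eLpNorm_smul_measure_of_ne_top hq] at h
  rw [finrank_euclideanSpace_fin, abs_of_pos (by positivity), smul_eq_mul] at h
  exact h.symm

theorem eLpNorm_two_comp_smul (f : Plane → ℂ) {c : ℝ} (hc : 0 < c) :
    eLpNorm (fun x : Plane => f (c • x)) 2 volume =
      ENNReal.ofReal c⁻¹ * eLpNorm f 2 volume := by
  rw [eLpNorm_comp_smul f hc (by simp)]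
  congr 1
  rw [ENNReal.ofReal_rpow_of_pos (by positivity)]
  congr 1
  rw [← inv_pow, ← Real.rpow_natCast, ← Real.rpow_mul (by positivity)]
  simp

theorem eLpNorm_one_comp_smul (f : Plane → ℂ) {c : ℝ} (hc : 0 < c) :
    eLpNorm (fun x : Plane => f (c • x)) 1 volume =
      ENNReal.ofReal (c ^ 2)⁻¹ * eLpNorm f 1 volume := by
  rw [eLpNorm_comp_smul f hc (by simp)]
  simp

/-! ### Plancherel's theorem for integrable functions -/

/-- The abstract `L²` transform is isometric. It agrees with the integral formula on `L¹ ∩ L²`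
because both define the same tempered distribution. -/
theorem eLpNorm_fourierInv_eq {k : Plane → ℂ} (h1 : Integrable k) (h2 : MemLp k 2 volume) :
    eLpNorm (𝓕⁻ k) 2 volume = eLpNorm k 2 volume := by
  set v : Lp ℂ 2 (volume : Measure Plane) := 𝓕⁻ (h2.toLp k) with hv
  have hn : ‖v‖ = ‖h2.toLp k‖ := by
    rw [← Lp.norm_fourier_eq v, hv, FourierTransform.fourier_fourierInv_eq]
  have hvk : (v : Plane → ℂ) =ᵐ[volume] 𝓕⁻ k := by
    refine ae_eq_of_integral_mul_schwartz ((Lp.memLp v).locallyIntegrable (by norm_num)) ?_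
      fun φ => ?_
    · refine Continuous.locallyIntegrable ?_
      rw [Real.fourierInv_eq_fourier_comp_neg]
      exact VectorFourier.fourierIntegral_continuous Real.continuous_fourierChar
        (by exact continuous_inner) h1.comp_neg
    · have e1 := congrArg (fun T => T φ) (Lp.fourierInv_toTemperedDistribution_eq (h2.toLp k))
      simp only [TemperedDistribution.fourierInv_apply, Lp.toTemperedDistribution_apply,
        smul_eq_mul] at e1
      calc ∫ x, v x * φ x = ∫ x, φ x * v x := by simp only [mul_comm]
        _ = ∫ x, (𝓕⁻ φ) x * (h2.toLp k) x := e1.symm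
        _ = ∫ x, k x * (𝓕⁻ φ) x := by
            refine integral_congr_ae ?_
            filter_upwards [h2.coeFn_toLp] with x hx
            rw [hx, mul_comm]
        _ = ∫ x, (𝓕⁻ k : Plane → ℂ) x * φ x := by
            have := VectorFourier.integral_fourierIntegral_smul_eq_flip (L := -innerₗ Plane)
              (μ := volume) (ν := volume) Real.continuous_fourierChar
              (by simpa using! continuous_inner.neg) h1 φ.integrable
            have a1 : VectorFourier.fourierIntegral Real.fourierChar volume (-innerₗ Plane) k =
                𝓕⁻ k := by
              ext x
              rw [Real.fourierInv_eq]
              simp [VectorFourier.fourierIntegral]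
            have a2 : VectorFourier.fourierIntegral Real.fourierChar volume (-innerₗ Plane).flip φ =
                𝓕⁻ (φ : Plane → ℂ) := by
              ext x
              rw [Real.fourierInv_eq]
              simp [VectorFourier.fourierIntegral, real_inner_comm]
            rw [a1, a2, ← SchwartzMap.fourierInv_coe] at this
            exact this.symm
  rw [← eLpNorm_congr_ae hvk, ← eLpNorm_congr_ae h2.coeFn_toLp]
  have := congrArg ENNReal.ofReal hn
  rw [Lp.norm_def, Lp.norm_def, ENNReal.ofReal_toReal (Lp.eLpNorm_ne_top _),
    ENNReal.ofReal_toReal (Lp.eLpNorm_ne_top _)] at this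
  exact this

theorem eLpNorm_fourierInvHat_eq {k : Plane → ℂ} (h1 : Integrable k) (h2 : MemLp k 2 volume) :
    eLpNorm (fourierInvHat k) 2 volume =
      ENNReal.ofReal (2 * Real.pi)⁻¹ * eLpNorm k 2 volume := by
  have hpi : 0 < 2 * Real.pi := by positivity
  have e : fourierInvHat k = 𝓕⁻ fun q : Plane => k ((2 * Real.pi) • q) :=
    funext fun x => fourierInvHat_eq k x
  have hm : AEStronglyMeasurable (fun q : Plane => k ((2 * Real.pi) • q)) volume :=
    (h1.comp_smul hpi.ne').aestronglyMeasurable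
  rw [e, eLpNorm_fourierInv_eq (h1.comp_smul hpi.ne'), eLpNorm_two_comp_smul k hpi]
  refine ⟨hm, ?_⟩
  rw [eLpNorm_two_comp_smul k hpi]
  exact ENNReal.mul_lt_top ENNReal.ofReal_lt_top h2.2

theorem eLpNorm_fourierInvHat_le {k : Plane → ℂ} (h1 : Integrable k) (h2 : MemLp k 2 volume) :
    eLpNorm (fourierInvHat k) 2 volume ≤ eLpNorm k 2 volume := by
  rw [eLpNorm_fourierInvHat_eq h1 h2]
  refine mul_le_of_le_one_left zero_le ?_
  rw [ENNReal.ofReal_le_one]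
  exact inv_le_one_of_one_le₀ (by nlinarith [Real.pi_gt_three])

theorem memLp_fourierInvHat {k : Plane → ℂ} (h1 : Integrable k) (h2 : MemLp k 2 volume) :
    MemLp (fourierInvHat k) 2 volume :=
  ⟨(continuous_fourierInvHat h1).aestronglyMeasurable,
    (eLpNorm_fourierInvHat_le h1 h2).trans_lt h2.2⟩

end ScaledVariables

/-! ### The space `L²(2)`: embeddings in weighted `L¹`, bounded operators, weak convergence. -/

namespace ScaledVariables

open scoped ENNReal NNReal

/-! ### Norms in `L²(2)` -/

/-- The weight `1 + |x|²`. -/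
def weight (x : Plane) : ℝ := 1 + ‖x‖ ^ 2

theorem weight_pos (x : Plane) : 0 < weight x := by
  unfold weight
  positivity

theorem continuous_weight : Continuous weight := by
  unfold weight
  fun_prop

theorem enorm_ofReal_mul {a : ℝ} (ha : 0 ≤ a) (z : ℂ) :
    ‖((a : ℝ) : ℂ) * z‖ₑ = ENNReal.ofReal a * ‖z‖ₑ := by
  rw [enorm_mul]
  congr 1
  rw [← ofReal_norm, Complex.norm_real, Real.norm_of_nonneg ha]

theorem eLpNorm_wMeasure (u : Plane → ℂ) :
    eLpNorm u 2 wMeasure = eLpNorm (fun x => ((weight x : ℝ) : ℂ) * u x) 2 volume := by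
  rw [eLpNorm_eq_lintegral_rpow_enorm_toReal (by simp) (by simp),
    eLpNorm_eq_lintegral_rpow_enorm_toReal (by simp) (by simp), wMeasure,
    lintegral_withDensity_eq_lintegral_mul_non_measurable _ (by fun_prop) (by simp)]
  congr 2
  ext x
  have hw : (0 : ℝ) ≤ 1 + ‖x‖ ^ 2 := by positivity
  rw [Pi.mul_apply, enorm_ofReal_mul (weight_pos x).le, ENNReal.mul_rpow_of_nonneg _ _ (by simp)]
  congr 1
  simp only [ENNReal.toReal_ofNat, ENNReal.rpow_ofNat]
  rw [← ENNReal.ofReal_pow (weight_pos x).le]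
  rfl

theorem aestronglyMeasurable_wMeasure {u : Plane → ℂ} (h : AEStronglyMeasurable u volume) :
    AEStronglyMeasurable u wMeasure :=
  h.mono_ac (withDensity_absolutelyContinuous _ _)

theorem coeFn_toLp_volume {u : Plane → ℂ} (h : MemLp u 2 wMeasure) :
    (h.toLp : Plane → ℂ) =ᵐ[volume] u :=
  ae_volume_iff.1 h.coeFn_toLp

theorem ext_volume {f g : L22} (h : (f : Plane → ℂ) =ᵐ[volume] g) : f = g :=
  Lp.ext (ae_volume_iff.2 h)

/-- Cauchy–Schwarz for `θ f = (θ / weight) · (weight f)`. -/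
theorem eLpNorm_one_mul_le (f : L22) {θ : Plane → ℝ} (hθ : Measurable θ) :
    eLpNorm (fun x => ((θ x : ℝ) : ℂ) * f x) 1 volume ≤
      eLpNorm (fun x => θ x / weight x) 2 volume * eLpNorm f 2 wMeasure := by
  have hf : AEStronglyMeasurable (fun x => ((weight x : ℝ) : ℂ) * f x) volume :=
    (Complex.continuous_ofReal.comp continuous_weight).aestronglyMeasurable.mul
      (Lp.stronglyMeasurable f).aestronglyMeasurable
  have hm : AEStronglyMeasurable (fun x => θ x / weight x) volume :=
    (hθ.div continuous_weight.measurable).aestronglyMeasurable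
  have := eLpNorm_smul_le_mul_eLpNorm (p := 2) (q := 2) (r := 1) hf hm
  rw [eLpNorm_wMeasure]
  refine le_trans (le_of_eq ?_) this
  congr 1
  ext x
  have : (weight x : ℂ) ≠ 0 := by exact_mod_cast (weight_pos x).ne'
  simp only [Pi.smul_apply', Complex.real_smul]
  push_cast
  field_simp

theorem memLp_two_inv_weight {s : ℝ} (hs : 1 < s) :
    MemLp (fun x : Plane => (1 + ‖x‖ ^ 2) ^ (-s / 2)) 2 volume := by
  have hm : AEStronglyMeasurable (fun x : Plane => ((1 : ℝ) + ‖x‖ ^ 2) ^ (-s / 2)) volume :=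
    Measurable.aestronglyMeasurable (by fun_prop)
  rw [memLp_two_iff_integrable_sq hm]
  have h4 : Integrable (fun x : Plane => ((1 : ℝ) + ‖x‖ ^ 2) ^ (-(2 * s) / 2)) volume :=
    integrable_rpow_neg_one_add_norm_sq (by simp; linarith)
  refine h4.congr (Eventually.of_forall fun x => ?_)
  have hw : (0 : ℝ) < 1 + ‖x‖ ^ 2 := by positivity
  simp only
  rw [← Real.rpow_mul_natCast hw.le]
  congr 1
  push_cast
  ring

/-- At infinity the square behaves like `|x|^{2s-4}`, which is integrable in the plane only for `s <
1`. The failure at `s = 1` is what forces the loss of `ε` in the decay rate. -/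
theorem memLp_two_rpow_div_weight {s : ℝ} (h0 : 0 ≤ s) (hs : s < 1) :
    MemLp (fun x : Plane => ‖x‖ ^ s / weight x) 2 volume := by
  refine (memLp_two_inv_weight (s := 2 - s) (by linarith)).mono'
    (Measurable.aestronglyMeasurable ?_) (Eventually.of_forall fun x => ?_)
  · exact Measurable.div (by fun_prop) continuous_weight.measurable
  have hw := weight_pos x
  rw [Real.norm_of_nonneg (div_nonneg (by positivity) hw.le), div_le_iff₀ hw]
  change ‖x‖ ^ s ≤ weight x ^ (-(2 - s) / 2) * weight x
  rw [← Real.rpow_add_one hw.ne', show -(2 - s) / 2 + 1 = s / 2 by ring]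
  have : ‖x‖ ^ s = (‖x‖ ^ 2) ^ (s / 2) := by
    rw [← Real.rpow_natCast, ← Real.rpow_mul (norm_nonneg x)]
    congr 1
    push_cast
    ring
  rw [this]
  refine Real.rpow_le_rpow (by positivity) ?_ (by linarith)
  unfold weight
  linarith

/-- The norm of the embedding of `L²(2)` in the space `L¹` with weight `|x|^s`. -/
def embConst (s : ℝ) : ℝ≥0∞ := eLpNorm (fun x : Plane => ‖x‖ ^ s / weight x) 2 volume

theorem embConst_ne_top {s : ℝ} (h0 : 0 ≤ s) (hs : s < 1) : embConst s ≠ ⊤ :=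
  (memLp_two_rpow_div_weight h0 hs).2.ne

theorem eLpNorm_one_rpow_le (f : L22) (s : ℝ) :
    eLpNorm (fun x => ((‖x‖ ^ s : ℝ) : ℂ) * f x) 1 volume ≤
      embConst s * eLpNorm f 2 wMeasure :=
  eLpNorm_one_mul_le f (by fun_prop)

theorem eLpNorm_one_le (f : L22) : eLpNorm f 1 volume ≤ embConst 0 * eLpNorm f 2 wMeasure := by
  simpa using eLpNorm_one_rpow_le f 0

theorem eLpNorm_coe_eq (f : L22) : eLpNorm f 2 wMeasure = ENNReal.ofReal ‖f‖ := by
  rw [Lp.norm_def, ENNReal.ofReal_toReal (Lp.eLpNorm_ne_top f)]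

theorem integral_norm_le (f : L22) : ∫ x, ‖f x‖ ≤ (embConst 0).toReal * ‖f‖ := by
  have h := eLpNorm_one_le f
  rw [eLpNorm_coe_eq] at h
  have h2 := ENNReal.toReal_mono
    (ENNReal.mul_ne_top (embConst_ne_top le_rfl one_pos) ENNReal.ofReal_ne_top) h
  rw [ENNReal.toReal_mul, ENNReal.toReal_ofReal (norm_nonneg f)] at h2
  refine le_trans (le_of_eq ?_) h2
  rw [eLpNorm_one_eq_lintegral_enorm, integral_norm_eq_lintegral_enorm
    (integrable_L22 f).aestronglyMeasurable]

/-! ### Construction of operators and functionals on `L²(2)` -/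

theorem exists_operator {Φ : L22 → Plane → ℂ} {C : ℝ} (hC : 0 ≤ C)
    (hm : ∀ f, AEStronglyMeasurable (Φ f) volume)
    (hadd : ∀ f g, Φ (f + g) =ᵐ[volume] fun x => Φ f x + Φ g x)
    (hsmul : ∀ (c : ℂ) f, Φ (c • f) =ᵐ[volume] fun x => c * Φ f x)
    (hb : ∀ f : L22, eLpNorm (Φ f) 2 wMeasure ≤ ENNReal.ofReal C * eLpNorm f 2 wMeasure) :
    ∃ T : L22 →L[ℂ] L22, (∀ f, (T f : Plane → ℂ) =ᵐ[volume] Φ f) ∧ ‖T‖ ≤ C := by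
  have hL : ∀ f, MemLp (Φ f) 2 wMeasure := fun f =>
    ⟨aestronglyMeasurable_wMeasure (hm f),
      (hb f).trans_lt (ENNReal.mul_lt_top ENNReal.ofReal_lt_top (Lp.memLp f).2)⟩
  let T₀ : L22 →ₗ[ℂ] L22 :=
    { toFun := fun f => (hL f).toLp
      map_add' := fun f g => ext_volume (by
        filter_upwards [coeFn_toLp_volume (hL (f + g)), coeFn_toLp_volume (hL f),
          coeFn_toLp_volume (hL g), hadd f g, coeFn_add_volume (hL f).toLp (hL g).toLp]
          with x h1 h2 h3 h4 h5
        rw [h1, h5, h2, h3, h4])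
      map_smul' := fun c f => ext_volume (by
        filter_upwards [coeFn_toLp_volume (hL (c • f)), coeFn_toLp_volume (hL f),
          hsmul c f, coeFn_smul_volume c (hL f).toLp] with x h1 h2 h3 h4
        rw [RingHom.id_apply, h1, h4, h2, h3]) }
  have hT : ∀ f, ‖T₀ f‖ ≤ C * ‖f‖ := fun f => by
    change ‖(hL f).toLp‖ ≤ _
    rw [Lp.norm_toLp, Lp.norm_def, ← ENNReal.toReal_ofReal hC, ← ENNReal.toReal_mul]
    exact ENNReal.toReal_mono (ENNReal.mul_ne_top ENNReal.ofReal_ne_top (Lp.eLpNorm_ne_top f)) (hb f)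
  exact ⟨T₀.mkContinuous C hT, fun f => coeFn_toLp_volume (hL f), T₀.mkContinuous_norm_le hC hT⟩

theorem integrable_mul_bounded (f : L22) {θ : Plane → ℂ} (hθ : AEStronglyMeasurable θ volume) {C : ℝ}
    (hC : ∀ x, ‖θ x‖ ≤ C) : Integrable (fun x => f x * θ x) (volume : Measure Plane) :=
  (integrable_L22 f).mul_bdd (c := C) hθ (Eventually.of_forall hC)

theorem exists_functional {θ : Plane → ℂ} (hθ : AEStronglyMeasurable θ volume) {C : ℝ}
    (hC : ∀ x, ‖θ x‖ ≤ C) :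
    ∃ l : L22 →L[ℂ] ℂ, (∀ f, l f = ∫ x, f x * θ x) ∧ ‖l‖ ≤ (embConst 0).toReal * C := by
  have hC0 : 0 ≤ C := (norm_nonneg _).trans (hC 0)
  let l₀ : L22 →ₗ[ℂ] ℂ :=
    { toFun := fun f => ∫ x, f x * θ x
      map_add' := fun f g => integral_add_mul f g (integrable_mul_bounded f hθ hC)
        (integrable_mul_bounded g hθ hC)
      map_smul' := fun c f => integral_smul_mul c f θ }
  have hb : ∀ f, ‖l₀ f‖ ≤ (embConst 0).toReal * C * ‖f‖ := fun f => by
    refine (norm_integral_le_of_norm_le ((integrable_L22 f).norm.mul_const C)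
      (Eventually.of_forall fun x => ?_)).trans ?_
    · rw [norm_mul]
      gcongr
      exact hC x
    · rw [integral_mul_const]
      nlinarith [integral_norm_le f]
  exact ⟨l₀.mkContinuous _ hb, fun f => rfl, l₀.mkContinuous_norm_le (by positivity) hb⟩

/-! ### The Fourier transform on `L²(2)` -/

/-- The Fourier transform of an element of `L²(2)`. -/
def hat (f : L22) : Plane → ℂ := fourierHat f

theorem continuous_hat (f : L22) : Continuous (hat f) := continuous_fourierHat (integrable_L22 f)

/-- Elements of `L²(2)` have continuous transforms, so the operator identities below reduce to
pointwise identities of multipliers and dilations. -/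
theorem hat_injective {f g : L22} (h : hat f = hat g) : f = g :=
  ext_volume (ae_eq_of_fourierHat_eq (integrable_L22 f) (integrable_L22 g) h)

theorem exists_hat_functional (p : Plane) :
    ∃ l : L22 →L[ℂ] ℂ, (∀ f, l f = hat f p) ∧ ‖l‖ ≤ (embConst 0).toReal := by
  obtain ⟨l, hl, hb⟩ := exists_functional
    (θ := fun x : Plane => Complex.exp (-(Complex.I * (inner ℝ x p : ℝ)))) (C := 1)
    (Continuous.aestronglyMeasurable (by fun_prop)) (fun x => (norm_exp_neg_I_mul _).le)
  refine ⟨l, fun f => ?_, by simpa using hb⟩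
  rw [hl, hat, fourierHat]
  simp only [mul_comm]

/-- Evaluation of the Fourier transform at a point. -/
def hatAt (p : Plane) : L22 →L[ℂ] ℂ := (exists_hat_functional p).choose

theorem hatAt_apply (p : Plane) (f : L22) : hatAt p f = hat f p :=
  (exists_hat_functional p).choose_spec.1 f

theorem norm_hat_le (f : L22) (p : Plane) : ‖hat f p‖ ≤ (embConst 0).toReal * ‖f‖ := by
  rw [← hatAt_apply]
  exact (hatAt p).le_of_opNorm_le (exists_hat_functional p).choose_spec.2 f

theorem hat_sub (f g : L22) (p : Plane) : hat (f - g) p = hat f p - hat g p := by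
  simp only [← hatAt_apply, map_sub]

theorem hat_smul (c : ℂ) (f : L22) (p : Plane) : hat (c • f) p = c * hat f p := by
  simp only [← hatAt_apply, map_smul, smul_eq_mul]

theorem hat_zero (f : L22) : hat f 0 = ∫ x, f x := fourierHat_zero f

theorem hat_toLp {u : Plane → ℂ} (h : MemLp u 2 wMeasure) : hat h.toLp = fourierHat u :=
  fourierHat_congr_ae (coeFn_toLp_volume h)

theorem integral_hat_mul (f : L22) {ψ : Plane → ℂ} (hψ : Integrable ψ) :
    ∫ p, hat f p * ψ p = ∫ x, f x * fourierHat ψ x :=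
  integral_fourierHat_mul (integrable_L22 f) hψ

theorem exists_schwartz_functional (φ : 𝓢(Plane, ℂ)) :
    ∃ l : L22 →L[ℂ] ℂ, ∀ f, l f = ∫ x, f x * φ x := by
  obtain ⟨C, -, hC⟩ := φ.decay 0 0
  simp only [pow_zero, norm_iteratedFDeriv_zero, one_mul] at hC
  obtain ⟨l, hl, -⟩ := exists_functional φ.continuous.aestronglyMeasurable hC
  exact ⟨l, hl⟩

/-! ### Weak convergence -/

/-- A bounded family in `L²(2)` which converges against Schwartz functions converges weakly. -/
theorem tendsto_inner_of_schwartz {ι : Type*} {l : Filter ι} {u : ι → L22} {v : L22} {M : ℝ}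
    (hM : ∀ᶠ i in l, ‖u i‖ ≤ M)
    (h : ∀ φ : 𝓢(Plane, ℂ), Tendsto (fun i => ∫ x, u i x * φ x) l (𝓝 (∫ x, v x * φ x)))
    (y : L22) : Tendsto (fun i => inner ℂ y (u i)) l (𝓝 (inner ℂ y v)) := by
  let W : Submodule ℂ L22 :=
    { carrier := {y | Tendsto (fun i => inner ℂ y (u i)) l (𝓝 (inner ℂ y v))}
      add_mem' := fun {a b} ha hb => by
        simp only [Set.mem_ofPred_eq, inner_add_left] at *
        exact ha.add hb
      zero_mem' := by simpa using tendsto_const_nhds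
      smul_mem' := fun c a ha => by
        simp only [Set.mem_ofPred_eq, inner_smul_left] at *
        exact ha.const_mul _ }
  -- The uniform bound on `u i` lets the limit pass to the closure.
  have hWc : IsClosed (W : Set L22) := by
    refine isClosed_of_closure_subset fun y hy => ?_
    change Tendsto (fun i => inner ℂ y (u i)) l (𝓝 (inner ℂ y v))
    rw [Metric.tendsto_nhds]
    intro ε hε
    have hM0 : 0 < |M| + ‖v‖ + 1 := by positivity
    obtain ⟨w, hw, hwy⟩ := Metric.mem_closure_iff.1 hy (ε / 2 / (|M| + ‖v‖ + 1)) (by positivity)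
    have hw' : Tendsto (fun i => inner ℂ w (u i)) l (𝓝 (inner ℂ w v)) := hw
    rw [Metric.tendsto_nhds] at hw'
    filter_upwards [hw' (ε / 2) (by positivity), hM] with i hi hMi
    rw [dist_eq_norm] at hi hwy ⊢
    have e : inner ℂ y (u i) - inner ℂ y v =
        (inner ℂ w (u i) - inner ℂ w v) + inner ℂ (y - w) (u i - v) := by
      simp only [inner_sub_left, inner_sub_right]
      ring
    rw [e]
    have h1 : ‖u i - v‖ ≤ |M| + ‖v‖ + 1 := by
      have := norm_sub_le (u i) v
      have := le_abs_self M
      linarith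
    have h2 : ‖inner ℂ (y - w) (u i - v)‖ ≤ ε / 2 := by
      refine (norm_inner_le_norm _ _).trans ?_
      calc ‖y - w‖ * ‖u i - v‖ ≤ (ε / 2 / (|M| + ‖v‖ + 1)) * (|M| + ‖v‖ + 1) := by
            gcongr
        _ = ε / 2 := by field_simp
    calc _ ≤ _ := norm_add_le _ _
      _ < ε / 2 + ε / 2 := add_lt_add_of_lt_of_le hi h2
      _ = ε := by ring
  have hWt : W.topologicalClosure = ⊤ := by
    rw [Submodule.topologicalClosure_eq_top_iff, Submodule.eq_bot_iff]
    intro z hz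
    have hz0 : ∀ φ : 𝓢(Plane, ℂ), ∫ x, z x * φ x = ∫ x, (0 : L22) x * φ x := fun φ => by
      obtain ⟨lφ, hlφ⟩ := exists_schwartz_functional φ
      -- By Riesz, each Schwartz functional is the inner product with an element of `W`. A vector
      -- orthogonal to `W` is therefore annihilated by every Schwartz function and vanishes.
      have hrep : ∀ f, inner ℂ ((InnerProductSpace.toDual ℂ L22).symm lφ) f = lφ f := fun f => by
        rw [InnerProductSpace.toDual_symm_apply]
      have hmem : (InnerProductSpace.toDual ℂ L22).symm lφ ∈ W := by
        change Tendsto _ _ _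
        simp only [hrep, hlφ]
        exact h φ
      have := (Submodule.mem_orthogonal W z).1 hz _ hmem
      rw [hrep] at this
      rw [← hlφ, ← hlφ, this, map_zero]
    exact ext_volume (ae_eq_of_integral_mul_schwartz (integrable_L22 z).locallyIntegrable
      (integrable_L22 0).locallyIntegrable hz0)
  have : y ∈ W.topologicalClosure := by rw [hWt]; trivial
  rw [IsClosed.submodule_topologicalClosure_eq hWc] at this
  exact this

theorem tendsto_integral_mul_schwartz_of_hat {ι : Type*} {l : Filter ι} [l.IsCountablyGenerated]
    {u : ι → L22} {v : L22} {M : ℝ} (hM : ∀ᶠ i in l, ‖u i‖ ≤ M)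
    (h : ∀ p, Tendsto (fun i => hat (u i) p) l (𝓝 (hat v p))) (φ : 𝓢(Plane, ℂ)) :
    Tendsto (fun i => ∫ x, u i x * φ x) l (𝓝 (∫ x, v x * φ x)) := by
  obtain ⟨ψ, hψ⟩ := exists_schwartz_fourierHat_eq φ
  simp only [← hψ, ← integral_hat_mul _ ψ.integrable]
  refine tendsto_integral_filter_of_dominated_convergence
    (fun p => (embConst 0).toReal * M * ‖ψ p‖) ?_ ?_ ?_ ?_
  · exact Eventually.of_forall fun i =>
      ((continuous_hat (u i)).mul ψ.continuous).aestronglyMeasurable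
  · filter_upwards [hM] with i hi
    refine Eventually.of_forall fun p => ?_
    rw [norm_mul]
    gcongr
    exact (norm_hat_le _ _).trans (by gcongr)
  · exact ψ.integrable.norm.const_mul _
  · exact Eventually.of_forall fun p => (h p).mul_const _

/-- A bounded family in `L²(2)` whose Fourier transforms converge pointwise converges weakly. -/
theorem tendsto_inner_of_hat {ι : Type*} {l : Filter ι} [l.IsCountablyGenerated]
    {u : ι → L22} {v : L22} {M : ℝ} (hM : ∀ᶠ i in l, ‖u i‖ ≤ M)
    (h : ∀ p, Tendsto (fun i => hat (u i) p) l (𝓝 (hat v p))) (y : L22) :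
    Tendsto (fun i => inner ℂ y (u i)) l (𝓝 (inner ℂ y v)) :=
  tendsto_inner_of_schwartz hM (tendsto_integral_mul_schwartz_of_hat hM h) y

end ScaledVariables

/-! ### Young's inequality, dilations and convolutions on `L²(2)`. -/

namespace ScaledVariables

open scoped ENNReal NNReal

/-! ### Young's inequality -/

/-- Cauchy–Schwarz for the functions `1` and `B (x - ·)` with respect to the measure `A dt`. -/
theorem lintegral_mul_sub_sq_le {A B : Plane → ℝ≥0∞} (hA : Measurable A) (hB : Measurable B)
    (x : Plane) : (∫⁻ t, A t * B (x - t)) ^ (2 : ℝ) ≤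
      (∫⁻ t, A t) * ∫⁻ t, A t * B (x - t) ^ (2 : ℝ) := by
  have hBx : Measurable fun t => B (x - t) := hB.comp (by fun_prop)
  have h := ENNReal.lintegral_mul_le_Lp_mul_Lq (volume.withDensity A) Real.HolderConjugate.two_two
    (f := fun _ => 1) (g := fun t => B (x - t)) aemeasurable_const hBx.aemeasurable
  simp only [Pi.mul_apply, one_mul, ENNReal.one_rpow, lintegral_const] at h
  rw [withDensity_apply _ MeasurableSet.univ, Measure.restrict_univ,
    lintegral_withDensity_eq_lintegral_mul _ hA hBx,
    lintegral_withDensity_eq_lintegral_mul _ hA (hBx.pow_const 2)] at h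
  have h2 := ENNReal.rpow_le_rpow h (zero_le_two (α := ℝ))
  rw [ENNReal.mul_rpow_of_nonneg _ _ zero_le_two, ← ENNReal.rpow_mul, ← ENNReal.rpow_mul] at h2
  simpa using h2

theorem eLpNorm_lintegral_mul_sub_le {A B : Plane → ℝ≥0∞} (hA : Measurable A) (hB : Measurable B) :
    eLpNorm (fun x => ∫⁻ t, A t * B (x - t)) 2 volume ≤ (∫⁻ t, A t) * eLpNorm B 2 volume := by
  have hAB : Measurable (Function.uncurry fun x t : Plane => A t * B (x - t) ^ (2 : ℝ)) := by
    refine (hA.comp measurable_snd).mul (Measurable.pow_const ?_ 2)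
    exact hB.comp (measurable_fst.sub measurable_snd)
  rw [eLpNorm_eq_lintegral_rpow_enorm_toReal (by simp) (by simp),
    eLpNorm_eq_lintegral_rpow_enorm_toReal (by simp) (by simp)]
  simp only [ENNReal.toReal_ofNat, enorm_eq_self]
  have key : ∫⁻ x, (∫⁻ t, A t * B (x - t)) ^ (2 : ℝ) ≤
      (∫⁻ t, A t) ^ (2 : ℝ) * ∫⁻ x, B x ^ (2 : ℝ) := by
    calc ∫⁻ x, (∫⁻ t, A t * B (x - t)) ^ (2 : ℝ)
        ≤ ∫⁻ x, (∫⁻ t, A t) * ∫⁻ t, A t * B (x - t) ^ (2 : ℝ) :=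
          lintegral_mono fun x => lintegral_mul_sub_sq_le hA hB x
      _ = (∫⁻ t, A t) * ∫⁻ x, ∫⁻ t, A t * B (x - t) ^ (2 : ℝ) :=
          lintegral_const_mul _ hAB.lintegral_prod_right'
      _ = (∫⁻ t, A t) * ∫⁻ t, ∫⁻ x, A t * B (x - t) ^ (2 : ℝ) := by
          rw [lintegral_lintegral_swap hAB.aemeasurable]
      _ = (∫⁻ t, A t) * ∫⁻ t, A t * ∫⁻ x, B x ^ (2 : ℝ) := by
          congr 2
          ext t
          have hBt : Measurable fun x => B (x - t) ^ (2 : ℝ) :=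
            (hB.comp (measurable_sub_const t)).pow_const 2
          rw [lintegral_const_mul _ hBt]
          congr 1
          exact lintegral_sub_right_eq_self (fun x => B x ^ (2 : ℝ)) t
      _ = _ := by
          rw [lintegral_mul_const _ hA, ← mul_assoc, ENNReal.rpow_two, sq]
  refine (ENNReal.rpow_le_rpow key (by norm_num)).trans_eq ?_
  rw [ENNReal.mul_rpow_of_nonneg _ _ (by norm_num), ← ENNReal.rpow_mul]
  norm_num

theorem lintegral_mul_sub_comm (A B : Plane → ℝ≥0∞) (x : Plane) :
    ∫⁻ t, A t * B (x - t) = ∫⁻ t, B t * A (x - t) := by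
  rw [← lintegral_sub_left_eq_self _ x]
  simp only [sub_sub_cancel, mul_comm]

theorem eLpNorm_lintegral_mul_sub_le' {A B : Plane → ℝ≥0∞} (hA : Measurable A)
    (hB : Measurable B) :
    eLpNorm (fun x => ∫⁻ t, A t * B (x - t)) 2 volume ≤ eLpNorm A 2 volume * ∫⁻ t, B t := by
  simp only [lintegral_mul_sub_comm A B]
  exact (eLpNorm_lintegral_mul_sub_le hB hA).trans_eq (mul_comm _ _)

theorem measurable_lintegral_mul_sub {A B : Plane → ℝ≥0∞} (hA : Measurable A)
    (hB : Measurable B) : Measurable fun x => ∫⁻ t, A t * B (x - t) := by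
  refine Measurable.lintegral_prod_right' (f := fun z : Plane × Plane => A z.2 * B (z.1 - z.2)) ?_
  exact (hA.comp measurable_snd).mul (hB.comp (measurable_fst.sub measurable_snd))

/-! ### Dilations -/

theorem eLpNorm_dil_le (f : Plane → ℂ) {c : ℝ} (hc : 0 < c) :
    eLpNorm (fun x : Plane => ((c ^ 2 : ℝ) : ℂ) * f (c • x)) 2 wMeasure ≤
      ENNReal.ofReal (max c c⁻¹) * eLpNorm f 2 wMeasure := by
  rw [eLpNorm_wMeasure, eLpNorm_wMeasure]
  have h := eLpNorm_two_comp_smul (fun x => ((weight x : ℝ) : ℂ) * f x) hc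
  -- Pointwise, `c² weight(x) ≤ max(c², 1) weight(cx)`. The substitution in the `L²` norm
  -- contributes `c⁻¹`, and `max(c², 1) c⁻¹ = max(c, c⁻¹)`.
  have h2 : eLpNorm (fun x : Plane => ((weight x : ℝ) : ℂ) * (((c ^ 2 : ℝ) : ℂ) * f (c • x))) 2
      volume ≤ ENNReal.ofReal (max (c ^ 2) 1) *
        eLpNorm (fun x : Plane => ((weight (c • x) : ℝ) : ℂ) * f (c • x)) 2 volume := by
    refine eLpNorm_le_mul_eLpNorm_of_ae_le_mul (Eventually.of_forall fun x => ?_) 2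
    simp only [norm_mul, Complex.norm_real, Real.norm_of_nonneg (weight_pos _).le,
      Real.norm_of_nonneg (sq_nonneg c)]
    rw [← mul_assoc, ← mul_assoc]
    refine mul_le_mul_of_nonneg_right ?_ (norm_nonneg _)
    unfold weight
    rw [norm_smul, Real.norm_of_nonneg hc.le, mul_pow]
    have h1 := le_max_left (c ^ 2) 1
    have h2 := le_max_right (c ^ 2) 1
    have h3 : 0 ≤ c ^ 2 * ‖x‖ ^ 2 := by positivity
    nlinarith
  refine h2.trans ?_
  rw [h, ← mul_assoc, ← ENNReal.ofReal_mul (by positivity)]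
  gcongr
  rw [max_mul_of_nonneg _ _ (by positivity), one_mul]
  apply le_of_eq
  congr 1
  field_simp

theorem ae_comp_smul {c : ℝ} (hc : 0 < c) {P : Plane → Prop} (h : ∀ᵐ x ∂(volume : Measure Plane), P x) :
    ∀ᵐ x ∂(volume : Measure Plane), P (c • x) := by
  have hq : Measure.QuasiMeasurePreserving (fun x : Plane => c • x) volume volume := by
    refine ⟨measurable_const_smul c, ?_⟩
    rw [Measure.map_addHaar_smul _ hc.ne']
    exact Measure.smul_absolutelyContinuous
  exact hq.ae h

theorem exists_dil {c : ℝ} (hc : 0 < c) :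
    ∃ T : L22 →L[ℂ] L22, (∀ f : L22, (T f : Plane → ℂ) =ᵐ[volume]
      fun x => ((c ^ 2 : ℝ) : ℂ) * f (c • x)) ∧ ‖T‖ ≤ max c c⁻¹ := by
  refine exists_operator (Φ := fun f x => ((c ^ 2 : ℝ) : ℂ) * f (c • x)) (by positivity)
    (fun f => ?_) (fun f g => ?_) (fun a f => ?_) (fun f => eLpNorm_dil_le f hc)
  · exact ((Lp.stronglyMeasurable f).comp_measurable
      (measurable_const_smul c)).aestronglyMeasurable.const_mul _
  · filter_upwards [ae_comp_smul hc (coeFn_add_volume f g)] with x hx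
    rw [hx, mul_add]
  · filter_upwards [ae_comp_smul hc (coeFn_smul_volume a f)] with x hx
    rw [hx]
    ring

open Classical in
/-- The dilation `f ↦ c² f(c ·)` on `L²(2)`. -/
def dil (c : ℝ) : L22 →L[ℂ] L22 := if h : 0 < c then (exists_dil h).choose else 0

theorem coeFn_dil {c : ℝ} (hc : 0 < c) (f : L22) :
    (dil c f : Plane → ℂ) =ᵐ[volume] fun x => ((c ^ 2 : ℝ) : ℂ) * f (c • x) := by
  rw [dil, dif_pos hc]
  exact (exists_dil hc).choose_spec.1 f

theorem norm_dil_le {c : ℝ} (hc : 0 < c) : ‖dil c‖ ≤ max c c⁻¹ := by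
  rw [dil, dif_pos hc]
  exact (exists_dil hc).choose_spec.2

theorem norm_dil_apply_le {c : ℝ} (hc : 0 < c) (f : L22) : ‖dil c f‖ ≤ max c c⁻¹ * ‖f‖ :=
  (dil c).le_of_opNorm_le (norm_dil_le hc) f

theorem hat_dil {c : ℝ} (hc : 0 < c) (f : L22) (p : Plane) :
    hat (dil c f) p = hat f (c⁻¹ • p) := by
  rw [hat, fourierHat_congr_ae (coeFn_dil hc f), hat, fourierHat, fourierHat]
  have h := Measure.integral_comp_smul volume (fun x : Plane =>
    ((c ^ 2 : ℝ) : ℂ) * (Complex.exp (-(Complex.I * (inner ℝ x (c⁻¹ • p) : ℝ))) * f x)) c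
  rw [integral_const_mul, integral_const_mul, finrank_euclideanSpace_fin,
    abs_of_pos (by positivity), ← Complex.coe_smul, smul_eq_mul, ← mul_assoc, ← Complex.ofReal_mul,
    inv_mul_cancel₀ (by positivity), Complex.ofReal_one, one_mul] at h
  rw [← h, ← integral_const_mul]
  congr 1
  ext x
  rw [real_inner_smul_left, real_inner_smul_right, ← mul_assoc c, mul_inv_cancel₀ hc.ne', one_mul]
  ring

theorem dil_dil {b c : ℝ} (hb : 0 < b) (hc : 0 < c) (f : L22) :
    dil b (dil c f) = dil (b * c) f := by
  refine hat_injective (funext fun p => ?_)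
  rw [hat_dil hb, hat_dil hc, hat_dil (mul_pos hb hc), smul_smul, mul_inv, mul_comm]

/-- Weak convergence together with convergence of norms gives strong convergence. -/
theorem tendsto_of_inner_of_norm_le {ι : Type*} {l : Filter ι} {u : ι → L22} {v : L22}
    {m : ι → ℝ} (hw : ∀ y, Tendsto (fun i => inner ℂ y (u i)) l (𝓝 (inner ℂ y v)))
    (hm : ∀ᶠ i in l, ‖u i‖ ≤ m i * ‖v‖) (h1 : Tendsto m l (𝓝 1)) : Tendsto u l (𝓝 v) := by
  rw [tendsto_iff_norm_sub_tendsto_zero]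
  have hre : Tendsto (fun i => RCLike.re (inner ℂ v (u i))) l (𝓝 (‖v‖ ^ 2)) := by
    have := (RCLike.continuous_re.tendsto _).comp (hw v)
    rw [inner_self_eq_norm_sq] at this
    exact this
  have hlim : Tendsto (fun i => Real.sqrt ((m i * ‖v‖) ^ 2 - 2 * RCLike.re (inner ℂ v (u i)) +
      ‖v‖ ^ 2)) l (𝓝 0) := by
    have := ((((h1.mul_const ‖v‖).pow 2).sub (hre.const_mul 2)).add_const (‖v‖ ^ 2)).sqrt
    convert this using 2
    rw [show (1 * ‖v‖) ^ 2 - 2 * ‖v‖ ^ 2 + ‖v‖ ^ 2 = 0 by ring, Real.sqrt_zero]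
  refine tendsto_of_tendsto_of_tendsto_of_le_of_le' tendsto_const_nhds hlim
    (Eventually.of_forall fun _ => norm_nonneg _) ?_
  filter_upwards [hm] with i hi
  refine Real.le_sqrt_of_sq_le ?_
  rw [@norm_sub_sq ℂ, ← inner_conj_symm (u i) v, RCLike.conj_re]
  have : ‖u i‖ ^ 2 ≤ (m i * ‖v‖) ^ 2 := by gcongr
  linarith

/-- The transforms converge pointwise, which gives weak convergence. The operator bound `max(c,
c⁻¹)` tends to `1`, and this upgrades it to convergence in norm. -/
theorem tendsto_dil_one (f : L22) : Tendsto (fun c => dil c f) (𝓝 1) (𝓝 f) := by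
  have hpos : ∀ᶠ c : ℝ in 𝓝 1, 0 < c := lt_mem_nhds one_pos
  have hmax : Tendsto (fun c : ℝ => max c c⁻¹) (𝓝 1) (𝓝 1) := by
    have : Tendsto (fun c : ℝ => max c c⁻¹) (𝓝 1) (𝓝 (max 1 1⁻¹)) :=
      tendsto_id.max (tendsto_id.inv₀ one_ne_zero)
    simpa using this
  have hle : ∀ᶠ c : ℝ in 𝓝 1, ‖dil c f‖ ≤ max c c⁻¹ * ‖f‖ := by
    filter_upwards [hpos] with c hc
    exact norm_dil_apply_le hc f
  refine tendsto_of_inner_of_norm_le (fun y => ?_) hle hmax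
  refine tendsto_inner_of_hat (M := 2 * ‖f‖) ?_ (fun p => ?_) y
  · filter_upwards [hle, hmax.eventually (ge_mem_nhds one_lt_two)] with c h1 h2
    exact h1.trans (by gcongr)
  · have h2 : Tendsto (fun c : ℝ => hat f (c⁻¹ • p)) (𝓝 1) (𝓝 (hat f ((1 : ℝ)⁻¹ • p))) :=
      ((continuous_hat f).tendsto _).comp ((tendsto_id.inv₀ one_ne_zero).smul_const p)
    rw [inv_one, one_smul] at h2
    refine h2.congr' ?_
    filter_upwards [hpos] with c hc
    rw [hat_dil hc]

theorem tendsto_dil {c : ℝ} (hc : 0 < c) (f : L22) :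
    Tendsto (fun b => dil b f) (𝓝 c) (𝓝 (dil c f)) := by
  have h1 : Tendsto (fun b : ℝ => b / c) (𝓝 c) (𝓝 1) := by
    simpa [hc.ne'] using (tendsto_id (x := 𝓝 c)).div_const c
  refine ((tendsto_dil_one (dil c f)).comp h1).congr' ?_
  filter_upwards [lt_mem_nhds hc] with b hb
  rw [Function.comp_apply, dil_dil (div_pos hb hc) hc, div_mul_cancel₀ _ hc.ne']

theorem eLpNorm_one_dil {c : ℝ} (hc : 0 < c) (f : L22) :
    eLpNorm (dil c f) 1 volume = eLpNorm f 1 volume := by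
  rw [eLpNorm_congr_ae (coeFn_dil hc f)]
  have h := eLpNorm_const_smul ((c ^ 2 : ℝ) : ℂ) (fun x : Plane => f (c • x)) 1 volume
  simp only [Pi.smul_def, smul_eq_mul] at h
  rw [h, eLpNorm_one_comp_smul _ hc, ← ofReal_norm, Complex.norm_real,
    Real.norm_of_nonneg (by positivity), ← mul_assoc, ← ENNReal.ofReal_mul (by positivity),
    mul_inv_cancel₀ (by positivity), ENNReal.ofReal_one, one_mul]

theorem eLpNorm_sq_dil {c : ℝ} (hc : 0 < c) (f : L22) :
    eLpNorm (fun x => ((‖x‖ ^ 2 : ℝ) : ℂ) * dil c f x) 2 volume =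
      ENNReal.ofReal c⁻¹ * eLpNorm (fun x => ((‖x‖ ^ 2 : ℝ) : ℂ) * f x) 2 volume := by
  rw [← eLpNorm_two_comp_smul _ hc]
  refine eLpNorm_congr_ae ?_
  filter_upwards [coeFn_dil hc f] with x hx
  rw [hx, norm_smul, mul_pow, Real.norm_of_nonneg hc.le]
  push_cast
  ring

theorem eLpNorm_rpow_one_dil {c : ℝ} (hc : 0 < c) (f : L22) (s : ℝ) :
    eLpNorm (fun x => ((‖x‖ ^ s : ℝ) : ℂ) * dil c f x) 1 volume =
      ENNReal.ofReal (c ^ (-s)) * eLpNorm (fun x => ((‖x‖ ^ s : ℝ) : ℂ) * f x) 1 volume := by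
  have h0 := eLpNorm_one_comp_smul (fun x => ((‖x‖ ^ s : ℝ) : ℂ) * f x) hc
  have h := eLpNorm_const_smul ((c ^ (-s) * c ^ 2 : ℝ) : ℂ)
    (fun x : Plane => ((‖c • x‖ ^ s : ℝ) : ℂ) * f (c • x)) 1 volume
  simp only [Pi.smul_def, smul_eq_mul] at h
  rw [h0, ← ofReal_norm, Complex.norm_real, Real.norm_of_nonneg (by positivity), ← mul_assoc,
    ← ENNReal.ofReal_mul (by positivity), mul_assoc, mul_inv_cancel₀ (by positivity), mul_one] at h
  rw [← h]
  refine eLpNorm_congr_ae ?_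
  filter_upwards [coeFn_dil hc f] with x hx
  rw [hx, norm_smul, Real.norm_of_nonneg hc.le, Real.mul_rpow hc.le (norm_nonneg x),
    Real.rpow_neg hc.le]
  have : ((c ^ s : ℝ) : ℂ) ≠ 0 := by exact_mod_cast (Real.rpow_pos_of_pos hc s).ne'
  push_cast at this ⊢
  field_simp

/-! ### Convolutions -/

theorem eLpNorm_two_le (f : L22) : eLpNorm f 2 volume ≤ eLpNorm f 2 wMeasure := by
  rw [eLpNorm_wMeasure]
  refine eLpNorm_mono fun x => ?_
  rw [norm_mul, Complex.norm_real, Real.norm_of_nonneg (weight_pos x).le]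
  refine le_mul_of_one_le_left (norm_nonneg _) ?_
  unfold weight
  nlinarith [sq_nonneg ‖x‖]

theorem memLp_two_volume (f : L22) : MemLp f 2 volume :=
  ⟨(Lp.stronglyMeasurable f).aestronglyMeasurable, (eLpNorm_two_le f).trans_lt (Lp.memLp f).2⟩

theorem eLpNorm_sq_le (f : L22) :
    eLpNorm (fun x => ((‖x‖ ^ 2 : ℝ) : ℂ) * f x) 2 volume ≤ eLpNorm f 2 wMeasure := by
  rw [eLpNorm_wMeasure]
  refine eLpNorm_mono fun x => ?_
  rw [norm_mul, norm_mul, Complex.norm_real, Complex.norm_real,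
    Real.norm_of_nonneg (weight_pos x).le, Real.norm_of_nonneg (sq_nonneg _)]
  gcongr
  unfold weight
  linarith

theorem integrable_conv (K h : L22) (x : Plane) :
    Integrable (fun t => h t * K (x - t)) (volume : Measure Plane) := by
  have h2 : MemLp (fun t => K (x - t)) 2 volume :=
    (memLp_two_volume K).comp_measurePreserving (Measure.measurePreserving_sub_left volume x)
  exact (memLp_two_volume h).integrable_mul h2

/-- The convolution of two elements of `L²(2)`, as a function. -/
def convFun (K h : L22) (x : Plane) : ℂ := ∫ t, h t * K (x - t)

theorem convFun_eq (K h : L22) :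
    convFun K h = convolution h K (ContinuousLinearMap.mul ℂ ℂ) volume := rfl

theorem integrable_convFun (K h : L22) : Integrable (convFun K h) volume :=
  (integrable_L22 h).integrable_convolution (ContinuousLinearMap.mul ℂ ℂ) (integrable_L22 K)

theorem enorm_convFun_le (K h : L22) (x : Plane) :
    ‖convFun K h x‖ₑ ≤ ∫⁻ t, ‖h t‖ₑ * ‖K (x - t)‖ₑ := by
  refine (enorm_integral_le_lintegral_enorm _).trans_eq ?_
  simp only [enorm_mul]

theorem measurable_enorm_coe (f : L22) : Measurable fun x => ‖f x‖ₑ :=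
  (Lp.stronglyMeasurable f).measurable.enorm

theorem measurable_enorm_mul_coe (f : L22) {θ : Plane → ℝ} (hθ : Measurable θ) :
    Measurable fun x => ‖((θ x : ℝ) : ℂ) * f x‖ₑ :=
  ((Complex.measurable_ofReal.comp hθ).mul (Lp.stronglyMeasurable f).measurable).enorm

theorem measurable_weight : Measurable weight := continuous_weight.measurable

theorem enorm_weight_mul_convFun_le (K h : L22) (x : Plane) :
    ‖((weight x : ℝ) : ℂ) * convFun K h x‖ₑ ≤
      2 * ((∫⁻ t, ‖((weight t : ℝ) : ℂ) * h t‖ₑ * ‖K (x - t)‖ₑ) +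
        ∫⁻ t, ‖h t‖ₑ * ‖((‖x - t‖ ^ 2 : ℝ) : ℂ) * K (x - t)‖ₑ) := by
  have hK : Measurable fun t => ‖K (x - t)‖ₑ := (measurable_enorm_coe K).comp (by fun_prop)
  have hW : Measurable fun t => ‖((weight t : ℝ) : ℂ) * h t‖ₑ * ‖K (x - t)‖ₑ :=
    (measurable_enorm_mul_coe h measurable_weight).mul hK
  have hH : Measurable fun t => ‖h t‖ₑ * ‖K (x - t)‖ₑ := (measurable_enorm_coe h).mul hK
  rw [enorm_ofReal_mul (weight_pos x).le, ← lintegral_add_left hW]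
  have hm : Measurable fun t => ‖((weight t : ℝ) : ℂ) * h t‖ₑ * ‖K (x - t)‖ₑ +
      ‖h t‖ₑ * ‖((‖x - t‖ ^ 2 : ℝ) : ℂ) * K (x - t)‖ₑ :=
    ((measurable_enorm_mul_coe h measurable_weight).mul hK).add ((measurable_enorm_coe h).mul
      ((measurable_enorm_mul_coe K (θ := fun x => ‖x‖ ^ 2) (by fun_prop)).comp
        (measurable_const_sub x)))
  refine (mul_le_mul_right (enorm_convFun_le K h x) _).trans ?_
  rw [← lintegral_const_mul _ hH, ← lintegral_const_mul _ hm]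
  refine lintegral_mono fun t => ?_
  rw [enorm_ofReal_mul (weight_pos t).le, enorm_ofReal_mul (sq_nonneg _)]
  have hw : weight x ≤ 2 * (weight t + ‖x - t‖ ^ 2) := by
    unfold weight
    have h1 : ‖x‖ ≤ ‖t‖ + ‖x - t‖ := by
      calc ‖x‖ = ‖t + (x - t)‖ := by rw [add_sub_cancel]
        _ ≤ _ := norm_add_le _ _
    nlinarith [norm_nonneg x, norm_nonneg t, norm_nonneg (x - t), sq_nonneg (‖t‖ - ‖x - t‖)]
  calc ENNReal.ofReal (weight x) * (‖h t‖ₑ * ‖K (x - t)‖ₑ)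
      ≤ ENNReal.ofReal (2 * (weight t + ‖x - t‖ ^ 2)) * (‖h t‖ₑ * ‖K (x - t)‖ₑ) := by
        gcongr
    _ = _ := by
        rw [ENNReal.ofReal_mul zero_le_two, ENNReal.ofReal_add (weight_pos t).le (sq_nonneg _)]
        simp only [ENNReal.ofReal_ofNat]
        ring

/-- The splitting `weight x ≤ 2 (weight t + |x - t|²)` is deliberately asymmetric. The kernel enters
only through `‖K‖₁`, invariant under `dil b`, and `‖|x|² K‖₂`, which `dil b` multiplies by `b⁻¹`.
The bound therefore stays uniform when the kernel concentrates. -/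
theorem eLpNorm_convFun_le (K h : L22) :
    eLpNorm (convFun K h) 2 wMeasure ≤ 2 * (eLpNorm h 2 wMeasure * eLpNorm K 1 volume +
      eLpNorm h 1 volume * eLpNorm (fun x => ((‖x‖ ^ 2 : ℝ) : ℂ) * K x) 2 volume) := by
  have m1 := measurable_enorm_mul_coe h measurable_weight
  have m2 := measurable_enorm_mul_coe K (θ := fun x => ‖x‖ ^ 2) (by fun_prop)
  rw [eLpNorm_wMeasure]
  refine (eLpNorm_le_mul_eLpNorm_of_ae_le_mul' (c := 2) (g := fun x =>
    (∫⁻ t, ‖((weight t : ℝ) : ℂ) * h t‖ₑ * ‖K (x - t)‖ₑ) +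
      ∫⁻ t, ‖h t‖ₑ * ‖((‖x - t‖ ^ 2 : ℝ) : ℂ) * K (x - t)‖ₑ) (Eventually.of_forall fun x => ?_)
      2).trans ?_
  · rw [enorm_eq_self]
    exact enorm_weight_mul_convFun_le K h x
  refine mul_le_mul_right ((eLpNorm_add_le
    (measurable_lintegral_mul_sub m1 (measurable_enorm_coe K)).aestronglyMeasurable
    (measurable_lintegral_mul_sub (measurable_enorm_coe h) m2).aestronglyMeasurable
    one_le_two).trans (add_le_add ?_ ?_)) _
  · refine (eLpNorm_lintegral_mul_sub_le' m1 (measurable_enorm_coe K)).trans_eq ?_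
    rw [eLpNorm_wMeasure, eLpNorm_one_eq_lintegral_enorm, eLpNorm_enorm]
  · refine (eLpNorm_lintegral_mul_sub_le (measurable_enorm_coe h) m2).trans_eq ?_
    rw [eLpNorm_one_eq_lintegral_enorm, eLpNorm_enorm]

/-- The constant in `‖K * h‖ ≤ C ‖K‖ ‖h‖`. -/
def convConst : ℝ := 4 * (embConst 0).toReal

theorem convConst_nonneg : 0 ≤ convConst := by
  unfold convConst
  positivity

theorem eLpNorm_convFun_le_mul (K h : L22) :
    eLpNorm (convFun K h) 2 wMeasure ≤ ENNReal.ofReal (convConst * ‖K‖) * eLpNorm h 2 wMeasure := by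
  refine (eLpNorm_convFun_le K h).trans ?_
  have h1 := eLpNorm_one_le K
  have h2 := eLpNorm_one_le h
  have h3 := eLpNorm_sq_le K
  calc _ ≤ 2 * (eLpNorm h 2 wMeasure * (embConst 0 * eLpNorm K 2 wMeasure) +
        embConst 0 * eLpNorm h 2 wMeasure * eLpNorm K 2 wMeasure) := by gcongr
    _ = 4 * embConst 0 * eLpNorm K 2 wMeasure * eLpNorm h 2 wMeasure := by ring
    _ = _ := by
        rw [convConst, ENNReal.ofReal_mul (by positivity), ENNReal.ofReal_mul (by positivity),
          ENNReal.ofReal_toReal (embConst_ne_top le_rfl one_pos), eLpNorm_coe_eq K]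
        simp

theorem exists_conv (K : L22) :
    ∃ T : L22 →L[ℂ] L22, (∀ h, (T h : Plane → ℂ) =ᵐ[volume] convFun K h) ∧
      ‖T‖ ≤ convConst * ‖K‖ := by
  refine exists_operator (mul_nonneg convConst_nonneg (norm_nonneg K))
    (fun h => (integrable_convFun K h).aestronglyMeasurable) (fun f g => ?_) (fun c f => ?_)
    (eLpNorm_convFun_le_mul K)
  · refine Eventually.of_forall fun x => ?_
    change ∫ t, _ = (∫ t, _) + ∫ t, _
    rw [← integral_add (integrable_conv K f x) (integrable_conv K g x)]
    refine integral_congr_ae ?_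
    filter_upwards [coeFn_add_volume f g] with t ht
    rw [ht, add_mul]
  · refine Eventually.of_forall fun x => ?_
    change ∫ t, _ = c * ∫ t, _
    rw [← integral_const_mul]
    refine integral_congr_ae ?_
    filter_upwards [coeFn_smul_volume c f] with t ht
    rw [ht, mul_assoc]

/-- Convolution with `K` on `L²(2)`. -/
def conv (K : L22) : L22 →L[ℂ] L22 := (exists_conv K).choose

theorem coeFn_conv (K h : L22) : (conv K h : Plane → ℂ) =ᵐ[volume] convFun K h :=
  (exists_conv K).choose_spec.1 h

theorem norm_conv_le (K h : L22) : ‖conv K h‖ ≤ convConst * ‖K‖ * ‖h‖ :=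
  (conv K).le_of_opNorm_le (exists_conv K).choose_spec.2 h

theorem hat_conv (K h : L22) (p : Plane) : hat (conv K h) p = hat K p * hat h p := by
  rw [hat, fourierHat_congr_ae (coeFn_conv K h), convFun_eq,
    fourierHat_convolution (integrable_L22 h) (integrable_L22 K), mul_comm]
  rfl

theorem conv_comm (K h : L22) : conv K h = conv h K :=
  hat_injective (funext fun p => by rw [hat_conv, hat_conv, mul_comm])

theorem tendsto_conv {ι : Type*} {l : Filter ι} {K h : ι → L22} {K₀ h₀ : L22}
    (hK : Tendsto K l (𝓝 K₀)) (hh : Tendsto h l (𝓝 h₀)) :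
    Tendsto (fun i => conv (K i) (h i)) l (𝓝 (conv K₀ h₀)) := by
  rw [tendsto_iff_norm_sub_tendsto_zero]
  have hlim : Tendsto (fun i => convConst * ‖K i‖ * ‖h i - h₀‖ + convConst * ‖h₀‖ * ‖K i - K₀‖) l
      (𝓝 0) := by
    have h1 := (hK.norm.const_mul convConst).mul (tendsto_iff_norm_sub_tendsto_zero.1 hh)
    have h2 := (tendsto_iff_norm_sub_tendsto_zero.1 hK).const_mul (convConst * ‖h₀‖)
    simpa using h1.add h2
  refine squeeze_zero (fun _ => norm_nonneg _) (fun i => ?_) hlim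
  -- Commutativity of `conv` replaces linearity in the kernel, which has not been established
  -- separately.
  have e : conv (K i) (h i) - conv K₀ h₀ = conv (K i) (h i - h₀) + conv h₀ (K i - K₀) := by
    rw [map_sub, map_sub, conv_comm h₀, conv_comm h₀]
    abel
  rw [e]
  exact (norm_add_le _ _).trans (add_le_add (norm_conv_le _ _) (norm_conv_le _ _))

theorem norm_conv_le_of_norms (K h : L22) :
    ‖conv K h‖ ≤ 2 * (‖h‖ * (eLpNorm K 1 volume).toReal +
      (embConst 0).toReal * ‖h‖ *
        (eLpNorm (fun x => ((‖x‖ ^ 2 : ℝ) : ℂ) * K x) 2 volume).toReal) := by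
  have h1 : eLpNorm K 1 volume ≠ ⊤ := ((eLpNorm_one_le K).trans_lt
    (ENNReal.mul_lt_top (embConst_ne_top le_rfl one_pos).lt_top (Lp.memLp K).2)).ne
  have h2 : eLpNorm (fun x => ((‖x‖ ^ 2 : ℝ) : ℂ) * K x) 2 volume ≠ ⊤ :=
    ((eLpNorm_sq_le K).trans_lt (Lp.memLp K).2).ne
  have key : ENNReal.ofReal ‖conv K h‖ ≤ ENNReal.ofReal (2 * (‖h‖ * (eLpNorm K 1 volume).toReal +
      (embConst 0).toReal * ‖h‖ *
        (eLpNorm (fun x => ((‖x‖ ^ 2 : ℝ) : ℂ) * K x) 2 volume).toReal)) := by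
    rw [← eLpNorm_coe_eq, eLpNorm_congr_ae (ae_volume_iff.2 (coeFn_conv K h))]
    refine (eLpNorm_convFun_le K h).trans ?_
    rw [ENNReal.ofReal_mul zero_le_two, ENNReal.ofReal_add (by positivity) (by positivity),
      ENNReal.ofReal_mul (norm_nonneg h), ENNReal.ofReal_mul (by positivity),
      ENNReal.ofReal_mul (by positivity), ENNReal.ofReal_toReal h1, ENNReal.ofReal_toReal h2,
      ENNReal.ofReal_toReal (embConst_ne_top le_rfl one_pos), ← eLpNorm_coe_eq h,
      ENNReal.ofReal_ofNat]
    gcongr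
    exact eLpNorm_one_le h
  exact (ENNReal.ofReal_le_ofReal_iff (by positivity)).1 key

end ScaledVariables

/-! ### Symbols with a singularity at the origin and the weighted norms of their inverse transforms.
-/

namespace ScaledVariables

open scoped ENNReal NNReal

/-! ### Derivatives along coordinate lines avoiding the origin -/

/-- `h'` is the derivative of `h` in the `j`-th direction away from the origin. -/
def IsLineDerivOffZero (j : Fin 2) (h h' : Plane → ℂ) : Prop :=
  ∀ p : Plane, p ≠ 0 →
    HasDerivAt (fun t : ℝ => h (p + t • EuclideanSpace.single j (1 : ℝ))) (h' p) 0

/-- The point of the plane whose `j`-th coordinate is `t` and whose other coordinate is `s`. -/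
def linePoint (j : Fin 2) (z : ℝ × ℝ) : Plane :=
  WithLp.toLp 2 (if j = 0 then ![z.1, z.2] else ![z.2, z.1])

theorem linePoint_add (j : Fin 2) (r s t : ℝ) :
    linePoint j (r, s) + t • EuclideanSpace.single j (1 : ℝ) = linePoint j (r + t, s) := by
  ext i
  fin_cases j <;> fin_cases i <;> simp [linePoint]

theorem linePoint_ne_zero (j : Fin 2) (r : ℝ) {s : ℝ} (hs : s ≠ 0) : linePoint j (r, s) ≠ 0 := by
  intro h
  have h0 := congrArg (fun v : Plane => v 0) h
  have h1 := congrArg (fun v : Plane => v 1) h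
  fin_cases j <;> simp [linePoint] at h0 h1
  · exact hs h1
  · exact hs h0

theorem measurePreserving_linePoint (j : Fin 2) :
    MeasurePreserving (linePoint j) (volume.prod volume) volume := by
  have h1 := ((volume_preserving_finTwoArrow ℝ).symm _).trans
    ((EuclideanSpace.volume_preserving_symm_measurableEquiv_toLp (Fin 2)).symm _)
  fin_cases j
  · exact h1
  · exact h1.comp (Measure.measurePreserving_swap (μ := (volume : Measure ℝ))
      (ν := (volume : Measure ℝ)))

theorem measurableEmbedding_linePoint (j : Fin 2) : MeasurableEmbedding (linePoint j) := by
  have h1 := ((MeasurableEquiv.finTwoArrow (α := ℝ)).symm.trans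
    (MeasurableEquiv.toLp 2 (Fin 2 → ℝ))).measurableEmbedding
  fin_cases j
  · exact h1
  · exact h1.comp (MeasurableEquiv.prodComm (α := ℝ) (β := ℝ)).measurableEmbedding

/-- A derivative along coordinate lines avoiding the origin has integral zero. -/
theorem integral_eq_zero_of_isLineDerivOffZero {j : Fin 2} {h h' : Plane → ℂ}
    (hi : Integrable h) (hi' : Integrable h') (hd : IsLineDerivOffZero j h h') :
    ∫ p, h' p = 0 := by
  have hmp := measurePreserving_linePoint j
  have hme := measurableEmbedding_linePoint j
  have g := (hmp.integrable_comp_emb hme).2 hi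
  have g' := (hmp.integrable_comp_emb hme).2 hi'
  rw [← hmp.integral_comp hme]
  refine (integral_prod_symm _ g').trans (integral_eq_zero_of_ae ?_)
  -- Almost every line parallel to the axis misses the origin. There the function is differentiable
  -- everywhere, and the integral of its derivative over the line is zero.
  have hne : ∀ᵐ s : ℝ, s ≠ 0 := by simp [ae_iff]
  filter_upwards [hne, g.prod_left_ae, g'.prod_left_ae] with s hs h1 h2
  refine integral_eq_zero_of_hasDerivAt_of_integrable (f := fun t => h (linePoint j (t, s)))
    (fun r => ?_) h2 h1
  have := hd _ (linePoint_ne_zero j r hs)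
  simp only [linePoint_add] at this
  have h3 := HasDerivAt.comp_const_add (-r) r (by simpa using this)
  simpa using h3

theorem IsLineDerivOffZero.mul {j : Fin 2} {f f' g g' : Plane → ℂ}
    (hf : IsLineDerivOffZero j f f') (hg : IsLineDerivOffZero j g g') :
    IsLineDerivOffZero j (fun p => f p * g p) (fun p => f' p * g p + f p * g' p) := fun p hp => by
  have h := (hf p hp).fun_mul (hg p hp)
  simp only [zero_smul, add_zero] at h
  exact h

theorem isLineDerivOffZero_exp (j : Fin 2) (x : Plane) :
    IsLineDerivOffZero j (fun p => Complex.exp (Complex.I * (inner ℝ x p : ℝ)))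
      (fun p => Complex.I * (x j : ℝ) * Complex.exp (Complex.I * (inner ℝ x p : ℝ))) := by
  intro p _
  have h1 : HasDerivAt (fun t : ℝ => inner ℝ x (p + t • EuclideanSpace.single j (1 : ℝ)))
      (x j) 0 := by
    have e : (fun t : ℝ => inner ℝ x (p + t • EuclideanSpace.single j (1 : ℝ))) =
        fun t => inner ℝ x p + t * x j := by
      ext t
      rw [inner_add_right, real_inner_smul_right, EuclideanSpace.inner_single_right]
      simp
    rw [e]
    simpa using ((hasDerivAt_id (0 : ℝ)).mul_const (x j)).const_add (inner ℝ x p)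
  have h2 := ((h1.ofReal_comp).const_mul Complex.I).cexp
  convert h2 using 1
  simp only [zero_smul, add_zero]
  ring

/-- Integration by parts: the derivative of `e^{ix·p} h(p)` has integral zero. The possible
singularity of `h` at the origin contributes nothing. -/
theorem fourierInvHat_lineDeriv {j : Fin 2} {h h' : Plane → ℂ} (hi : Integrable h)
    (hi' : Integrable h') (hd : IsLineDerivOffZero j h h') (x : Plane) :
    fourierInvHat h' x = -(Complex.I * (x j : ℝ)) * fourierInvHat h x := by
  have hE : ∀ {k : Plane → ℂ}, Integrable k →
      Integrable fun p : Plane => Complex.exp (Complex.I * (inner ℝ x p : ℝ)) * k p := fun hk =>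
    hk.bdd_mul (c := 1) (Continuous.aestronglyMeasurable (by fun_prop))
      (Eventually.of_forall fun p => (norm_exp_I_mul _).le)
  have hE1 : Integrable fun p : Plane =>
      Complex.I * (x j : ℝ) * Complex.exp (Complex.I * (inner ℝ x p : ℝ)) * h p := by
    simpa only [mul_assoc] using ((hE hi).const_mul (x j : ℂ)).const_mul Complex.I
  have h0 := integral_eq_zero_of_isLineDerivOffZero (hE hi) (hE1.add (hE hi'))
    ((isLineDerivOffZero_exp j x).mul hd)
  simp only [Pi.add_apply] at h0
  rw [integral_add hE1 (hE hi')] at h0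
  simp only [mul_assoc] at h0
  rw [integral_const_mul, integral_const_mul] at h0
  unfold fourierInvHat
  linear_combination (((2 * Real.pi : ℝ) : ℂ)⁻¹ ^ 2) * h0

/-! ### Functions built from monomials, powers of `|p|`, and `e^{-|p|^α}` -/

/-- The function `p₁^a p₂^b |p|^w e^{-|p|^α}`. -/
def basicSymbol (α : ℝ) (a b : ℕ) (w : ℂ) (p : Plane) : ℂ :=
  ((p 0 : ℝ) : ℂ) ^ a * ((p 1 : ℝ) : ℂ) ^ b * ((‖p‖ : ℝ) : ℂ) ^ w *
    ((Real.exp (-(‖p‖ ^ α)) : ℝ) : ℂ)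

theorem measurable_basicSymbol (α : ℝ) (a b : ℕ) (w : ℂ) : Measurable (basicSymbol α a b w) := by
  unfold basicSymbol
  fun_prop

theorem abs_coord_le (p : Plane) (i : Fin 2) : |p i| ≤ ‖p‖ := by
  simpa using PiLp.norm_apply_le p i

theorem norm_basicSymbol_le (α : ℝ) (a b : ℕ) (w : ℂ) {p : Plane} (hp : p ≠ 0) :
    ‖basicSymbol α a b w p‖ ≤ ‖p‖ ^ (a + b + w.re) * Real.exp (-(‖p‖ ^ α)) := by
  have hp' : 0 < ‖p‖ := norm_pos_iff.2 hp
  unfold basicSymbol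
  rw [norm_mul, norm_mul, norm_mul, norm_pow, norm_pow, Complex.norm_real, Complex.norm_real,
    Complex.norm_real, Complex.norm_cpow_eq_rpow_re_of_pos hp', Real.norm_of_nonneg
    (Real.exp_pos _).le, Real.rpow_add hp', Real.rpow_add hp', Real.rpow_natCast,
    Real.rpow_natCast]
  gcongr
  · exact abs_coord_le p 0
  · exact abs_coord_le p 1

theorem integrable_rpow_mul_exp {α : ℝ} (hα : 0 < α) {b d : ℝ} (hb : 0 < b) (hd : -2 < d) :
    Integrable fun p : Plane => ‖p‖ ^ d * Real.exp (-b * ‖p‖ ^ α) := by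
  refine (integrable_fun_norm_addHaar volume
    (f := fun y : ℝ => y ^ d * Real.exp (-b * y ^ α))).2 ?_
  refine (integrableOn_rpow_mul_exp_neg_mul_rpow (s := d + 1) (by linarith) hα hb).congr_fun
    (fun y hy => ?_) measurableSet_Ioi
  have hy' : (0 : ℝ) < y := hy
  simp only [finrank_euclideanSpace_fin, Nat.add_one_sub_one, pow_one, smul_eq_mul]
  rw [Real.rpow_add_one hy'.ne']
  ring

theorem ae_ne_zero : ∀ᵐ p : Plane, p ≠ 0 := by simp [ae_iff]

theorem integrable_basicSymbol {α : ℝ} (hα : 0 < α) {a b : ℕ} {w : ℂ} (hd : -2 < a + b + w.re) :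
    Integrable (basicSymbol α a b w) := by
  refine (integrable_rpow_mul_exp hα one_pos hd).mono'
    (measurable_basicSymbol α a b w).aestronglyMeasurable ?_
  filter_upwards [ae_ne_zero] with p hp
  simpa using norm_basicSymbol_le α a b w hp

theorem memLp_rpow_mul_basicSymbol {α : ℝ} (hα : 0 < α) {a b : ℕ} {w : ℂ}
    (hd : -1 < a + b + w.re) {s : ℝ} (hs : 0 ≤ s) :
    MemLp (fun p => ((‖p‖ ^ s : ℝ) : ℂ) * basicSymbol α a b w p) 2 volume := by
  have hm : Measurable fun p => ((‖p‖ ^ s : ℝ) : ℂ) * basicSymbol α a b w p :=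
    Measurable.mul (by fun_prop) (measurable_basicSymbol α a b w)
  rw [memLp_two_iff_integrable_sq_norm hm.aestronglyMeasurable]
  refine (integrable_rpow_mul_exp hα two_pos (d := 2 * (s + (a + b + w.re)))
    (by linarith)).mono' (hm.norm.pow_const 2).aestronglyMeasurable ?_
  filter_upwards [ae_ne_zero] with p hp
  have hp' : 0 < ‖p‖ := norm_pos_iff.2 hp
  rw [Real.norm_of_nonneg (sq_nonneg _), norm_mul, Complex.norm_real,
    Real.norm_of_nonneg (by positivity)]
  calc (‖p‖ ^ s * ‖basicSymbol α a b w p‖) ^ 2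
      ≤ (‖p‖ ^ s * (‖p‖ ^ (a + b + w.re) * Real.exp (-(‖p‖ ^ α)))) ^ 2 := by
        gcongr
        exact norm_basicSymbol_le α a b w hp
    _ = _ := by
        rw [← mul_assoc, ← Real.rpow_add hp', mul_pow, ← Real.exp_nat_mul,
          ← Real.rpow_mul_natCast hp'.le]
        congr 2
        · push_cast
          ring
        · push_cast
          ring

theorem hasDerivAt_norm_line (j : Fin 2) {p : Plane} (hp : p ≠ 0) :
    HasDerivAt (fun t : ℝ => ‖p + t • EuclideanSpace.single j (1 : ℝ)‖) (p j / ‖p‖) 0 := by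
  have hp' : 0 < ‖p‖ := norm_pos_iff.2 hp
  have h1 : HasDerivAt (fun t : ℝ => p + t • EuclideanSpace.single j (1 : ℝ))
      (EuclideanSpace.single j (1 : ℝ)) 0 := by
    simpa using ((hasDerivAt_id (0 : ℝ)).smul_const
      (EuclideanSpace.single j (1 : ℝ) : Plane)).const_add p
  have h2 := h1.norm_sq.sqrt (by simp [hp])
  simp only [Real.sqrt_sq (norm_nonneg _)] at h2
  convert h2 using 1
  rw [zero_smul, add_zero, EuclideanSpace.inner_single_right]
  simp
  field_simp

theorem hasDerivAt_coord_line (i j : Fin 2) (p : Plane) :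
    HasDerivAt (fun t : ℝ => (((p + t • EuclideanSpace.single j (1 : ℝ)) i : ℝ) : ℂ))
      (if i = j then 1 else 0) 0 := by
  have h1 : HasDerivAt (fun t : ℝ => (p + t • EuclideanSpace.single j (1 : ℝ)) i)
      (if i = j then 1 else 0) 0 := by
    have e : (fun t : ℝ => (p + t • EuclideanSpace.single j (1 : ℝ)) i) =
        fun t => p i + t * (if i = j then 1 else 0) := by
      ext t
      simp
    rw [e]
    simpa using ((hasDerivAt_id (0 : ℝ)).mul_const (if i = j then (1 : ℝ) else 0)).const_add (p i)
  convert h1.ofReal_comp using 1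
  split_ifs <;> simp

/-- Writing the derivative with `p_j |p|^{w-2}` and `p_j |p|^{w+α-2}` keeps it a combination of
basic symbols. -/
theorem hasDerivAt_radial_line (j : Fin 2) (α : ℝ) (w : ℂ) {p : Plane} (hp : p ≠ 0) :
    HasDerivAt (fun t : ℝ => ((‖p + t • EuclideanSpace.single j (1 : ℝ)‖ : ℝ) : ℂ) ^ w *
        ((Real.exp (-(‖p + t • EuclideanSpace.single j (1 : ℝ)‖ ^ α)) : ℝ) : ℂ))
      ((p j : ℝ) * (w * ((‖p‖ : ℝ) : ℂ) ^ (w - 2) - α * ((‖p‖ : ℝ) : ℂ) ^ (w + α - 2)) *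
        ((Real.exp (-(‖p‖ ^ α)) : ℝ) : ℂ)) 0 := by
  have hp' : 0 < ‖p‖ := norm_pos_iff.2 hp
  have hpc : ((‖p‖ : ℝ) : ℂ) ≠ 0 := by exact_mod_cast hp'.ne'
  have hn := hasDerivAt_norm_line j hp
  have h1 : HasDerivAt (fun t : ℝ => ((‖p + t • EuclideanSpace.single j (1 : ℝ)‖ : ℝ) : ℂ) ^ w)
      (w * ((‖p‖ : ℝ) : ℂ) ^ (w - 1) * ((p j / ‖p‖ : ℝ) : ℂ)) 0 := by
    have h0 : HasDerivAt (fun z : ℂ => z ^ w)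
        (w * ((‖p + (0 : ℝ) • EuclideanSpace.single j (1 : ℝ)‖ : ℝ) : ℂ) ^ (w - 1))
        ((‖p + (0 : ℝ) • EuclideanSpace.single j (1 : ℝ)‖ : ℝ) : ℂ) := by
      rw [zero_smul, add_zero]
      simpa using (hasDerivAt_id ((‖p‖ : ℝ) : ℂ)).cpow_const (c := w)
        (Complex.ofReal_mem_slitPlane.2 hp')
    have := HasDerivAt.comp (h := fun t : ℝ =>
      ((‖p + t • EuclideanSpace.single j (1 : ℝ)‖ : ℝ) : ℂ)) (0 : ℝ) h0 hn.ofReal_comp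
    rw [zero_smul, add_zero] at this
    exact this
  have h2 : HasDerivAt
      (fun t : ℝ => Real.exp (-(‖p + t • EuclideanSpace.single j (1 : ℝ)‖ ^ α)))
      (Real.exp (-(‖p‖ ^ α)) * -(p j / ‖p‖ * α * ‖p‖ ^ (α - 1))) 0 := by
    have := (hn.rpow_const (p := α) (by simp [hp])).neg.exp
    simpa using this
  have h3 := h1.mul h2.ofReal_comp
  refine h3.congr_deriv ?_
  rw [zero_smul, add_zero]
  have e1 : ((‖p‖ : ℝ) : ℂ) ^ (w - 1) = ((‖p‖ : ℝ) : ℂ) ^ (w - 2) * ((‖p‖ : ℝ) : ℂ) := by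
    nth_rewrite 3 [← Complex.cpow_one ((‖p‖ : ℝ) : ℂ)]
    rw [← Complex.cpow_add _ _ hpc]
    ring_nf
  have e2 : ((‖p‖ : ℝ) : ℂ) ^ w * (((‖p‖ ^ (α - 1) : ℝ)) : ℂ) =
      ((‖p‖ : ℝ) : ℂ) ^ (w + α - 2) * ((‖p‖ : ℝ) : ℂ) := by
    rw [Complex.ofReal_cpow hp'.le, ← Complex.cpow_add _ _ hpc]
    nth_rewrite 3 [← Complex.cpow_one ((‖p‖ : ℝ) : ℂ)]
    rw [← Complex.cpow_add _ _ hpc]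
    push_cast
    ring_nf
  push_cast
  rw [e1]
  have e3 : ((‖p‖ : ℝ) : ℂ) ^ w * (Complex.exp (-((‖p‖ ^ α : ℝ) : ℂ)) *
      -((p j : ℂ) / (‖p‖ : ℂ) * α * ((‖p‖ ^ (α - 1) : ℝ) : ℂ))) =
      -(Complex.exp (-((‖p‖ ^ α : ℝ) : ℂ)) * ((p j : ℂ) / (‖p‖ : ℂ) * α *
        (((‖p‖ : ℝ) : ℂ) ^ (w + α - 2) * ((‖p‖ : ℝ) : ℂ)))) := by
    rw [← e2]
    ring
  rw [e3]
  field_simp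
  ring

theorem isLineDerivOffZero_basicSymbol_zero (α : ℝ) (a b : ℕ) (w : ℂ) :
    IsLineDerivOffZero 0 (basicSymbol α a b w) (fun p => a * basicSymbol α (a - 1) b w p +
      (w * basicSymbol α (a + 1) b (w - 2) p +
        -α * basicSymbol α (a + 1) b (w + α - 2) p)) := by
  intro p hp
  have h := (((hasDerivAt_coord_line 0 0 p).fun_pow a).fun_mul
    ((hasDerivAt_coord_line 1 0 p).fun_pow b)).fun_mul (hasDerivAt_radial_line 0 α w hp)
  have e : (fun t : ℝ => basicSymbol α a b w (p + t • EuclideanSpace.single 0 (1 : ℝ))) =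
      fun t : ℝ => (((p + t • EuclideanSpace.single 0 (1 : ℝ) : Plane) 0 : ℝ) : ℂ) ^ a *
        (((p + t • EuclideanSpace.single 0 (1 : ℝ) : Plane) 1 : ℝ) : ℂ) ^ b *
        (((‖p + t • EuclideanSpace.single 0 (1 : ℝ)‖ : ℝ) : ℂ) ^ w *
        ((Real.exp (-(‖p + t • EuclideanSpace.single 0 (1 : ℝ)‖ ^ α)) : ℝ) : ℂ)) := by
    ext t
    rw [basicSymbol, mul_assoc]
  rw [e]
  refine h.congr_deriv ?_
  simp only [basicSymbol, zero_smul, add_zero, if_true, one_ne_zero, if_false]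
  ring

theorem isLineDerivOffZero_basicSymbol_one (α : ℝ) (a b : ℕ) (w : ℂ) :
    IsLineDerivOffZero 1 (basicSymbol α a b w) (fun p => b * basicSymbol α a (b - 1) w p +
      (w * basicSymbol α a (b + 1) (w - 2) p +
        -α * basicSymbol α a (b + 1) (w + α - 2) p)) := by
  intro p hp
  have h := (((hasDerivAt_coord_line 0 1 p).fun_pow a).fun_mul
    ((hasDerivAt_coord_line 1 1 p).fun_pow b)).fun_mul (hasDerivAt_radial_line 1 α w hp)
  have e : (fun t : ℝ => basicSymbol α a b w (p + t • EuclideanSpace.single 1 (1 : ℝ))) =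
      fun t : ℝ => (((p + t • EuclideanSpace.single 1 (1 : ℝ) : Plane) 0 : ℝ) : ℂ) ^ a *
        (((p + t • EuclideanSpace.single 1 (1 : ℝ) : Plane) 1 : ℝ) : ℂ) ^ b *
        (((‖p + t • EuclideanSpace.single 1 (1 : ℝ)‖ : ℝ) : ℂ) ^ w *
        ((Real.exp (-(‖p + t • EuclideanSpace.single 1 (1 : ℝ)‖ ^ α)) : ℝ) : ℂ)) := by
    ext t
    rw [basicSymbol, mul_assoc]
  rw [e]
  refine h.congr_deriv ?_
  simp only [basicSymbol, zero_smul, add_zero, if_true, zero_ne_one, if_false]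
  ring

/-- Linear combinations of functions `p₁^a p₂^b |p|^w e^{-|p|^α}` with `a + b + Re w ≥ d`, and of
functions `p₁^a p₂^b e^{-|p|^α}` if `d ≤ α`. -/
inductive IsSymbol (α d : ℝ) : (Plane → ℂ) → Prop
  | basic (a b : ℕ) (w : ℂ) (h : d ≤ a + b + w.re) : IsSymbol α d (basicSymbol α a b w)
  | poly (a b : ℕ) (h : d ≤ α) : IsSymbol α d (basicSymbol α a b 0)
  | add (f g : Plane → ℂ) (hf : IsSymbol α d f) (hg : IsSymbol α d g) :
      IsSymbol α d fun p => f p + g p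
  | const_mul (c : ℂ) (f : Plane → ℂ) (hf : IsSymbol α d f) : IsSymbol α d fun p => c * f p

namespace IsSymbol

variable {α d : ℝ} {h : Plane → ℂ}

theorem integrable (hα : 0 < α) (hh : IsSymbol α d h) (hd : -2 < d) : Integrable h := by
  induction hh with
  | basic a b w h => exact integrable_basicSymbol hα (hd.trans_le h)
  | poly a b h =>
    refine integrable_basicSymbol hα ?_
    simp only [Complex.zero_re, add_zero]
    have : (0 : ℝ) ≤ a + b := by positivity
    linarith
  | add f g hf hg ihf ihg => exact ihf.add ihg
  | const_mul c f hf ih => exact ih.const_mul c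

theorem memLp (hα : 0 < α) (hh : IsSymbol α d h) (hd : -1 < d) {s : ℝ} (hs : 0 ≤ s) :
    MemLp (fun p => ((‖p‖ ^ s : ℝ) : ℂ) * h p) 2 volume := by
  induction hh with
  | basic a b w h => exact memLp_rpow_mul_basicSymbol hα (hd.trans_le h) hs
  | poly a b h =>
    refine memLp_rpow_mul_basicSymbol hα ?_ hs
    simp only [Complex.zero_re, add_zero]
    have : (0 : ℝ) ≤ a + b := by positivity
    linarith
  | add f g hf hg ihf ihg =>
    simp only [mul_add]
    exact ihf.add ihg
  | const_mul c f hf ih =>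
    simp only [mul_left_comm _ c]
    exact ih.const_mul c

theorem isLineDeriv_add {j : Fin 2} {f f' g g' : Plane → ℂ} (hf : IsLineDerivOffZero j f f')
    (hg : IsLineDerivOffZero j g g') :
    IsLineDerivOffZero j (fun p => f p + g p) fun p => f' p + g' p :=
  fun p hp => (hf p hp).add (hg p hp)

/-- Each differentiation lowers the degree at the origin by one at most. A polynomial times
`e^{-|p|^α}` is counted as having degree `α`, since a derivative leaves either another such product
or a term of degree at least `α - 1`. -/
theorem exists_lineDeriv (hα : 0 < α) (hh : IsSymbol α d h) (j : Fin 2) :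
    ∃ h', IsSymbol α (d - 1) h' ∧ IsLineDerivOffZero j h h' := by
  induction hh with
  | basic a b w h =>
    obtain rfl | rfl : j = 0 ∨ j = 1 := by fin_cases j <;> simp
    · refine ⟨_, .add _ _ ?_ (.add _ _ ?_ ?_), isLineDerivOffZero_basicSymbol_zero α a b w⟩
      -- For `a = 0` the truncated `a - 1` does not lower the degree, but the term has coefficient
      -- zero and any admissible symbol can stand in for it.
      · rcases Nat.eq_zero_or_pos a with rfl | ha
        · have := IsSymbol.const_mul 0 _
            (IsSymbol.basic (α := α) (d := d - 1) 0 b w (by simp at h ⊢; linarith))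
          simpa using this
        · refine .const_mul _ _ (.basic _ _ _ ?_)
          rw [Nat.cast_sub ha]
          push_cast
          linarith
      · refine .const_mul _ _ (.basic _ _ _ ?_)
        simp
        linarith
      · refine .const_mul _ _ (.basic _ _ _ ?_)
        simp
        linarith
    · refine ⟨_, .add _ _ ?_ (.add _ _ ?_ ?_), isLineDerivOffZero_basicSymbol_one α a b w⟩
      · rcases Nat.eq_zero_or_pos b with rfl | hb
        · have := IsSymbol.const_mul 0 _
            (IsSymbol.basic (α := α) (d := d - 1) a 0 w (by simp at h ⊢; linarith))
          simpa using this
        · refine .const_mul _ _ (.basic _ _ _ ?_)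
          rw [Nat.cast_sub hb]
          push_cast
          linarith
      · refine .const_mul _ _ (.basic _ _ _ ?_)
        simp
        linarith
      · refine .const_mul _ _ (.basic _ _ _ ?_)
        simp
        linarith
  | poly a b h =>
    have ha : (0 : ℝ) ≤ a := a.cast_nonneg
    have hb : (0 : ℝ) ≤ b := b.cast_nonneg
    obtain rfl | rfl : j = 0 ∨ j = 1 := by fin_cases j <;> simp
    · refine ⟨_, .add _ _ (.const_mul (a : ℂ) _ (.poly (a - 1) b (by linarith))) (?_ :
        IsSymbol α (d - 1) fun p => -α * basicSymbol α (a + 1) b (0 + α - 2) p), ?_⟩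
      · refine .const_mul _ _ (.basic _ _ _ ?_)
        simp
        linarith
      -- With `w = 0` the term in `|p|^{w-2}`, which would be too singular, has coefficient zero and
      -- drops out.
      · simpa using isLineDerivOffZero_basicSymbol_zero α a b 0
    · refine ⟨_, .add _ _ (.const_mul (b : ℂ) _ (.poly a (b - 1) (by linarith))) (?_ :
        IsSymbol α (d - 1) fun p => -α * basicSymbol α a (b + 1) (0 + α - 2) p), ?_⟩
      · refine .const_mul _ _ (.basic _ _ _ ?_)
        simp
        linarith
      · simpa using isLineDerivOffZero_basicSymbol_one α a b 0
  | add f g hf hg ihf ihg =>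
    obtain ⟨f', hf', hfd⟩ := ihf
    obtain ⟨g', hg', hgd⟩ := ihg
    exact ⟨_, hf'.add _ _ hg', isLineDeriv_add hfd hgd⟩
  | const_mul c f hf ih =>
    obtain ⟨f', hf', hfd⟩ := ih
    exact ⟨_, hf'.const_mul c _, fun p hp => (hfd p hp).const_mul c⟩

theorem mono {d' : ℝ} (hh : IsSymbol α d h) (hd : d' ≤ d) : IsSymbol α d' h := by
  induction hh with
  | basic a b w h => exact .basic _ _ _ (hd.trans h)
  | poly a b h => exact .poly _ _ (hd.trans h)
  | add f g hf hg ihf ihg => exact .add _ _ ihf ihg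
  | const_mul c f hf ih => exact .const_mul _ _ ih

/-- Multiplication of the inverse Fourier transform with `1 + |x|²`. -/
theorem exists_weight_mul (hα : 0 < α) (hh : IsSymbol α d h) (hd : 1 < d) :
    ∃ k, IsSymbol α (d - 2) k ∧
      ∀ x, ((weight x : ℝ) : ℂ) * fourierInvHat h x = fourierInvHat k x := by
  -- Multiplication by `1 + |x|²` is `1 - Δ` on symbols. Two derivatives bring the degree to `d - 2
  -- > -1`, still integrable in the plane.
  have second : ∀ j : Fin 2, ∃ k, IsSymbol α (d - 2) k ∧
      ∀ x : Plane, fourierInvHat k x = -((x j : ℝ) : ℂ) ^ 2 * fourierInvHat h x := fun j => by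
    obtain ⟨h', hs', hd'⟩ := hh.exists_lineDeriv hα j
    obtain ⟨h'', hs'', hd''⟩ := hs'.exists_lineDeriv hα j
    refine ⟨h'', hs''.mono (by linarith), fun x => ?_⟩
    rw [fourierInvHat_lineDeriv (hs'.integrable hα (by linarith))
      (hs''.integrable hα (by linarith)) hd'', fourierInvHat_lineDeriv
      (hh.integrable hα (by linarith)) (hs'.integrable hα (by linarith)) hd']
    linear_combination (-((x j : ℝ) : ℂ) ^ 2 * fourierInvHat h x) * -Complex.I_sq
  obtain ⟨k₀, hk₀, e₀⟩ := second 0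
  obtain ⟨k₁, hk₁, e₁⟩ := second 1
  refine ⟨_, (hh.mono (d' := d - 2) (by linarith)).add _ _
    ((hk₀.add _ _ hk₁).const_mul (-1) _), fun x => ?_⟩
  have hE : ∀ {k : Plane → ℂ}, Integrable k →
      Integrable fun p : Plane => Complex.exp (Complex.I * (inner ℝ x p : ℝ)) * k p := fun hk =>
    hk.bdd_mul (c := 1) (Continuous.aestronglyMeasurable (by fun_prop))
      (Eventually.of_forall fun p => (norm_exp_I_mul _).le)
  have i := hE (hh.integrable hα (by linarith))
  have i₀ := hE (hk₀.integrable hα (by linarith))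
  have i₁ := hE (hk₁.integrable hα (by linarith))
  have e : fourierInvHat (fun p => h p + -1 * (k₀ p + k₁ p)) x =
      fourierInvHat h x - (fourierInvHat k₀ x + fourierInvHat k₁ x) := by
    unfold fourierInvHat
    have i₂ : Integrable fun p : Plane => Complex.exp (Complex.I * (inner ℝ x p : ℝ)) * k₀ p +
      Complex.exp (Complex.I * (inner ℝ x p : ℝ)) * k₁ p := i₀.add i₁
    rw [← mul_add, ← integral_add i₀ i₁, ← mul_sub, ← integral_sub i i₂]
    congr 2
    ext p
    ring
  rw [e, e₀, e₁, weight, EuclideanSpace.norm_sq_eq, Fin.sum_univ_two]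
  simp only [Real.norm_eq_abs, sq_abs]
  push_cast
  ring

/-- By Plancherel it suffices that the symbol of degree `d - 2` is square integrable, which in the
plane means `d - 2 > -1`. For the profile `d = α`, and this is the role of `α > 1`. -/
theorem memLp_fourierInvHat (hα : 0 < α) (hh : IsSymbol α d h) (hd : 1 < d) :
    MemLp (fourierInvHat h) 2 wMeasure := by
  obtain ⟨k, hk, e⟩ := hh.exists_weight_mul hα hd
  refine ⟨aestronglyMeasurable_wMeasure
    (continuous_fourierInvHat (hh.integrable hα (by linarith))).aestronglyMeasurable, ?_⟩
  rw [eLpNorm_wMeasure]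
  simp only [e]
  refine (ScaledVariables.memLp_fourierInvHat (hk.integrable hα (by linarith)) ?_).2
  simpa using hk.memLp hα (by linarith) le_rfl

theorem hat_fourierInvHat (hα : 0 < α) (hh : IsSymbol α d h) (hd : 1 < d) (hc : Continuous h) :
    hat (hh.memLp_fourierInvHat hα hd).toLp = h := by
  rw [hat_toLp]
  refine fourierHat_fourierInvHat hc (hh.integrable hα (by linarith)) ?_
  exact (integrable_L22 (hh.memLp_fourierInvHat hα hd).toLp).congr (coeFn_toLp_volume _)

end IsSymbol

end ScaledVariables

/-! ### The explicit semigroup: growth, semigroup law, strong continuity. -/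

namespace ScaledVariables

open scoped ENNReal NNReal
open UnboundedOp

/-! ### Kernels with given symbol -/

open Classical in
/-- The element of `L²(2)` with Fourier transform `k`. -/
def symbolKernel (k : Plane → ℂ) : L22 :=
  if h : MemLp (fourierInvHat k) 2 wMeasure then h.toLp else 0

theorem coeFn_symbolKernel {k : Plane → ℂ} (h : MemLp (fourierInvHat k) 2 wMeasure) :
    symbolKernel k =ᵐ[(volume : Measure Plane)] fourierInvHat k := by
  rw [symbolKernel, dif_pos h]
  exact coeFn_toLp_volume h

theorem IsSymbol.hat_symbolKernel {α d : ℝ} {k : Plane → ℂ} (hα : 0 < α) (hk : IsSymbol α d k)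
    (hd : 1 < d) (hc : Continuous k) : hat (symbolKernel k) = k := by
  rw [symbolKernel, dif_pos (hk.memLp_fourierInvHat hα hd)]
  exact hk.hat_fourierInvHat hα hd hc

/-- The symbol `e^{-|p|^α}` of `G`. -/
def profileSymbol (α : ℝ) (p : Plane) : ℂ := ((Real.exp (-(‖p‖ ^ α)) : ℝ) : ℂ)

theorem continuous_profileSymbol {α : ℝ} (hα : 0 < α) : Continuous (profileSymbol α) := by
  unfold profileSymbol
  have : Continuous fun p : Plane => ‖p‖ ^ α := continuous_norm.rpow_const fun _ => Or.inr hα.le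
  fun_prop

theorem isSymbol_profileSymbol (α : ℝ) : IsSymbol α α (profileSymbol α) := by
  have e : profileSymbol α = basicSymbol α 0 0 0 := by
    ext p
    simp [profileSymbol, basicSymbol]
  rw [e]
  exact .poly 0 0 le_rfl

/-- The symbol `i p_j e^{-|p|^α}` of `∂_j G`. -/
def gradSymbol (α : ℝ) (j : Fin 2) (p : Plane) : ℂ := Complex.I * (p j : ℝ) * profileSymbol α p

theorem continuous_gradSymbol {α : ℝ} (hα : 0 < α) (j : Fin 2) : Continuous (gradSymbol α j) := by
  unfold gradSymbol
  exact (by fun_prop : Continuous fun p : Plane => Complex.I * ((p j : ℝ) : ℂ)).mul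
    (continuous_profileSymbol hα)

theorem isSymbol_gradSymbol (α : ℝ) (j : Fin 2) : IsSymbol α α (gradSymbol α j) := by
  obtain rfl | rfl : j = 0 ∨ j = 1 := by fin_cases j <;> simp
  · have e : gradSymbol α 0 = fun p => Complex.I * basicSymbol α 1 0 0 p := by
      ext p
      simp [gradSymbol, profileSymbol, basicSymbol, mul_assoc]
    rw [e]
    exact .const_mul _ _ (.poly 1 0 le_rfl)
  · have e : gradSymbol α 1 = fun p => Complex.I * basicSymbol α 0 1 0 p := by
      ext p
      simp [gradSymbol, profileSymbol, basicSymbol, mul_assoc]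
    rw [e]
    exact .const_mul _ _ (.poly 0 1 le_rfl)

/-- The function `G` as an element of `L²(2)`. -/
def profile (α : ℝ) : L22 := symbolKernel (profileSymbol α)

variable {α β : ℝ}

theorem hat_profile (hα : 1 < α) : hat (profile α) = profileSymbol α :=
  (isSymbol_profileSymbol α).hat_symbolKernel (by linarith) hα
    (continuous_profileSymbol (by linarith))

/-- The function with Fourier transform `e^{-c|p|^α}`. -/
def heat (α c : ℝ) : L22 := dil (c ^ (-(1 / α))) (profile α)

theorem norm_inv_smul_rpow {c : ℝ} (hα : 0 < α) (hc : 0 < c) (p : Plane) :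
    ‖(c ^ (-(1 / α)))⁻¹ • p‖ ^ α = c * ‖p‖ ^ α := by
  rw [norm_smul, Real.mul_rpow (norm_nonneg _) (norm_nonneg _), Real.rpow_neg hc.le, inv_inv,
    Real.norm_of_nonneg (by positivity), ← Real.rpow_mul hc.le, one_div_mul_cancel hα.ne',
    Real.rpow_one]

theorem hat_heat (hα : 1 < α) {c : ℝ} (hc : 0 < c) (p : Plane) :
    hat (heat α c) p = ((Real.exp (-(c * ‖p‖ ^ α)) : ℝ) : ℂ) := by
  rw [heat, hat_dil (by positivity), hat_profile hα, profileSymbol,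
    norm_inv_smul_rpow (by linarith) hc]

theorem tendsto_heat {c : ℝ} (hc : 0 < c) {ι : Type*} {l : Filter ι} {u : ι → ℝ}
    (hu : Tendsto u l (𝓝 c)) : Tendsto (fun i => heat α (u i)) l (𝓝 (heat α c)) :=
  (tendsto_dil (by positivity) _).comp (hu.rpow_const (Or.inl hc.ne'))

/-! ### The semigroup -/

/-- The exponent `λ₀ = 1 - (3 - β)/α`. -/
def topRate (α β : ℝ) : ℝ := 1 - (3 - β) / α

/-- The operators `f ↦ e^{λ₀ t} (Dil_b K) * Dil_{e^{t/α}} f`, where `b = (1 - e^{-t})^{-1/α}`. -/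
def kernelFlow (α β : ℝ) (K : L22) (t : ℝ) : L22 →L[ℂ] L22 :=
  ((Real.exp (topRate α β * t) : ℝ) : ℂ) •
    (conv (dil ((1 - Real.exp (-t)) ^ (-(1 / α))) K)).comp (dil (Real.exp (t / α)))

theorem kernelFlow_apply (K : L22) (t : ℝ) (f : L22) :
    kernelFlow α β K t f = ((Real.exp (topRate α β * t) : ℝ) : ℂ) •
      conv (dil ((1 - Real.exp (-t)) ^ (-(1 / α))) K) (dil (Real.exp (t / α)) f) := rfl

theorem one_sub_exp_neg_pos {t : ℝ} (ht : 0 < t) : 0 < 1 - Real.exp (-t) := by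
  have : Real.exp (-t) < 1 := Real.exp_lt_one_iff.2 (by linarith)
  linarith

theorem hat_kernelFlow (K : L22) {t : ℝ} (ht : 0 < t) (f : L22) (p : Plane) :
    hat (kernelFlow α β K t f) p = ((Real.exp (topRate α β * t) : ℝ) : ℂ) *
      (hat K (((1 - Real.exp (-t)) ^ (-(1 / α)))⁻¹ • p) * hat f (Real.exp (-(t / α)) • p)) := by
  have := one_sub_exp_neg_pos ht
  rw [kernelFlow_apply, hat_smul, hat_conv, hat_dil (by positivity), hat_dil (by positivity),
    Real.exp_neg (t / α)]

/-- Growth of `kernelFlow`. -/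
theorem norm_kernelFlow_le (hα : 0 < α) (K : L22) : ∃ M : ℝ, 0 ≤ M ∧ ∀ t : ℝ, 0 < t →
    ‖kernelFlow α β K t‖ ≤ M * Real.exp ((topRate α β + 1 / α) * t) := by
  set A := (eLpNorm K 1 volume).toReal
  set B := (eLpNorm (fun x => ((‖x‖ ^ 2 : ℝ) : ℂ) * K x) 2 volume).toReal
  refine ⟨2 * (A + (embConst 0).toReal * B), by positivity, fun t ht => ?_⟩
  refine ContinuousLinearMap.opNorm_le_bound _ (by positivity) fun f => ?_
  have ha := one_sub_exp_neg_pos ht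
  have ha1 : 1 - Real.exp (-t) ≤ 1 := by linarith [Real.exp_pos (-t)]
  set b := (1 - Real.exp (-t)) ^ (-(1 / α)) with hb
  have hb0 : 0 < b := by positivity
  -- Since `b ≥ 1`, the dilation does not increase the second moment of the kernel, so the bound
  -- does not degenerate as `t → 0`.
  have hb1 : b⁻¹ ≤ 1 := by
    rw [hb, Real.rpow_neg ha.le, inv_inv]
    exact Real.rpow_le_one ha.le ha1 (by positivity)
  set h := dil (Real.exp (t / α)) f
  have hh : ‖h‖ ≤ Real.exp (t / α) * ‖f‖ := by
    have := norm_dil_apply_le (Real.exp_pos (t / α)) f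
    rwa [max_eq_left] at this
    have h1 : 1 ≤ Real.exp (t / α) := Real.one_le_exp (by positivity)
    exact (inv_le_one_of_one_le₀ h1).trans h1
  have e1 : (eLpNorm (dil b K) 1 volume).toReal = A := by rw [eLpNorm_one_dil hb0]
  have e2 : (eLpNorm (fun x => ((‖x‖ ^ 2 : ℝ) : ℂ) * dil b K x) 2 volume).toReal = b⁻¹ * B := by
    rw [eLpNorm_sq_dil hb0, ENNReal.toReal_mul, ENNReal.toReal_ofReal (by positivity)]
  rw [kernelFlow_apply, norm_smul, Complex.norm_real, Real.norm_of_nonneg (Real.exp_pos _).le]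
  have e3 : Real.exp ((topRate α β + 1 / α) * t) =
      Real.exp (topRate α β * t) * Real.exp (t / α) := by
    rw [← Real.exp_add]
    ring_nf
  rw [e3]
  have key := norm_conv_le_of_norms (dil b K) h
  rw [e1, e2] at key
  calc Real.exp (topRate α β * t) * ‖conv (dil b K) h‖
      ≤ Real.exp (topRate α β * t) * (2 * (‖h‖ * A + (embConst 0).toReal * ‖h‖ * (1 * B))) := by
        gcongr
        exact key.trans (by gcongr)
    _ = Real.exp (topRate α β * t) * (2 * (A + (embConst 0).toReal * B)) * ‖h‖ := by ring
    _ ≤ Real.exp (topRate α β * t) * (2 * (A + (embConst 0).toReal * B)) *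
        (Real.exp (t / α) * ‖f‖) := by gcongr
    _ = _ := by ring

/-- The semigroup `e^{t𝓛}`. -/
def flow (α β t : ℝ) : L22 →L[ℂ] L22 :=
  if 0 < t then kernelFlow α β (profile α) t else ContinuousLinearMap.id ℂ L22

theorem flow_of_pos {t : ℝ} (ht : 0 < t) : flow α β t = kernelFlow α β (profile α) t := if_pos ht

theorem flow_zero : flow α β 0 = ContinuousLinearMap.id ℂ L22 := if_neg (lt_irrefl _)

theorem hat_flow (hα : 1 < α) {t : ℝ} (ht : 0 ≤ t) (f : L22) (p : Plane) :
    hat (flow α β t f) p = ((Real.exp (topRate α β * t) : ℝ) : ℂ) *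
      (((Real.exp (-((1 - Real.exp (-t)) * ‖p‖ ^ α)) : ℝ) : ℂ) *
        hat f (Real.exp (-(t / α)) • p)) := by
  rcases ht.eq_or_lt with rfl | ht
  · simp [flow_zero]
  · rw [flow_of_pos ht, hat_kernelFlow _ ht, hat_profile hα, profileSymbol,
      norm_inv_smul_rpow (by linarith) (one_sub_exp_neg_pos ht)]

theorem norm_exp_neg_smul_rpow (hα : 0 < α) (t : ℝ) (p : Plane) :
    ‖Real.exp (-(t / α)) • p‖ ^ α = Real.exp (-t) * ‖p‖ ^ α := by
  rw [norm_smul, Real.mul_rpow (norm_nonneg _) (norm_nonneg _),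
    Real.norm_of_nonneg (Real.exp_pos _).le, ← Real.exp_mul]
  congr 2
  field_simp

theorem flow_add (hα : 1 < α) {s t : ℝ} (hs : 0 ≤ s) (ht : 0 ≤ t) :
    flow α β (s + t) = (flow α β s).comp (flow α β t) := by
  have hα0 : 0 < α := by linarith
  ext1 f
  refine hat_injective (funext fun p => ?_)
  rw [ContinuousLinearMap.comp_apply, hat_flow hα (add_nonneg hs ht), hat_flow hα hs,
    hat_flow hα ht, norm_exp_neg_smul_rpow hα0, smul_smul, ← Real.exp_add]
  have e1 : -(t / α) + -(s / α) = -((s + t) / α) := by ring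
  have e2 : Real.exp (topRate α β * (s + t)) =
      Real.exp (topRate α β * s) * Real.exp (topRate α β * t) := by
    rw [← Real.exp_add]
    ring_nf
  -- The cocycle identity `a(s + t) = a(s) + e^{-s} a(t)` for `a(t) = 1 - e^{-t}`.
  have e3 : Real.exp (-((1 - Real.exp (-(s + t))) * ‖p‖ ^ α)) =
      Real.exp (-((1 - Real.exp (-s)) * ‖p‖ ^ α)) *
        Real.exp (-((1 - Real.exp (-t)) * (Real.exp (-s) * ‖p‖ ^ α))) := by
    rw [← Real.exp_add]
    congr 1
    rw [neg_add, Real.exp_add]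
    ring
  rw [e1, e2, e3]
  push_cast
  ring

theorem exists_norm_flow_le (hα : 1 < α) : ∃ M : ℝ, ∀ t : ℝ, 0 ≤ t →
    ‖flow α β t‖ ≤ M * Real.exp ((topRate α β + 1 / α) * t) := by
  obtain ⟨M, hM, h⟩ := norm_kernelFlow_le (β := β) (by linarith : 0 < α) (profile α)
  refine ⟨max M 1, fun t ht => ?_⟩
  rcases ht.eq_or_lt with rfl | ht
  · rw [flow_zero, mul_zero, Real.exp_zero, mul_one]
    exact ContinuousLinearMap.norm_id_le.trans (le_max_right _ _)
  · rw [flow_of_pos ht]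
    exact (h t ht).trans (by gcongr; exact le_max_left _ _)

/-- The semigroup on functions smoothed by a heat kernel. -/
theorem flow_conv_heat (hα : 1 < α) {t c : ℝ} (ht : 0 ≤ t) (hc : 0 < c) (g : L22) :
    flow α β t (conv (heat α c) g) = ((Real.exp (topRate α β * t) : ℝ) : ℂ) •
      conv (heat α ((1 - Real.exp (-t)) + Real.exp (-t) * c)) (dil (Real.exp (t / α)) g) := by
  have hc' : 0 < (1 - Real.exp (-t)) + Real.exp (-t) * c := by
    have : Real.exp (-t) ≤ 1 := Real.exp_le_one_iff.2 (by linarith)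
    have : 0 < Real.exp (-t) * c := by positivity
    linarith
  refine hat_injective (funext fun p => ?_)
  rw [hat_flow hα ht, hat_conv, hat_smul, hat_conv, hat_heat hα hc, hat_heat hα hc',
    hat_dil (Real.exp_pos _), norm_exp_neg_smul_rpow (by linarith), Real.exp_neg (t / α)]
  have e : Real.exp (-((1 - Real.exp (-t) + Real.exp (-t) * c) * ‖p‖ ^ α)) =
      Real.exp (-((1 - Real.exp (-t)) * ‖p‖ ^ α)) *
        Real.exp (-(c * (Real.exp (-t) * ‖p‖ ^ α))) := by
    rw [← Real.exp_add]
    ring_nf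
  rw [e]
  push_cast
  ring

/-- On data already smoothed, the parameter of the kernel tends to `c > 0` instead of `0`. Nothing
concentrates, and the joint continuity of convolution applies. -/
theorem tendsto_flow_conv_heat (hα : 1 < α) {c : ℝ} (hc : 0 < c) (g : L22) :
    Tendsto (fun t => flow α β t (conv (heat α c) g)) (𝓝[>] 0) (𝓝 (conv (heat α c) g)) := by
  have h1 : Tendsto (fun t : ℝ => heat α ((1 - Real.exp (-t)) + Real.exp (-t) * c)) (𝓝 0)
      (𝓝 (heat α c)) := by
    refine tendsto_heat hc ?_
    have : Continuous fun t : ℝ => (1 - Real.exp (-t)) + Real.exp (-t) * c := by fun_prop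
    simpa using this.tendsto 0
  have h2 : Tendsto (fun t : ℝ => dil (Real.exp (t / α)) g) (𝓝 0) (𝓝 g) := by
    have : Continuous fun t : ℝ => Real.exp (t / α) := by fun_prop
    have h3 := this.tendsto 0
    simp only [zero_div, Real.exp_zero] at h3
    exact (tendsto_dil_one g).comp h3
  have h3 : Tendsto (fun t : ℝ => ((Real.exp (topRate α β * t) : ℝ) : ℂ)) (𝓝 0) (𝓝 1) := by
    have : Continuous fun t : ℝ => ((Real.exp (topRate α β * t) : ℝ) : ℂ) := by fun_prop
    simpa using this.tendsto 0
  have h4 := (h3.smul (tendsto_conv h1 h2)).mono_left (nhdsWithin_le_nhds (s := Set.Ioi 0))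
  rw [one_smul] at h4
  refine h4.congr' ?_
  filter_upwards [self_mem_nhdsWithin] with t ht
  rw [flow_conv_heat hα (le_of_lt ht) hc]

/-- Smoothing by a heat kernel converges weakly to the identity. -/
theorem tendsto_inner_conv_heat (hα : 1 < α) (g y : L22) :
    Tendsto (fun c => inner ℂ y (conv (heat α c) g)) (𝓝[>] 0) (𝓝 (inner ℂ y g)) := by
  have hlim : Tendsto (fun c : ℝ => c) (𝓝[>] 0) (𝓝 0) := nhdsWithin_le_nhds
  have hα0 : 0 < α := by linarith
  refine tendsto_inner_of_hat (M := 2 * (‖g‖ * (eLpNorm (profile α) 1 volume).toReal +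
      (embConst 0).toReal * ‖g‖ * (1 *
        (eLpNorm (fun x => ((‖x‖ ^ 2 : ℝ) : ℂ) * profile α x) 2 volume).toReal))) ?_ ?_ y
  · filter_upwards [self_mem_nhdsWithin, hlim.eventually (eventually_le_nhds zero_lt_one)]
      with c hc hc1
    rw [Set.mem_Ioi] at hc
    have hb0 : 0 < c ^ (-(1 / α)) := by positivity
    have hb1 : (c ^ (-(1 / α)))⁻¹ ≤ 1 := by
      rw [Real.rpow_neg hc.le, inv_inv]
      exact Real.rpow_le_one hc.le hc1 (by positivity)
    refine (norm_conv_le_of_norms _ _).trans ?_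
    rw [heat, eLpNorm_one_dil hb0, eLpNorm_sq_dil hb0, ENNReal.toReal_mul,
      ENNReal.toReal_ofReal (by positivity)]
    gcongr
  · intro p
    have h1 : Tendsto (fun c : ℝ => ((Real.exp (-(c * ‖p‖ ^ α)) : ℝ) : ℂ) * hat g p) (𝓝[>] 0)
        (𝓝 (hat g p)) := by
      have : Continuous fun c : ℝ => ((Real.exp (-(c * ‖p‖ ^ α)) : ℝ) : ℂ) * hat g p := by
        fun_prop
      simpa using (this.tendsto 0).mono_left (nhdsWithin_le_nhds (s := Set.Ioi 0))
    refine h1.congr' ?_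
    filter_upwards [self_mem_nhdsWithin] with c hc
    rw [hat_conv, hat_heat hα hc]

/-- The flow is uniformly bounded near `t = 0`, so the vectors with continuous orbit form a closed
subspace. It contains all smoothed functions, and a vector orthogonal to these is zero by
`tendsto_inner_conv_heat`. Weak approximation by smoothed functions is thus enough. -/
theorem tendsto_flow (hα : 1 < α) (f : L22) :
    Tendsto (fun t => flow α β t f) (𝓝[>] 0) (𝓝 f) := by
  obtain ⟨M, hM⟩ := exists_norm_flow_le (β := β) hα
  set N := M * Real.exp (|topRate α β + 1 / α|) with hN
  have hM0 : 0 ≤ M := by simpa using (norm_nonneg _).trans (hM 0 le_rfl)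
  have hN0 : 0 ≤ N := by positivity
  have hlim : Tendsto (fun c : ℝ => c) (𝓝[>] 0) (𝓝 0) := nhdsWithin_le_nhds
  have hb : ∀ᶠ t : ℝ in 𝓝[>] 0, ‖flow α β t‖ ≤ N := by
    filter_upwards [self_mem_nhdsWithin, hlim.eventually (eventually_le_nhds zero_lt_one)]
      with t ht ht1
    rw [Set.mem_Ioi] at ht
    refine (hM t ht.le).trans ?_
    rw [hN]
    gcongr
    calc (topRate α β + 1 / α) * t ≤ |topRate α β + 1 / α| * t := by gcongr; exact le_abs_self _
      _ ≤ |topRate α β + 1 / α| * 1 := by gcongr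
      _ = _ := mul_one _
  let D : Submodule ℂ L22 :=
    { carrier := {f | Tendsto (fun t => flow α β t f) (𝓝[>] 0) (𝓝 f)}
      add_mem' := fun {f g} hf hg => by
        simpa only [Set.mem_ofPred_eq, map_add] using Tendsto.add hf hg
      zero_mem' := by simp
      smul_mem' := fun c f hf => by
        simpa only [Set.mem_ofPred_eq, map_smul] using Tendsto.const_smul hf c }
  have hD : ∀ f, f ∈ D ↔ Tendsto (fun t => flow α β t f) (𝓝[>] 0) (𝓝 f) := fun f => Iff.rfl
  have hcl : IsClosed (D : Set L22) := by
    refine isClosed_of_closure_subset fun f hf => ?_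
    rw [SetLike.mem_coe, hD, Metric.tendsto_nhds]
    intro ε hε
    obtain ⟨g, hg, hfg⟩ := Metric.mem_closure_iff.1 hf (ε / (N + 2)) (by positivity)
    rw [SetLike.mem_coe, hD] at hg
    filter_upwards [hb, Metric.tendsto_nhds.1 hg (ε / (N + 2)) (by positivity)] with t h1 h2
    rw [dist_eq_norm] at hfg h2 ⊢
    have e : flow α β t f - f = flow α β t (f - g) + (flow α β t g - g) - (f - g) := by
      rw [map_sub]
      abel
    have h3 : ‖flow α β t (f - g)‖ ≤ N * ‖f - g‖ := (flow α β t).le_of_opNorm_le h1 _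
    calc ‖flow α β t f - f‖ ≤ N * ‖f - g‖ + ‖flow α β t g - g‖ + ‖f - g‖ := by
          rw [e]
          exact (norm_sub_le _ _).trans (by gcongr; exact (norm_add_le _ _).trans (by gcongr))
      _ < N * (ε / (N + 2)) + ε / (N + 2) + ε / (N + 2) := by
          have := mul_le_mul_of_nonneg_left hfg.le hN0
          linarith
      _ = ε := by
          field_simp
          ring
  have htop : D = ⊤ := by
    have : CompleteSpace D := hcl.completeSpace_coe
    rw [← Submodule.orthogonal_eq_bot_iff, Submodule.eq_bot_iff]
    intro y hy
    have h0 : ∀ g : L22, inner ℂ y g = 0 := fun g => by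
      refine tendsto_nhds_unique (tendsto_inner_conv_heat hα g y) ?_
      refine tendsto_const_nhds.congr' ?_
      filter_upwards [self_mem_nhdsWithin] with c hc
      exact ((D.mem_orthogonal' y).1 hy _ (tendsto_flow_conv_heat hα hc g)).symm
    exact inner_self_eq_zero.1 (h0 y)
  exact (hD f).1 (htop ▸ Submodule.mem_top)

theorem exists_isC0Semigroup_flow (hα : 1 < α) :
    ∃ M, IsC0Semigroup (flow α β) M (topRate α β + 1 / α) := by
  obtain ⟨M, hM⟩ := exists_norm_flow_le (β := β) hα
  exact ⟨M, flow_zero, fun s t hs ht => flow_add hα hs ht, fun f => tendsto_flow hα f, hM⟩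

end ScaledVariables

/-! ### The transposed flow on test functions and the Fourier form of `𝓛`. -/

namespace ScaledVariables

open scoped ENNReal NNReal
open UnboundedOp

/-! ### The transposed semigroup on test functions -/

/-- The orbit `e^{-κ(e^t - 1)|p|^α} ψ(e^{t/α} p)` of a test function. -/
def orbitTest (κ α t : ℝ) (ψ : Plane → ℂ) (p : Plane) : ℂ :=
  ((Real.exp (-(κ * (Real.exp t - 1) * ‖p‖ ^ α)) : ℝ) : ℂ) * ψ (Real.exp (t / α) • p)

/-- The derivative `-κ|p|^α ψ + (1/α) p·∇ψ` of the orbit at `t = 0`. -/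
def genTest (κ α : ℝ) (ψ : Plane → ℂ) (p : Plane) : ℂ :=
  -((κ * ‖p‖ ^ α : ℝ) : ℂ) * ψ p + ((1 / α : ℝ) : ℂ) * fderiv ℝ ψ p p

variable {α β κ : ℝ}

theorem norm_exp_smul_rpow (hα : 0 < α) (t : ℝ) (p : Plane) :
    ‖Real.exp (t / α) • p‖ ^ α = Real.exp t * ‖p‖ ^ α := by
  have := norm_exp_neg_smul_rpow hα (-t) p
  rwa [neg_div, neg_neg, neg_neg] at this

theorem orbitTest_zero (ψ : Plane → ℂ) : orbitTest κ α 0 ψ = ψ := by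
  ext p
  simp [orbitTest]

theorem orbitTest_orbitTest (hα : 0 < α) (s t : ℝ) (ψ : Plane → ℂ) :
    orbitTest κ α s (orbitTest κ α t ψ) = orbitTest κ α (t + s) ψ := by
  ext p
  rw [orbitTest, orbitTest, orbitTest, norm_exp_smul_rpow hα, smul_smul, ← Real.exp_add,
    ← mul_assoc, ← Complex.ofReal_mul, ← Real.exp_add]
  congr 2
  · congr 2
    rw [Real.exp_add]
    ring
  · rw [add_div]

/-- The derivative at time `t` is the orbit of `genTest κ α ψ`, so one decay bound for `genTest`
controls all difference quotients. The parameter is used with `κ = 1` for the transposed semigroup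
and with `κ = 0` for pure dilation. -/
theorem hasDerivAt_orbitTest (hα : 0 < α) {ψ : Plane → ℂ} (hψ : Differentiable ℝ ψ) (p : Plane)
    (t : ℝ) : HasDerivAt (fun s => orbitTest κ α s ψ p)
      (((Real.exp (-(κ * (Real.exp t - 1) * ‖p‖ ^ α)) : ℝ) : ℂ) *
        genTest κ α ψ (Real.exp (t / α) • p)) t := by
  have h1 : HasDerivAt (fun s => Real.exp (-(κ * (Real.exp s - 1) * ‖p‖ ^ α)))
      (Real.exp (-(κ * (Real.exp t - 1) * ‖p‖ ^ α)) * -(κ * Real.exp t * ‖p‖ ^ α)) t := by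
    have := ((((Real.hasDerivAt_exp t).sub_const 1).const_mul κ).mul_const (‖p‖ ^ α)).fun_neg.exp
    exact this
  have h2 : HasDerivAt (fun s => Real.exp (s / α) • p)
      ((Real.exp (t / α) * (1 / α)) • p) t :=
    (((hasDerivAt_id t).div_const α).exp).smul_const p
  have h3 : HasDerivAt (fun s => ψ (Real.exp (s / α) • p))
      (fderiv ℝ ψ (Real.exp (t / α) • p) ((Real.exp (t / α) * (1 / α)) • p)) t :=
    (hψ _).hasFDerivAt.comp_hasDerivAt t h2
  refine (h1.ofReal_comp.fun_mul h3).congr_deriv ?_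
  rw [genTest, norm_exp_smul_rpow hα, mul_comm (Real.exp (t / α)), mul_smul, map_smul,
    ← Complex.coe_smul, smul_eq_mul]
  push_cast
  ring

/-! ### Decay of test functions -/

/-- The integrable function `(1 + |p|²)⁻²`. -/
def decayBound (p : Plane) : ℝ := (1 + ‖p‖ ^ 2) ^ (-(4 : ℝ) / 2)

theorem integrable_decayBound : Integrable decayBound :=
  integrable_rpow_neg_one_add_norm_sq (by simp; norm_num)

theorem decayBound_eq (p : Plane) : decayBound p = ((1 + ‖p‖ ^ 2) ^ 2)⁻¹ := by
  rw [decayBound, show (-(4 : ℝ) / 2) = -((2 : ℕ) : ℝ) by norm_num, Real.rpow_neg (by positivity),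
    Real.rpow_natCast]

theorem decayBound_exp_smul_le {a : ℝ} (ha : 1 ≤ a) (p : Plane) :
    decayBound (a • p) ≤ decayBound p := by
  rw [decayBound_eq, decayBound_eq]
  have : ‖p‖ ≤ ‖a • p‖ := by
    rw [norm_smul, Real.norm_of_nonneg (by linarith)]
    exact le_mul_of_one_le_left (norm_nonneg _) ha
  gcongr

theorem le_decayBound {u : Plane → ℝ} (h0 : ∀ p, 0 ≤ u p) {A B : ℝ} (hA : ∀ p, u p ≤ A)
    (hB : ∀ p, ‖p‖ ^ 4 * u p ≤ B) (p : Plane) : u p ≤ (2 * A + 2 * B) * decayBound p := by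
  rw [decayBound_eq, ← div_eq_mul_inv, le_div_iff₀ (by positivity)]
  calc u p * (1 + ‖p‖ ^ 2) ^ 2 ≤ u p * (2 + 2 * ‖p‖ ^ 4) := by
        gcongr
        · exact h0 p
        · nlinarith [sq_nonneg (‖p‖ ^ 2 - 1)]
    _ = 2 * u p + 2 * (‖p‖ ^ 4 * u p) := by ring
    _ ≤ _ := by linarith [hA p, hB p]

theorem exists_pow_mul_schwartz_le (ψ : 𝓢(Plane, ℂ)) (k n : ℕ) :
    ∃ C, ∀ p, ‖p‖ ^ k * ‖iteratedFDeriv ℝ n ψ p‖ ≤ C * decayBound p := by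
  obtain ⟨A, -, hA⟩ := ψ.decay k n
  obtain ⟨B, -, hB⟩ := ψ.decay (4 + k) n
  refine ⟨_, le_decayBound (fun p => by positivity) hA (B := B) fun p => ?_⟩
  rw [← mul_assoc, ← pow_add]
  exact hB p

theorem exists_schwartz_le (ψ : 𝓢(Plane, ℂ)) : ∃ C, ∀ p, ‖ψ p‖ ≤ C * decayBound p := by
  simpa using exists_pow_mul_schwartz_le ψ 0 0

theorem rpow_le_one_add_pow (hα : 0 ≤ α) {r : ℝ} (hr : 0 ≤ r) : r ^ α ≤ 1 + r ^ ⌈α⌉₊ := by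
  rcases le_total r 1 with h | h
  · have := Real.rpow_le_one hr h hα
    have : 0 ≤ r ^ ⌈α⌉₊ := by positivity
    linarith
  · have := Real.rpow_le_rpow_of_exponent_le h (Nat.le_ceil α)
    rw [Real.rpow_natCast] at this
    linarith

theorem exists_genTest_le (hα : 0 ≤ α) (hκ : 0 ≤ κ) (ψ : 𝓢(Plane, ℂ)) :
    ∃ C, ∀ p, ‖genTest κ α ψ p‖ ≤ C * decayBound p := by
  obtain ⟨C0, h0⟩ := exists_pow_mul_schwartz_le ψ 0 0
  obtain ⟨C1, h1⟩ := exists_pow_mul_schwartz_le ψ ⌈α⌉₊ 0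
  obtain ⟨C2, h2⟩ := exists_pow_mul_schwartz_le ψ 1 1
  simp only [pow_zero, one_mul, norm_iteratedFDeriv_zero, pow_one,
    norm_iteratedFDeriv_one] at h0 h1 h2
  refine ⟨κ * (C0 + C1) + 1 / α * C2, fun p => ?_⟩
  have hp : ‖fderiv ℝ ψ p p‖ ≤ C2 * decayBound p := by
    refine ((fderiv ℝ ψ p).le_opNorm p).trans ?_
    rw [mul_comm]
    exact h2 p
  calc ‖genTest κ α ψ p‖ ≤ κ * ‖p‖ ^ α * ‖ψ p‖ + 1 / α * ‖fderiv ℝ ψ p p‖ := by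
        refine (norm_add_le _ _).trans_eq ?_
        rw [norm_mul, norm_mul, norm_neg, Complex.norm_real, Complex.norm_real,
          Real.norm_of_nonneg (by positivity), Real.norm_of_nonneg (by positivity)]
    _ ≤ κ * (1 + ‖p‖ ^ ⌈α⌉₊) * ‖ψ p‖ + 1 / α * (C2 * decayBound p) := by
        gcongr
        exact rpow_le_one_add_pow hα (norm_nonneg _)
    _ = κ * (‖ψ p‖ + ‖p‖ ^ ⌈α⌉₊ * ‖ψ p‖) + 1 / α * (C2 * decayBound p) := by ring
    _ ≤ κ * (C0 * decayBound p + C1 * decayBound p) + 1 / α * (C2 * decayBound p) := by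
        have := add_le_add (h0 p) (h1 p)
        gcongr κ * ?_ + _
    _ = _ := by ring

theorem continuous_genTest (hα : 0 ≤ α) (ψ : 𝓢(Plane, ℂ)) : Continuous (genTest κ α ψ) := by
  have h1 : Continuous fun p : Plane => ‖p‖ ^ α :=
    continuous_norm.rpow_const fun _ => Or.inr hα
  have h2 : Continuous fun p : Plane => fderiv ℝ ψ p p := by
    have : Continuous (fderiv ℝ (ψ : Plane → ℂ)) := (ψ.smooth 1).continuous_fderiv (by simp)
    exact this.clm_apply continuous_id
  have h3 := ψ.continuous
  unfold genTest
  fun_prop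

theorem integrable_genTest (hα : 0 ≤ α) (hκ : 0 ≤ κ) (ψ : 𝓢(Plane, ℂ)) :
    Integrable (genTest κ α ψ) := by
  obtain ⟨C, hC⟩ := exists_genTest_le hα hκ ψ
  exact (integrable_decayBound.const_mul C).mono'
    (continuous_genTest hα ψ).aestronglyMeasurable (Eventually.of_forall hC)

theorem exp_orbit_le_one (hκ : 0 ≤ κ) {t : ℝ} (ht : 0 ≤ t) (p : Plane) :
    Real.exp (-(κ * (Real.exp t - 1) * ‖p‖ ^ α)) ≤ 1 := by
  rw [Real.exp_le_one_iff, neg_nonpos]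
  have : 0 ≤ Real.exp t - 1 := by linarith [Real.one_le_exp ht]
  positivity

/-- For `t ≥ 0` the exponential factor is at most one and the dilation pushes points outward, where
`decayBound` is smaller. One integrable bound therefore serves all times. -/
theorem norm_orbit_mul_le (hκ : 0 ≤ κ) (hα : 0 ≤ α) {u : Plane → ℂ} {C : ℝ}
    (hu : ∀ p, ‖u p‖ ≤ C * decayBound p) {t : ℝ} (ht : 0 ≤ t) (p : Plane) :
    ‖((Real.exp (-(κ * (Real.exp t - 1) * ‖p‖ ^ α)) : ℝ) : ℂ) * u (Real.exp (t / α) • p)‖ ≤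
      C * decayBound p := by
  have hC : 0 ≤ C := by
    have := (norm_nonneg _).trans (hu 0)
    simpa [decayBound] using this
  rw [norm_mul, Complex.norm_real, Real.norm_of_nonneg (Real.exp_pos _).le]
  refine (mul_le_of_le_one_left (norm_nonneg _) (exp_orbit_le_one hκ ht p)).trans
    ((hu _).trans ?_)
  gcongr
  exact decayBound_exp_smul_le (Real.one_le_exp (by positivity)) p

theorem continuous_orbitTest (hα : 0 ≤ α) {ψ : Plane → ℂ} (hψ : Continuous ψ) (t : ℝ) :
    Continuous (orbitTest κ α t ψ) := by
  have h1 : Continuous fun p : Plane => ‖p‖ ^ α :=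
    continuous_norm.rpow_const fun _ => Or.inr hα
  unfold orbitTest
  fun_prop

/-- The transposed semigroup has generator `genTest`, tested against bounded functions. -/
theorem tendsto_integral_orbitTest (hα : 0 < α) (hκ : 0 ≤ κ) (ψ : 𝓢(Plane, ℂ)) {F : Plane → ℂ}
    (hF : Continuous F) {B : ℝ} (hB : ∀ p, ‖F p‖ ≤ B) :
    Tendsto (fun t : ℝ => ((t⁻¹ : ℝ) : ℂ) * ((∫ p, F p * orbitTest κ α t ψ p) - ∫ p, F p * ψ p))
      (𝓝[>] 0) (𝓝 (∫ p, F p * genTest κ α ψ p)) := by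
  have hB0 : 0 ≤ B := (norm_nonneg _).trans (hB 0)
  obtain ⟨C, hC⟩ := exists_genTest_le hα.le hκ ψ
  obtain ⟨C', hC'⟩ := exists_schwartz_le ψ
  have hψd : Differentiable ℝ ψ := ψ.differentiable
  have hlim : Tendsto (fun t : ℝ => ∫ p, F p * (((t⁻¹ : ℝ) : ℂ) * (orbitTest κ α t ψ p - ψ p)))
      (𝓝[>] 0) (𝓝 (∫ p, F p * genTest κ α ψ p)) := by
    refine tendsto_integral_filter_of_dominated_convergence
      (fun p => B * (C * decayBound p)) ?_ ?_ ((integrable_decayBound.const_mul C).const_mul B) ?_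
    · refine Eventually.of_forall fun t => Continuous.aestronglyMeasurable ?_
      exact hF.mul (continuous_const.mul
        ((continuous_orbitTest hα.le ψ.continuous t).sub ψ.continuous))
    · filter_upwards [self_mem_nhdsWithin] with t ht
      rw [Set.mem_Ioi] at ht
      refine Eventually.of_forall fun p => ?_
      rw [norm_mul]
      refine mul_le_mul (hB p) ?_ (norm_nonneg _) hB0
      -- The mean value inequality on `[0, t]` dominates the difference quotient by `C * decayBound
      -- p`, independently of `t`.
      have := Convex.norm_image_sub_le_of_norm_hasDerivWithin_le (s := Set.Icc 0 t)
        (f := fun s => orbitTest κ α s ψ p) (C := C * decayBound p)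
        (fun s hs => (hasDerivAt_orbitTest hα hψd p s).hasDerivWithinAt)
        (fun s hs => norm_orbit_mul_le hκ hα.le hC hs.1 p) (convex_Icc 0 t)
        (Set.left_mem_Icc.2 ht.le) (Set.right_mem_Icc.2 ht.le)
      rw [orbitTest_zero, sub_zero, Real.norm_of_nonneg ht.le] at this
      rw [norm_mul, Complex.norm_real, Real.norm_of_nonneg (by positivity), inv_mul_le_iff₀ ht,
        mul_comm]
      exact this
    · refine Eventually.of_forall fun p => ?_
      refine Tendsto.const_mul _ ?_
      have h := hasDerivAt_orbitTest (κ := κ) hα hψd p 0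
      have h' := (hasDerivWithinAt_iff_tendsto_slope' (s := Set.Ioi (0 : ℝ)) (by simp)).1
        (h.hasDerivWithinAt (s := Set.Ioi 0))
      have e : ((Real.exp (-(κ * (Real.exp 0 - 1) * ‖p‖ ^ α)) : ℝ) : ℂ) *
          genTest κ α ψ (Real.exp (0 / α) • p) = genTest κ α ψ p := by simp
      rw [e] at h'
      refine h'.congr fun t => ?_
      rw [slope_def_module, sub_zero, orbitTest_zero, ← Complex.coe_smul, smul_eq_mul]
  refine hlim.congr' ?_
  filter_upwards [self_mem_nhdsWithin] with t ht
  rw [Set.mem_Ioi] at ht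
  have i1 : Integrable fun p => F p * ψ p :=
    ψ.integrable.bdd_mul (c := B) hF.aestronglyMeasurable (Eventually.of_forall hB)
  have i2 : Integrable fun p => F p * orbitTest κ α t ψ p := by
    refine Integrable.bdd_mul (c := B) ?_ hF.aestronglyMeasurable (Eventually.of_forall hB)
    exact (integrable_decayBound.const_mul C').mono'
      (continuous_orbitTest hα.le ψ.continuous t).aestronglyMeasurable
      (Eventually.of_forall fun p => norm_orbit_mul_le hκ hα.le hC' ht.le p)
  rw [← integral_sub i2 i1, ← integral_const_mul]
  congr 1
  ext p
  ring

/-! ### The formal transpose on the Fourier side -/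

theorem fourierHat_fourierHat (ψ : 𝓢(Plane, ℂ)) (p : Plane) :
    ((2 * Real.pi : ℝ) : ℂ)⁻¹ ^ 2 * fourierHat (fourierHat ψ) p = ψ (-p) := by
  obtain ⟨φ, hφ⟩ := exists_schwartz_eq_fourierHat ψ
  have e : fourierInvHat ψ = fun x => ((2 * Real.pi : ℝ) : ℂ)⁻¹ ^ 2 * φ (-x) := by
    ext x
    rw [fourierInvHat, ← hφ, fourierHat]
    congr 2
    ext p
    rw [inner_neg_right, real_inner_comm]
    push_cast
    rw [mul_neg, neg_neg]
  have h := fourierHat_fourierInvHat ψ.continuous ψ.integrable (by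
    rw [e]
    exact φ.integrable.comp_neg.const_mul _)
  rw [hφ, ← congrFun h (-p), e, fourierHat, fourierHat, ← integral_const_mul,
    ← integral_neg_eq_self]
  congr 1
  ext x
  rw [inner_neg_left, inner_neg_right]
  ring

theorem fracLap_fourierHat (ψ : 𝓢(Plane, ℂ)) (x : Plane) :
    fracLap α (fourierHat ψ) x = fourierHat (fun p => ((‖p‖ ^ α : ℝ) : ℂ) * ψ p) x := by
  rw [fracLap, fourierInvHat, fourierHat, ← integral_const_mul, ← integral_neg_eq_self]
  congr 1
  ext p
  have := fourierHat_fourierHat ψ (-p)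
  rw [neg_neg] at this
  rw [← this, norm_neg, inner_neg_right, real_inner_comm]
  push_cast
  ring_nf

theorem integral_orbitTest_zero_exp (ψ : Plane → ℂ) (t : ℝ) (x : Plane) :
    ∫ p, Complex.exp (-(Complex.I * (inner ℝ p x : ℝ))) * orbitTest 0 α t ψ p =
      ((Real.exp (-(2 * t / α)) : ℝ) : ℂ) * fourierHat ψ (Real.exp (-(t / α)) • x) := by
  have h := Measure.integral_comp_smul (volume : Measure Plane) (fun q : Plane =>
    Complex.exp (-(Complex.I * (inner ℝ q (Real.exp (-(t / α)) • x) : ℝ))) * ψ q)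
    (Real.exp (t / α))
  rw [fourierHat]
  have e : |(Real.exp (t / α) ^ Module.finrank ℝ Plane)⁻¹| = Real.exp (-(2 * t / α)) := by
    rw [abs_of_pos (by positivity), finrank_euclideanSpace, Fintype.card_fin, ← Real.exp_nat_mul,
      ← Real.exp_neg]
    congr 2
    push_cast
    ring
  rw [e, ← Complex.coe_smul, smul_eq_mul] at h
  rw [← h]
  congr 1
  ext p
  rw [orbitTest, real_inner_smul_left, real_inner_smul_right, ← mul_assoc, ← mul_assoc,
    ← Real.exp_add]
  simp

/-- `x·∇ψ̂ = -2ψ̂ - (p·∇ψ)^`. -/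
theorem fourierHat_genTest_zero (hα : 0 < α) (ψ φ : 𝓢(Plane, ℂ)) (h : fourierHat ψ = φ)
    (x : Plane) : fourierHat (genTest 0 α ψ) x =
      -(((1 / α : ℝ) : ℂ) * (2 * φ x + fderiv ℝ φ x x)) := by
  -- For `κ = 0` the orbit is a dilation. Tested against an exponential, its limit is the transform
  -- of `genTest 0 α ψ`, while its difference quotient is explicit by scaling `ψ̂`. Comparing the
  -- two replaces an integration by parts.
  have h1 := tendsto_integral_orbitTest (κ := 0) hα le_rfl ψ
    (F := fun p => Complex.exp (-(Complex.I * (inner ℝ p x : ℝ)))) (by fun_prop) (B := 1)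
    (fun p => (norm_exp_neg_I_mul _).le)
  refine tendsto_nhds_unique h1 ?_
  have h2 : HasDerivAt (fun t : ℝ => ((Real.exp (-(2 * t / α)) : ℝ) : ℂ) *
      φ (Real.exp (-(t / α)) • x)) (-(((1 / α : ℝ) : ℂ) * (2 * φ x + fderiv ℝ φ x x))) 0 := by
    have d1 : HasDerivAt (fun t : ℝ => Real.exp (-(2 * t / α))) (-(2 * 1 / α)) 0 := by
      have := ((((hasDerivAt_id (0 : ℝ)).const_mul 2).div_const α).fun_neg).exp
      simpa using this
    have d2 : HasDerivAt (fun t : ℝ => Real.exp (-(t / α)) • x) (-(1 / α) • x) 0 := by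
      have := ((((hasDerivAt_id (0 : ℝ)).div_const α).fun_neg).exp).smul_const x
      simpa using this
    have d3 : HasDerivAt (fun t : ℝ => φ (Real.exp (-(t / α)) • x))
        (fderiv ℝ φ x (-(1 / α) • x)) 0 := by
      refine HasFDerivAt.comp_hasDerivAt (0 : ℝ) (l := φ) ?_ d2
      simpa using (φ.differentiable x).hasFDerivAt
    refine (d1.ofReal_comp.fun_mul d3).congr_deriv ?_
    rw [(fderiv ℝ φ x).map_smul, ← Complex.coe_smul, smul_eq_mul]
    simp only [mul_zero, zero_div, neg_zero, Real.exp_zero, one_smul]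
    push_cast
    ring
  have h3 := (hasDerivWithinAt_iff_tendsto_slope' (s := Set.Ioi (0 : ℝ)) (by simp)).1
    (h2.hasDerivWithinAt (s := Set.Ioi 0))
  refine h3.congr fun t => ?_
  rw [slope_def_module, sub_zero, integral_orbitTest_zero_exp, h, ← Complex.coe_smul, smul_eq_mul]
  have : ∫ p, Complex.exp (-(Complex.I * (inner ℝ p x : ℝ))) * ψ p = φ x := congrFun h x
  rw [this]
  simp

/-- `-|p|^α ψ + (1/α) p·∇ψ + (1 + (β-1)/α) ψ`. -/
def transposeTest (α β : ℝ) (ψ : Plane → ℂ) (p : Plane) : ℂ :=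
  genTest 1 α ψ p + ((1 + (β - 1) / α : ℝ) : ℂ) * ψ p

theorem integrable_transposeTest (hα : 0 ≤ α) (ψ : 𝓢(Plane, ℂ)) :
    Integrable (transposeTest α β ψ) :=
  (integrable_genTest hα zero_le_one ψ).add (ψ.integrable.const_mul _)

theorem formalTranspose_eq (hα : 0 < α) (ψ φ : 𝓢(Plane, ℂ)) (h : fourierHat ψ = φ)
    (x : Plane) : formalTranspose α β φ x = fourierHat (transposeTest α β ψ) x := by
  have i0 := integrable_exp_mul (integrable_genTest hα.le (le_refl 0) ψ) x
  have i1 := integrable_exp_mul (integrable_genTest hα.le zero_le_one ψ) x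
  have i2 := integrable_exp_mul ψ.integrable x
  -- The two generators differ exactly by `|p|^α ψ`, so the fractional Laplacian and the drift
  -- combine into `genTest 1 α ψ`.
  have e1 : fourierHat (fun p => ((‖p‖ ^ α : ℝ) : ℂ) * ψ p) x =
      fourierHat (genTest 0 α ψ) x - fourierHat (genTest 1 α ψ) x := by
    simp only [fourierHat]
    rw [← integral_sub i0 i1]
    congr 1
    ext p
    simp only [genTest]
    push_cast
    ring
  have e2 : fourierHat (transposeTest α β ψ) x =
      fourierHat (genTest 1 α ψ) x + ((1 + (β - 1) / α : ℝ) : ℂ) * fourierHat ψ x := by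
    simp only [fourierHat]
    rw [← integral_const_mul, ← integral_add i1 (i2.const_mul _)]
    congr 1
    ext p
    simp only [transposeTest]
    ring
  have e3 : fracLap α φ x = fourierHat (fun p => ((‖p‖ ^ α : ℝ) : ℂ) * ψ p) x := by
    rw [← h, fracLap_fourierHat]
  rw [formalTranspose, e3, e1, e2, h, fourierHat_genTest_zero hα ψ φ h]
  ring

/-- Schwartz functions are exactly the transforms of Schwartz functions, and the multiplication
formula moves the transform onto `f` and `g`. -/
theorem isScaledL_iff (hα : 0 < α) (f g : L22) : IsScaledL α β f g ↔
    ∀ ψ : 𝓢(Plane, ℂ), ∫ p, hat g p * ψ p = ∫ p, hat f p * transposeTest α β ψ p := by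
  constructor
  · intro h ψ
    obtain ⟨φ, hφ⟩ := exists_schwartz_eq_fourierHat ψ
    rw [integral_hat_mul g ψ.integrable, integral_hat_mul f (integrable_transposeTest hα.le ψ),
      hφ, h φ]
    simp only [formalTranspose_eq hα ψ φ hφ]
  · intro h φ
    obtain ⟨ψ, hψ⟩ := exists_schwartz_fourierHat_eq φ
    have := h ψ
    rw [integral_hat_mul g ψ.integrable, integral_hat_mul f (integrable_transposeTest hα.le ψ),
      hψ] at this
    simp only [formalTranspose_eq hα ψ φ hψ]
    exact this

end ScaledVariables

/-! ### The generator of the flow is `𝓛` with its maximal domain. -/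

namespace ScaledVariables

open scoped ENNReal NNReal
open UnboundedOp

variable {α β : ℝ}

/-! ### The generator of the flow -/

theorem exists_norm_hat_le (f : L22) : ∃ B, ∀ p, ‖hat f p‖ ≤ B := ⟨_, norm_hat_le f⟩

theorem integral_comp_exp_smul (u : Plane → ℂ) (t : ℝ) :
    ∫ p : Plane, u (Real.exp (t / α) • p) = ((Real.exp (-(2 * t / α)) : ℝ) : ℂ) * ∫ p, u p := by
  have h := Measure.integral_comp_smul (volume : Measure Plane) u (Real.exp (t / α))
  have e : |(Real.exp (t / α) ^ Module.finrank ℝ Plane)⁻¹| = Real.exp (-(2 * t / α)) := by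
    rw [abs_of_pos (by positivity), finrank_euclideanSpace, Fintype.card_fin, ← Real.exp_nat_mul,
      ← Real.exp_neg]
    congr 2
    push_cast
    ring
  rw [h, e, ← Complex.coe_smul, smul_eq_mul]

/-- The substitution `p ↦ e^{t/α} p` moves the flow onto the test function. Its Jacobian `e^{2t/α}`
changes the rate `λ₀` into `1 + (β-1)/α`. -/
theorem integral_hat_flow_mul (hα : 1 < α) {t : ℝ} (ht : 0 ≤ t) (f : L22) (ψ : Plane → ℂ) :
    ∫ p, hat (flow α β t f) p * ψ p = ((Real.exp ((1 + (β - 1) / α) * t) : ℝ) : ℂ) *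
      ∫ p, hat f p * orbitTest 1 α t ψ p := by
  have h := integral_comp_exp_smul (α := α) (fun p => hat (flow α β t f) p * ψ p) t
  have e : ∀ p : Plane, hat (flow α β t f) (Real.exp (t / α) • p) * ψ (Real.exp (t / α) • p) =
      ((Real.exp (topRate α β * t) : ℝ) : ℂ) * (hat f p * orbitTest 1 α t ψ p) := fun p => by
    have e1 : (1 - Real.exp (-t)) * (Real.exp t * ‖p‖ ^ α) = 1 * (Real.exp t - 1) * ‖p‖ ^ α := by
      have : Real.exp (-t) * Real.exp t = 1 := by rw [← Real.exp_add]; simp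
      linear_combination -‖p‖ ^ α * this
    rw [hat_flow hα ht, norm_exp_smul_rpow (by linarith), orbitTest, smul_smul, ← Real.exp_add,
      neg_add_cancel, Real.exp_zero, one_smul, e1]
    ring
  simp only [e] at h
  rw [integral_const_mul] at h
  have e2 : Real.exp ((1 + (β - 1) / α) * t) =
      Real.exp (2 * t / α) * Real.exp (topRate α β * t) := by
    rw [← Real.exp_add, topRate]
    congr 1
    ring
  have e3 : ((Real.exp (2 * t / α) : ℝ) : ℂ) * ((Real.exp (-(2 * t / α)) : ℝ) : ℂ) = 1 := by
    rw [← Complex.ofReal_mul, ← Real.exp_add]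
    simp
  rw [e2]
  push_cast at h e3 ⊢
  rw [mul_assoc, h, ← mul_assoc, e3, one_mul]

/-- The constant `c` is left free: `1 + (β-1)/α` gives the transpose of `𝓛`, and subtracting `z`
from it gives the transpose of `𝓛 - z`. -/
theorem tendsto_exp_mul_integral_orbitTest (hα : 0 < α) (ψ : 𝓢(Plane, ℂ)) {F : Plane → ℂ}
    (hF : Continuous F) {B : ℝ} (hB : ∀ p, ‖F p‖ ≤ B) (c : ℂ) :
    Tendsto (fun t : ℝ => ((t⁻¹ : ℝ) : ℂ) *
      (Complex.exp (c * t) * (∫ p, F p * orbitTest 1 α t ψ p) - ∫ p, F p * ψ p)) (𝓝[>] 0)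
      (𝓝 (∫ p, F p * (genTest 1 α ψ p + c * ψ p))) := by
  have h1 := tendsto_integral_orbitTest hα zero_le_one ψ hF hB
  have h2 : Tendsto (fun t : ℝ => Complex.exp (c * t)) (𝓝[>] 0) (𝓝 1) := by
    have : Continuous fun t : ℝ => Complex.exp (c * t) := by fun_prop
    simpa using (this.tendsto 0).mono_left (nhdsWithin_le_nhds (s := Set.Ioi 0))
  have h3 : Tendsto (fun t : ℝ => ((t⁻¹ : ℝ) : ℂ) * (Complex.exp (c * t) - 1)) (𝓝[>] 0)
      (𝓝 c) := by
    have hd : HasDerivAt (fun t : ℝ => Complex.exp (c * t)) c 0 := by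
      have := ((hasDerivAt_id (0 : ℝ)).ofReal_comp.const_mul c).cexp
      simpa using this
    have := (hasDerivWithinAt_iff_tendsto_slope' (s := Set.Ioi (0 : ℝ)) (by simp)).1
      (hd.hasDerivWithinAt (s := Set.Ioi 0))
    refine this.congr fun t => ?_
    rw [slope_def_module, sub_zero, ← Complex.coe_smul, smul_eq_mul]
    simp
  have i1 : Integrable fun p => F p * genTest 1 α ψ p :=
    (integrable_genTest hα.le zero_le_one ψ).bdd_mul (c := B) hF.aestronglyMeasurable
      (Eventually.of_forall hB)
  have i2 : Integrable fun p => F p * ψ p :=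
    ψ.integrable.bdd_mul (c := B) hF.aestronglyMeasurable (Eventually.of_forall hB)
  have e : ∫ p, F p * (genTest 1 α ψ p + c * ψ p) =
      1 * (∫ p, F p * genTest 1 α ψ p) + c * ∫ p, F p * ψ p := by
    rw [one_mul, ← integral_const_mul, ← integral_add i1 (i2.const_mul c)]
    congr 1
    ext p
    ring
  rw [e]
  refine ((h2.mul h1).add (h3.mul_const (∫ p, F p * ψ p))).congr fun t => ?_
  ring

/-- The generator of the flow is a restriction of `𝓛`. -/
theorem isScaledL_of_inGenerator (hα : 1 < α) {f g : L22} (h : InGenerator (flow α β) f g) :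
    IsScaledL α β f g := by
  refine (isScaledL_iff (by linarith) f g).2 fun ψ => ?_
  obtain ⟨φ, hφ⟩ := exists_schwartz_eq_fourierHat ψ
  obtain ⟨l, hl⟩ := exists_schwartz_functional φ
  have hl' : ∀ u, l u = ∫ p, hat u p * ψ p := fun u => by
    rw [hl, integral_hat_mul u ψ.integrable, hφ]
  have h1 := (l.continuous.tendsto g).comp h
  rw [hl'] at h1
  have h2 := tendsto_exp_mul_integral_orbitTest (by linarith : 0 < α) ψ (continuous_hat f)
    (norm_hat_le f) ((1 + (β - 1) / α : ℝ) : ℂ)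
  refine tendsto_nhds_unique h1 (h2.congr' ?_)
  filter_upwards [self_mem_nhdsWithin] with t ht
  rw [Function.comp_apply, map_smul, map_sub, smul_eq_mul, hl', hl',
    integral_hat_flow_mul hα (le_of_lt ht)]
  push_cast
  ring

/-! ### Injectivity of `z - 𝓛` for large `Re z` -/

/-- The function `|p|^α` need not be smooth at the origin. Test functions supported away from it
remain test functions along the orbit. -/
theorem contDiff_orbitTest {ψ : Plane → ℂ} (hψ : ContDiff ℝ ∞ ψ) (h0 : (0 : Plane) ∉ tsupport ψ)
    (α t : ℝ) : ContDiff ℝ ∞ (orbitTest 1 α t ψ) := by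
  rw [contDiff_iff_contDiffAt]
  intro p
  have hlin : ContDiff ℝ ∞ fun q : Plane => Real.exp (t / α) • q := contDiff_const_smul _
  by_cases hp : p = 0
  · have hz : orbitTest 1 α t ψ =ᶠ[𝓝 p] fun _ => 0 := by
      have h1 := notMem_tsupport_iff_eventuallyEq.1 h0
      have h2 : Tendsto (fun q : Plane => Real.exp (t / α) • q) (𝓝 p) (𝓝 0) := by
        have := hlin.continuous.tendsto p
        rw [hp, smul_zero] at this
        rwa [hp]
      filter_upwards [h2.eventually h1] with q hq
      rw [orbitTest, hq]
      simp
    exact contDiffAt_const.congr_of_eventuallyEq hz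
  · unfold orbitTest
    refine ContDiffAt.mul ?_ (hψ.comp hlin).contDiffAt
    refine Complex.ofRealCLM.contDiff.contDiffAt.comp p (ContDiffAt.exp ?_)
    exact (contDiffAt_const.mul ((contDiffAt_norm ℝ hp).rpow_const_of_ne
      (norm_ne_zero_iff.2 hp))).neg

theorem hasCompactSupport_orbitTest {ψ : Plane → ℂ} (hψ : HasCompactSupport ψ) (α t : ℝ) :
    HasCompactSupport (orbitTest 1 α t ψ) :=
  (hψ.comp_smul (Real.exp_ne_zero (t / α))).mul_left

/-- `𝓛` has no eigenvalue with real part above `λ₀`. -/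
theorem eq_zero_of_isScaledL_smul (hα : 1 < α) {f : L22} {z : ℂ} (hz : topRate α β < z.re)
    (h : IsScaledL α β f (z • f : L22)) : f = 0 := by
  have hα0 : 0 < α := by linarith
  rw [isScaledL_iff hα0] at h
  set F := hat f with hF
  have hFc : Continuous F := continuous_hat f
  obtain ⟨B, hB⟩ := exists_norm_hat_le f
  have key : ∀ ψ : Plane → ℂ, ContDiff ℝ ∞ ψ → HasCompactSupport ψ → (0 : Plane) ∉ tsupport ψ →
      ∫ p, F p * ψ p = 0 := by
    intro ψ hψ hc h0
    set c : ℂ := ((1 + (β - 1) / α : ℝ) : ℂ) - z with hcdef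
    set u : ℝ → ℂ := fun t => Complex.exp (c * t) * ∫ p, F p * orbitTest 1 α t ψ p with hu
    let Ψ : ℝ → 𝓢(Plane, ℂ) := fun t =>
      (hasCompactSupport_orbitTest hc α t).toSchwartzMap (contDiff_orbitTest hψ h0 α t)
    have hΨ : ∀ t, (Ψ t : Plane → ℂ) = orbitTest 1 α t ψ := fun t => rfl
    have hψ0 : (Ψ 0 : Plane → ℂ) = ψ := by rw [hΨ, orbitTest_zero]
    obtain ⟨C, hC⟩ := exists_schwartz_le (Ψ 0)
    rw [hψ0] at hC
    -- The semigroup law of `orbitTest` reduces the right derivative at `t` to the one at `0` for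
    -- the test function `Ψ t`, and there the equation `𝓛 f = z f` makes it vanish.
    have hder : ∀ t, HasDerivWithinAt u 0 (Set.Ici t) t := by
      intro t
      have h1 := tendsto_exp_mul_integral_orbitTest hα0 (Ψ t) hFc hB c
      have h2 : ∫ p, F p * (genTest 1 α (Ψ t) p + c * Ψ t p) = 0 := by
        have h3 := h (Ψ t)
        have i1 : Integrable fun p => F p * transposeTest α β (Ψ t) p :=
          (integrable_transposeTest hα0.le (Ψ t)).bdd_mul (c := B) hFc.aestronglyMeasurable
            (Eventually.of_forall hB)
        have i2 : Integrable fun p => F p * Ψ t p :=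
          (Ψ t).integrable.bdd_mul (c := B) hFc.aestronglyMeasurable (Eventually.of_forall hB)
        have e : ∫ p, hat (z • f) p * Ψ t p = z * ∫ p, F p * Ψ t p := by
          rw [← integral_const_mul]
          congr 1
          ext p
          rw [hat_smul, mul_assoc]
        rw [e, ← integral_const_mul] at h3
        rw [← sub_eq_zero.2 h3.symm, ← integral_sub i1 (i2.const_mul z)]
        congr 1
        ext p
        rw [hcdef, transposeTest]
        ring
      rw [h2] at h1
      have h4 : Tendsto (fun s : ℝ => slope u t (t + s)) (𝓝[>] 0) (𝓝 0) := by
        have := h1.const_mul (Complex.exp (c * t))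
        rw [mul_zero] at this
        refine this.congr fun s => ?_
        rw [slope_def_module, add_sub_cancel_left, ← Complex.coe_smul, smul_eq_mul, hu]
        simp only [hΨ]
        rw [orbitTest_orbitTest hα0]
        push_cast
        rw [mul_add, Complex.exp_add]
        ring
      rw [← hasDerivWithinAt_Ioi_iff_Ici, hasDerivWithinAt_iff_tendsto_slope' (by simp)]
      have h5 : Tendsto (fun r : ℝ => r - t) (𝓝[>] t) (𝓝[>] 0) := by
        refine tendsto_nhdsWithin_iff.2 ⟨?_, ?_⟩
        · have : Continuous fun r : ℝ => r - t := by fun_prop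
          simpa using (this.tendsto t).mono_left (nhdsWithin_le_nhds (s := Set.Ioi t))
        · filter_upwards [self_mem_nhdsWithin] with r hr
          exact Set.mem_Ioi.2 (sub_pos.2 (Set.mem_Ioi.1 hr))
      refine (h4.comp h5).congr fun r => ?_
      rw [Function.comp_apply, add_sub_cancel]
    have hcont : ContinuousOn u (Set.Ici 0) := by
      refine ContinuousOn.mul (Continuous.continuousOn (by fun_prop)) ?_
      refine continuousOn_of_dominated (bound := fun p => B * (C * decayBound p)) ?_ ?_
        ((integrable_decayBound.const_mul C).const_mul B) ?_
      · intro t _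
        exact (hFc.mul (continuous_orbitTest hα0.le hψ.continuous t)).aestronglyMeasurable
      · intro t ht
        refine Eventually.of_forall fun p => ?_
        rw [norm_mul]
        exact mul_le_mul (hB p) (norm_orbit_mul_le zero_le_one hα0.le hC ht p) (norm_nonneg _)
          ((norm_nonneg _).trans (hB 0))
      · refine Eventually.of_forall fun p => Continuous.continuousOn ?_
        have := hψ.continuous
        unfold orbitTest
        fun_prop
    have hconst : ∀ t, 0 ≤ t → u t = u 0 := fun t ht =>
      constant_of_has_deriv_right_zero (hcont.mono Set.Icc_subset_Ici_self)
        (fun s _ => hder s) t (Set.right_mem_Icc.2 ht)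
    -- The boundedness of `F` and the scaling `e^{-2t/α}` of `‖ψ(e^{t/α}·)‖₁` give the rate `λ₀ - Re
    -- z < 0`. A constant function with this bound is zero.
    have hbound : ∀ t, 0 ≤ t →
        ‖u t‖ ≤ Real.exp ((topRate α β - z.re) * t) * (B * ∫ p, ‖ψ p‖) := by
      intro t ht
      have hint : ∫ p, ‖ψ (Real.exp (t / α) • p)‖ = Real.exp (-(2 * t / α)) * ∫ p, ‖ψ p‖ := by
        have := integral_comp_exp_smul (α := α) (fun p => ((‖ψ p‖ : ℝ) : ℂ)) t
        rw [integral_complex_ofReal, integral_complex_ofReal] at this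
        exact_mod_cast this
      have hn : ‖∫ p, F p * orbitTest 1 α t ψ p‖ ≤ B * ∫ p, ‖ψ (Real.exp (t / α) • p)‖ := by
        rw [← integral_const_mul]
        have hi : Integrable fun p => ‖ψ (Real.exp (t / α) • p)‖ :=
          ((hψ.continuous.integrable_of_hasCompactSupport hc).comp_smul
            (Real.exp_ne_zero (t / α))).norm
        refine norm_integral_le_of_norm_le (hi.const_mul B) (Eventually.of_forall fun p => ?_)
        rw [norm_mul]
        refine mul_le_mul (hB p) ?_ (norm_nonneg _) ((norm_nonneg _).trans (hB 0))
        rw [orbitTest, norm_mul, Complex.norm_real, Real.norm_of_nonneg (Real.exp_pos _).le]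
        exact mul_le_of_le_one_left (norm_nonneg _) (exp_orbit_le_one zero_le_one ht p)
      rw [hu]
      simp only
      rw [norm_mul, Complex.norm_exp]
      have e1 : (c * t).re = (1 + (β - 1) / α - z.re) * t := by simp [hcdef]
      have e2 : Real.exp ((topRate α β - z.re) * t) =
          Real.exp ((1 + (β - 1) / α - z.re) * t) * Real.exp (-(2 * t / α)) := by
        rw [← Real.exp_add, topRate]
        congr 1
        ring
      rw [e1, e2]
      rw [hint] at hn
      calc _ ≤ Real.exp ((1 + (β - 1) / α - z.re) * t) *
            (B * (Real.exp (-(2 * t / α)) * ∫ p, ‖ψ p‖)) := by gcongr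
        _ = _ := by ring
    have hlim : Tendsto (fun t : ℝ => Real.exp ((topRate α β - z.re) * t) * (B * ∫ p, ‖ψ p‖))
        atTop (𝓝 0) := by
      have h1 : Tendsto (fun t : ℝ => (topRate α β - z.re) * t) atTop atBot :=
        tendsto_id.const_mul_atTop_of_neg (by linarith)
      simpa using (Real.tendsto_exp_atBot.comp h1).mul_const (B * ∫ p, ‖ψ p‖)
    have hu0 : u 0 = 0 := by
      rw [← norm_le_zero_iff]
      refine ge_of_tendsto hlim ?_
      filter_upwards [eventually_ge_atTop 0] with t ht
      rw [← hconst t ht]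
      exact hbound t ht
    rw [hu] at hu0
    simpa [orbitTest_zero] using hu0
  -- The tests only see the punctured plane. The origin is recovered from the continuity of `F`; a
  -- distribution supported there is thereby excluded.
  have hae : ∀ᵐ p : Plane, p ∈ ({0}ᶜ : Set Plane) → F p = 0 := by
    refine IsOpen.ae_eq_zero_of_integral_contDiff_smul_eq_zero isOpen_compl_singleton
      (hFc.locallyIntegrable.locallyIntegrableOn _) fun g hg hc hs => ?_
    have h1 : HasCompactSupport fun x => (g x : ℂ) := hc.comp_left (g := ((↑) : ℝ → ℂ)) (by simp)
    have h2 : ContDiff ℝ ∞ fun x => (g x : ℂ) := Complex.ofRealCLM.contDiff.comp hg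
    have h3 : (0 : Plane) ∉ tsupport fun x => (g x : ℂ) := fun hm => by
      have : (0 : Plane) ∈ tsupport g := by
        refine closure_mono (fun x hx => ?_) hm
        rw [Function.mem_support] at hx ⊢
        exact_mod_cast hx
      exact hs this rfl
    simpa [mul_comm] using key _ h2 h1 h3
  have hF0 : F = fun _ => 0 := by
    refine Continuous.ae_eq_iff_eq (volume : Measure Plane) hFc continuous_const |>.1 ?_
    filter_upwards [hae, ae_ne_zero] with p hp hp0
    exact hp hp0
  refine hat_injective ?_
  ext p
  have := hat_smul 0 f p
  rw [zero_smul, zero_mul] at this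
  rw [this, ← hF, hF0]

/-- The generator of the flow is `𝓛` with its maximal domain. -/
theorem isScaledL_iff_inGenerator (hα : 1 < α) {f g : L22} :
    IsScaledL α β f g ↔ InGenerator (flow α β) f g := by
  refine ⟨fun h => ?_, isScaledL_of_inGenerator hα⟩
  obtain ⟨M, hS⟩ := exists_isC0Semigroup_flow (β := β) hα
  set ν := topRate α β + 1 / α with hν
  have hb : ∀ t : ℝ, 0 ≤ t →
      ‖(flow α β t).comp (ContinuousLinearMap.id ℂ L22)‖ ≤ M * Real.exp (ν * t) := fun t ht => by
    rw [ContinuousLinearMap.comp_id]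
    exact hS.bound t ht
  have hα0 : 0 < 1 / α := by positivity
  set z : ℂ := ((ν + 1 : ℝ) : ℂ) with hzdef
  have hzre : z.re = ν + 1 := Complex.ofReal_re _
  obtain ⟨R, hR, -⟩ := hS.exists_laplace hb (z := z) (by linarith)
  -- Both `f` and `R (z f - g)` solve `(z - 𝓛) u = z f - g`. Their difference vanishes by
  -- injectivity, so `f` lies in the range of `R`, which is contained in the domain of the
  -- generator.
  have h1 := hS.inGenerator_laplace hb (by linarith) hR (z • f - g)
  rw [ContinuousLinearMap.id_apply] at h1
  have h2 := isScaledL_of_inGenerator hα h1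
  have h3 := h.add (h2.smul (-1))
  have e : g + (-1 : ℂ) • (z • R (z • f - g) - (z • f - g)) =
      z • (f + (-1 : ℂ) • R (z • f - g)) := by
    module
  rw [e] at h3
  have h4 := eq_zero_of_isScaledL_smul hα (by linarith) h3
  have h5 : R (z • f - g) = f := by
    rw [neg_one_smul, ← sub_eq_add_neg, sub_eq_zero] at h4
    exact h4.symm
  rw [h5] at h1
  simpa using h1

end ScaledVariables

/-! ### The convolution estimate for functions of mean zero. -/

namespace ScaledVariables

open scoped ENNReal NNReal
open UnboundedOp

variable {α β : ℝ}

/-! ### Convolution with functions of mean zero -/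

theorem norm_exp_neg_sub_one_le {s : ℝ} (h0 : 0 ≤ s) (h1 : s ≤ 1) (t : ℝ) :
    ‖Complex.exp (-(Complex.I * (t : ℂ))) - 1‖ ≤ 2 * |t| ^ s := by
  rcases le_total |t| 1 with h | h
  · have h2 : ‖Complex.exp (-(Complex.I * (t : ℂ))) - 1‖ ≤ |t| := by
      have := Real.norm_exp_I_mul_ofReal_sub_one_le (x := -t)
      simpa using this
    have h3 : |t| ≤ |t| ^ s := by
      have := Real.rpow_le_rpow_of_exponent_ge_of_imp (abs_nonneg t) h h1 (fun _ h => by linarith)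
      simpa using this
    have : 0 ≤ |t| ^ s := by positivity
    linarith
  · have h2 : ‖Complex.exp (-(Complex.I * (t : ℂ))) - 1‖ ≤ 1 + 1 := by
      refine (norm_sub_le _ _).trans ?_
      rw [norm_exp_neg_I_mul, norm_one]
    have := Real.one_le_rpow h h0
    linarith

/-- A function of mean zero has a Hölder continuous transform vanishing at the origin. -/
theorem enorm_hat_le_of_hat_zero {s : ℝ} (h0 : 0 ≤ s) (h1 : s ≤ 1) {h : L22} (hz : hat h 0 = 0)
    (p : Plane) : ‖hat h p‖ₑ ≤ ENNReal.ofReal (‖p‖ ^ s) *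
      (2 * eLpNorm (fun x => ((‖x‖ ^ s : ℝ) : ℂ) * h x) 1 volume) := by
  have hi := integrable_L22 h
  have e : hat h p = ∫ x : Plane, (Complex.exp (-(Complex.I * (inner ℝ x p : ℝ))) - 1) * h x := by
    rw [← sub_zero (hat h p), ← hz, hat_zero, hat, fourierHat,
      ← integral_sub (integrable_exp_mul hi p) hi]
    congr 1
    ext x
    ring
  rw [e, eLpNorm_one_eq_lintegral_enorm]
  refine (enorm_integral_le_lintegral_enorm _).trans ?_
  have hm := measurable_enorm_mul_coe h (θ := fun x => ‖x‖ ^ s) (by fun_prop)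
  rw [← lintegral_const_mul _ hm, ← lintegral_const_mul _ (hm.const_mul 2)]
  refine lintegral_mono fun x => ?_
  rw [enorm_mul, enorm_ofReal_mul (by positivity), ← ofReal_norm]
  have hb : ‖Complex.exp (-(Complex.I * (inner ℝ x p : ℝ))) - 1‖ ≤ ‖p‖ ^ s * (2 * ‖x‖ ^ s) := by
    refine (norm_exp_neg_sub_one_le h0 h1 _).trans ?_
    calc 2 * |inner ℝ x p| ^ s ≤ 2 * (‖x‖ * ‖p‖) ^ s := by
          gcongr
          exact abs_real_inner_le_norm x p
      _ = _ := by
          rw [Real.mul_rpow (norm_nonneg _) (norm_nonneg _)]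
          ring
  calc _ ≤ ENNReal.ofReal (‖p‖ ^ s * (2 * ‖x‖ ^ s)) * ‖h x‖ₑ := by gcongr
    _ = _ := by
        rw [ENNReal.ofReal_mul (by positivity), ENNReal.ofReal_mul zero_le_two]
        simp only [ENNReal.ofReal_ofNat]
        ring

theorem fourierInvHat_mul_hat {k : Plane → ℂ} (hk : Integrable k) (h : L22) (x : Plane) :
    fourierInvHat (fun p => k p * hat h p) x = ∫ t, h t * fourierInvHat k (x - t) := by
  have hi : Integrable (Function.uncurry fun p t : Plane =>
      Complex.exp (Complex.I * ((inner ℝ x p - inner ℝ t p : ℝ) : ℂ)) * (k p * h t))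
      (volume.prod volume) := by
    refine (hk.mul_prod (integrable_L22 h)).bdd_mul (c := 1)
      (Continuous.aestronglyMeasurable (by fun_prop)) (Eventually.of_forall fun z => ?_)
    rw [norm_exp_I_mul]
  have hs := integral_integral_swap hi
  have e1 : ∀ p : Plane, Complex.exp (Complex.I * (inner ℝ x p : ℝ)) * (k p * hat h p) =
      ∫ t, Complex.exp (Complex.I * ((inner ℝ x p - inner ℝ t p : ℝ) : ℂ)) * (k p * h t) := by
    intro p
    rw [hat, fourierHat, ← mul_assoc, ← integral_const_mul]
    congr 1
    ext t
    have : Complex.I * ((inner ℝ x p - inner ℝ t p : ℝ) : ℂ) =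
        Complex.I * (inner ℝ x p : ℝ) + -(Complex.I * (inner ℝ t p : ℝ)) := by
      push_cast
      ring
    rw [this, Complex.exp_add]
    ring
  simp only [fourierInvHat, e1]
  rw [hs, ← integral_const_mul]
  congr 1
  ext t
  rw [mul_left_comm]
  congr 1
  rw [← integral_const_mul]
  congr 1
  ext p
  rw [inner_sub_left]
  ring

/-- The error must be paid with `|t|²` alone or with `|t|^s` against `weight (x - t)`, the two
quantities whose norms shrink under dilation. With `z = x - t`, the critical product `|z||t|` is at
most `|t|²` if `|z| ≤ |t|`. Otherwise it is at most `(1 + |z|²)|t|^s`, by `|t| ≤ |t|^s` for `|t| ≤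
1` and by `|t| ≤ |z|` for `|t| ≥ 1`. -/
theorem abs_weight_sub_le {s : ℝ} (h0 : 0 ≤ s) (h1 : s ≤ 1) (x t : Plane) :
    |weight x - weight (x - t)| ≤ 3 * ‖t‖ ^ 2 + 2 * (weight (x - t) * ‖t‖ ^ s) := by
  obtain ⟨z, rfl⟩ : ∃ z, x = z + t := ⟨x - t, by abel⟩
  rw [add_sub_cancel_right]
  unfold weight
  have hz := norm_nonneg z
  have ht := norm_nonneg t
  have hts : 0 ≤ ‖t‖ ^ s := by positivity
  have a1 : ‖z + t‖ ≤ ‖z‖ + ‖t‖ := norm_add_le _ _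
  have a2 : ‖z‖ ≤ ‖z + t‖ + ‖t‖ := by
    calc ‖z‖ = ‖(z + t) - t‖ := by rw [add_sub_cancel_right]
      _ ≤ _ := norm_sub_le _ _
  have h2 : |1 + ‖z + t‖ ^ 2 - (1 + ‖z‖ ^ 2)| ≤ 2 * (‖z‖ * ‖t‖) + ‖t‖ ^ 2 := by
    have e := norm_add_sq_real z t
    have b := abs_le.1 (abs_real_inner_le_norm z t)
    rw [abs_le]
    constructor <;> nlinarith [b.1, b.2]
  refine h2.trans ?_
  rcases le_total ‖z‖ ‖t‖ with h | h
  · have : ‖z‖ * ‖t‖ ≤ ‖t‖ ^ 2 := by nlinarith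
    have : 0 ≤ (1 + ‖z‖ ^ 2) * ‖t‖ ^ s := by positivity
    linarith
  · rcases le_total ‖t‖ 1 with h' | h'
    · have h3 : ‖t‖ ≤ ‖t‖ ^ s := by
        have := Real.rpow_le_rpow_of_exponent_ge_of_imp ht h' h1 (fun _ h => by linarith)
        simpa using this
      have h4 : ‖z‖ * ‖t‖ ≤ (1 + ‖z‖ ^ 2) * ‖t‖ ^ s :=
        mul_le_mul (by nlinarith [sq_nonneg (‖z‖ - 1)]) h3 ht (by positivity)
      nlinarith
    · have h3 : 1 ≤ ‖t‖ ^ s := Real.one_le_rpow h' h0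
      have h4 : ‖z‖ * ‖t‖ ≤ (1 + ‖z‖ ^ 2) * ‖t‖ ^ s := by
        calc ‖z‖ * ‖t‖ ≤ (1 + ‖z‖ ^ 2) * 1 := by nlinarith
          _ ≤ _ := by gcongr
      nlinarith

/-- Convolution with a kernel of given symbol, on functions of mean zero. -/
theorem exists_eLpNorm_conv_le {d s : ℝ} {k : Plane → ℂ} (hα : 0 < α) (hk : IsSymbol α d k)
    (hd : 1 < d) (h0 : 0 ≤ s) (h1 : s < 1) :
    ∃ C : ℝ, 0 ≤ C ∧ ∀ h : L22, hat h 0 = 0 →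
      eLpNorm (conv (symbolKernel k) h) 2 wMeasure ≤ ENNReal.ofReal C *
        (eLpNorm (fun x => ((‖x‖ ^ 2 : ℝ) : ℂ) * h x) 2 volume +
          eLpNorm (fun x => ((‖x‖ ^ s : ℝ) : ℂ) * h x) 1 volume) := by
  obtain ⟨k₂, hk₂, hw⟩ := hk.exists_weight_mul hα hd
  have i₂ : Integrable k₂ := hk₂.integrable hα (by linarith)
  have m₂ := hk₂.memLp hα (by linarith) h0
  have hKm := hk.memLp_fourierInvHat hα hd
  set K := symbolKernel k
  have hK : K =ᵐ[(volume : Measure Plane)] fourierInvHat k := coeFn_symbolKernel hKm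
  set A := eLpNorm (fun p => ((‖p‖ ^ s : ℝ) : ℂ) * k₂ p) 2 volume
  set C : ℝ≥0∞ := 3 * (2 * A + eLpNorm K 1 volume + eLpNorm K 2 wMeasure) with hCdef
  have hC : C ≠ ⊤ := by
    have t1 : A ≠ ⊤ := m₂.2.ne
    have t2 : eLpNorm K 1 volume ≠ ⊤ := (memLp_one_iff_integrable.2 (integrable_L22 K)).2.ne
    have t3 : eLpNorm K 2 wMeasure ≠ ⊤ := (Lp.memLp K).2.ne
    rw [hCdef]
    finiteness
  refine ⟨C.toReal, ENNReal.toReal_nonneg, fun h hz => ?_⟩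
  rw [ENNReal.ofReal_toReal hC]
  set U := eLpNorm (fun x => ((‖x‖ ^ 2 : ℝ) : ℂ) * h x) 2 volume
  set V := eLpNorm (fun x => ((‖x‖ ^ s : ℝ) : ℂ) * h x) 1 volume
  -- the transform of the main term
  have ik : Integrable fun p => k₂ p * hat h p :=
    i₂.mul_bdd (c := (embConst 0).toReal * ‖h‖) (continuous_hat h).aestronglyMeasurable
      (Eventually.of_forall (norm_hat_le h))
  -- Young's inequality for `weight · K` in `L²` would leave `‖h‖₁`, which is invariant under
  -- dilation. The zero of `ĥ` at the origin puts the decaying quantity `V` in its place.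
  have hle : eLpNorm (fun p => k₂ p * hat h p) 2 volume ≤ 2 * V * A := by
    refine eLpNorm_le_mul_eLpNorm_of_ae_le_mul'' 2 m₂.1 (Eventually.of_forall fun p => ?_)
    rw [enorm_mul, enorm_ofReal_mul (by positivity)]
    calc ‖k₂ p‖ₑ * ‖hat h p‖ₑ ≤ ‖k₂ p‖ₑ * (ENNReal.ofReal (‖p‖ ^ s) * (2 * V)) := by
          gcongr
          exact enorm_hat_le_of_hat_zero h0 h1.le hz p
      _ = _ := by ring
  have hV : V ≠ ⊤ := by
    refine ne_top_of_le_ne_top ?_ (eLpNorm_one_rpow_le h s)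
    exact ENNReal.mul_ne_top (embConst_ne_top h0 h1) (Lp.memLp h).2.ne
  have mk : MemLp (fun p => k₂ p * hat h p) 2 volume :=
    ⟨ik.aestronglyMeasurable, hle.trans_lt (by finiteness [m₂.2.ne])⟩
  -- splitting of the convolution
  have hsplit : ∀ x, ((weight x : ℝ) : ℂ) * convFun K h x =
      fourierInvHat (fun p => k₂ p * hat h p) x +
        ∫ t, h t * (((weight x - weight (x - t) : ℝ) : ℂ) * K (x - t)) := by
    intro x
    have hKx : ∀ᵐ t : Plane, K (x - t) = fourierInvHat k (x - t) :=
      (quasiMeasurePreserving_sub_left volume x).ae hK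
    have j1 : Integrable fun t => h t * fourierInvHat k₂ (x - t) :=
      integrable_mul_bounded h
        (((continuous_fourierInvHat i₂).comp (by fun_prop)).aestronglyMeasurable)
        fun t => fourierInvHat_norm_le k₂ (x - t)
    have j2 : Integrable fun t => h t * (((weight x - weight (x - t) : ℝ) : ℂ) * K (x - t)) := by
      refine (((integrable_conv K h x).const_mul ((weight x : ℝ) : ℂ)).sub j1).congr ?_
      filter_upwards [hKx] with t ht
      rw [Pi.sub_apply, ← hw, ht]
      push_cast
      ring
    rw [fourierInvHat_mul_hat i₂, ← integral_add j1 j2, convFun, ← integral_const_mul]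
    refine integral_congr_ae ?_
    filter_upwards [hKx] with t ht
    rw [← hw, ht]
    push_cast
    ring
  have n1 := measurable_enorm_mul_coe h (θ := fun x => ‖x‖ ^ 2) (by fun_prop)
  have n2 := measurable_enorm_mul_coe h (θ := fun x => ‖x‖ ^ s) (by fun_prop)
  have n3 := measurable_enorm_coe K
  have n4 := measurable_enorm_mul_coe K measurable_weight
  have l1 := measurable_lintegral_mul_sub n1 n3
  have l2 := measurable_lintegral_mul_sub n2 n4
  have hpt : ∀ x, ‖((weight x : ℝ) : ℂ) * convFun K h x‖ₑ ≤
      3 * (‖fourierInvHat (fun p => k₂ p * hat h p) x‖ₑ +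
        ((∫⁻ t, ‖((‖t‖ ^ 2 : ℝ) : ℂ) * h t‖ₑ * ‖K (x - t)‖ₑ) +
          ∫⁻ t, ‖((‖t‖ ^ s : ℝ) : ℂ) * h t‖ₑ * ‖((weight (x - t) : ℝ) : ℂ) * K (x - t)‖ₑ)) := by
    intro x
    have q1 : Measurable fun t => ‖((‖t‖ ^ 2 : ℝ) : ℂ) * h t‖ₑ * ‖K (x - t)‖ₑ :=
      n1.mul (n3.comp (measurable_const_sub x))
    have q2 : Measurable fun t => ‖((‖t‖ ^ s : ℝ) : ℂ) * h t‖ₑ *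
        ‖((weight (x - t) : ℝ) : ℂ) * K (x - t)‖ₑ := n2.mul (n4.comp (measurable_const_sub x))
    have hr : ‖∫ t, h t * (((weight x - weight (x - t) : ℝ) : ℂ) * K (x - t))‖ₑ ≤
        3 * ((∫⁻ t, ‖((‖t‖ ^ 2 : ℝ) : ℂ) * h t‖ₑ * ‖K (x - t)‖ₑ) +
          ∫⁻ t, ‖((‖t‖ ^ s : ℝ) : ℂ) * h t‖ₑ * ‖((weight (x - t) : ℝ) : ℂ) * K (x - t)‖ₑ) := by
      refine (enorm_integral_le_lintegral_enorm _).trans ?_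
      have q3 : Measurable fun t => ‖((‖t‖ ^ 2 : ℝ) : ℂ) * h t‖ₑ * ‖K (x - t)‖ₑ +
        ‖((‖t‖ ^ s : ℝ) : ℂ) * h t‖ₑ * ‖((weight (x - t) : ℝ) : ℂ) * K (x - t)‖ₑ := q1.add q2
      rw [← lintegral_add_left q1, ← lintegral_const_mul _ q3]
      refine lintegral_mono fun t => ?_
      rw [enorm_ofReal_mul (by positivity), enorm_ofReal_mul (by positivity),
        enorm_ofReal_mul (weight_pos _).le, enorm_mul, enorm_mul, ← ofReal_norm ((_ : ℝ) : ℂ),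
        Complex.norm_real, Real.norm_eq_abs]
      have hwt := weight_pos (x - t)
      have hb : |weight x - weight (x - t)| ≤ 3 * (‖t‖ ^ 2 + weight (x - t) * ‖t‖ ^ s) := by
        have := abs_weight_sub_le h0 h1.le x t
        have : 0 ≤ weight (x - t) * ‖t‖ ^ s := by positivity
        linarith
      calc _ ≤ ‖h t‖ₑ * (ENNReal.ofReal (3 * (‖t‖ ^ 2 + weight (x - t) * ‖t‖ ^ s)) *
            ‖K (x - t)‖ₑ) := by gcongr
        _ = _ := by
            rw [ENNReal.ofReal_mul (by norm_num), ENNReal.ofReal_add (by positivity)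
              (by positivity), ENNReal.ofReal_mul hwt.le]
            simp only [ENNReal.ofReal_ofNat]
            ring
    rw [hsplit]
    refine (enorm_add_le _ _).trans ?_
    rw [mul_add]
    gcongr
    exact le_mul_of_one_le_left' (by norm_num)
  have hconv : eLpNorm (conv K h) 2 wMeasure = eLpNorm (convFun K h) 2 wMeasure :=
    eLpNorm_congr_ae (ae_volume_iff.2 (coeFn_conv K h))
  have hFm : AEStronglyMeasurable (fun x => ‖fourierInvHat (fun p => k₂ p * hat h p) x‖ₑ)
      volume := (continuous_fourierInvHat ik).enorm.aestronglyMeasurable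
  rw [hconv, eLpNorm_wMeasure]
  refine (eLpNorm_le_mul_eLpNorm_of_ae_le_mul' (c := 3) (g := fun x =>
    ‖fourierInvHat (fun p => k₂ p * hat h p) x‖ₑ +
        ((∫⁻ t, ‖((‖t‖ ^ 2 : ℝ) : ℂ) * h t‖ₑ * ‖K (x - t)‖ₑ) +
          ∫⁻ t, ‖((‖t‖ ^ s : ℝ) : ℂ) * h t‖ₑ * ‖((weight (x - t) : ℝ) : ℂ) * K (x - t)‖ₑ))
    (Eventually.of_forall fun x => ?_) 2).trans ?_
  · rw [enorm_eq_self]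
    exact hpt x
  have b1 : eLpNorm (fun x => ∫⁻ t, ‖((‖t‖ ^ 2 : ℝ) : ℂ) * h t‖ₑ * ‖K (x - t)‖ₑ) 2 volume ≤
      U * eLpNorm K 1 volume := by
    refine (eLpNorm_lintegral_mul_sub_le' n1 n3).trans_eq ?_
    rw [eLpNorm_one_eq_lintegral_enorm, eLpNorm_enorm]
  have b2 : eLpNorm (fun x => ∫⁻ t, ‖((‖t‖ ^ s : ℝ) : ℂ) * h t‖ₑ *
      ‖((weight (x - t) : ℝ) : ℂ) * K (x - t)‖ₑ) 2 volume ≤ V * eLpNorm K 2 wMeasure := by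
    refine (eLpNorm_lintegral_mul_sub_le n2 n4).trans_eq ?_
    rw [← eLpNorm_one_eq_lintegral_enorm, eLpNorm_enorm, eLpNorm_wMeasure]
  have b3 : eLpNorm (fun x => ‖fourierInvHat (fun p => k₂ p * hat h p) x‖ₑ) 2 volume ≤
      2 * V * A := by
    rw [eLpNorm_enorm]
    exact (eLpNorm_fourierInvHat_le ik mk).trans hle
  have b4 := (eLpNorm_add_le hFm (l1.add l2).aestronglyMeasurable one_le_two).trans
    (add_le_add b3 ((eLpNorm_add_le l1.aestronglyMeasurable l2.aestronglyMeasurable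
      one_le_two).trans (add_le_add b1 b2)))
  refine (mul_le_mul_right b4 _).trans ?_
  rw [hCdef]
  calc ((3 : ℝ≥0) : ℝ≥0∞) * (2 * V * A + (U * eLpNorm K 1 volume + V * eLpNorm K 2 wMeasure))
      ≤ 3 * (2 * (U + V) * A + ((U + V) * eLpNorm K 1 volume +
        (U + V) * eLpNorm K 2 wMeasure)) := by
        gcongr
        · simp
        · exact le_add_self
        · exact le_self_add
        · exact le_add_self
    _ = _ := by ring

end ScaledVariables

/-! ### Decay and smoothing of the flow on functions of mean zero. -/

namespace ScaledVariables

open scoped ENNReal NNReal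
open UnboundedOp

variable {α β : ℝ}

/-! ### Decay of the flow on functions of mean zero -/

/-- With `m = min t 1`, one has `1 - e^{-m} ≥ m / (1 + m) ≥ m / 2`. -/
theorem half_min_le_one_sub_exp_neg {t : ℝ} (ht : 0 ≤ t) : min t 1 / 2 ≤ 1 - Real.exp (-t) := by
  have h1 : min t 1 + 1 ≤ Real.exp (min t 1) := Real.add_one_le_exp _
  have h0 : 0 ≤ min t 1 := le_min ht zero_le_one
  have h2 : Real.exp (-t) ≤ Real.exp (-(min t 1)) :=
    Real.exp_le_exp.2 (neg_le_neg (min_le_left _ _))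
  have h3 : Real.exp (-(min t 1)) * Real.exp (min t 1) = 1 := by
    rw [← Real.exp_add, neg_add_cancel, Real.exp_zero]
  have h4 : min t 1 ≤ 1 := min_le_right _ _
  have h5 := Real.exp_pos (-(min t 1))
  nlinarith

/-- Pulling the dilation of the kernel out of the convolution leaves a fixed kernel, so that the
constant of `exists_eLpNorm_conv_le` does not depend on time. -/
theorem kernelFlow_eq_dil (K : L22) {t : ℝ} (ht : 0 < t) (f : L22) :
    kernelFlow α β K t f = ((Real.exp (topRate α β * t) : ℝ) : ℂ) •
      dil ((1 - Real.exp (-t)) ^ (-(1 / α))) (conv K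
        (dil (((1 - Real.exp (-t)) ^ (-(1 / α)))⁻¹ * Real.exp (t / α)) f)) := by
  have ha := one_sub_exp_neg_pos ht
  set b := (1 - Real.exp (-t)) ^ (-(1 / α)) with hb
  have hb0 : 0 < b := by positivity
  refine hat_injective (funext fun p => ?_)
  rw [hat_kernelFlow K ht, hat_smul, hat_dil hb0, hat_conv, hat_dil (by positivity), smul_smul,
    Real.exp_neg (t / α)]
  congr 4
  field_simp

/-- For `t ≥ 1` the outer dilation is harmless and the inner factor `c` is comparable to `e^{t/α}`.
The two norms of `dil c f` scale like `c⁻¹` and `c^{-s}`, hence the gain `e^{-st/α}`. -/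
theorem exists_norm_kernelFlow_le_of_one_le {s : ℝ} {k : Plane → ℂ} (hα : 1 < α)
    (hk : IsSymbol α α k) (h0 : 0 ≤ s) (h1 : s < 1) :
    ∃ M : ℝ, 0 ≤ M ∧ ∀ f : L22, hat f 0 = 0 → ∀ t : ℝ, 1 ≤ t →
      ‖kernelFlow α β (symbolKernel k) t f‖ ≤
        M * Real.exp ((topRate α β - s / α) * t) * ‖f‖ := by
  have hα0 : 0 < α := by linarith
  obtain ⟨C, hC, hCh⟩ := exists_eLpNorm_conv_le hα0 hk hα h0 h1
  set E := (embConst s).toReal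
  -- The largest value allowed for `b` by `1 - e^{-t} ≥ 1/2`.
  set b₁ : ℝ := 2 ^ (1 / α) with hb₁
  have hb₁1 : 1 ≤ b₁ := Real.one_le_rpow one_le_two (by positivity)
  refine ⟨b₁ * C * (b₁ * (1 + E)), by positivity, fun f hf t ht => ?_⟩
  have ht0 : 0 < t := by linarith
  have ha := one_sub_exp_neg_pos ht0
  have ha1 : 1 - Real.exp (-t) ≤ 1 := by linarith [Real.exp_pos (-t)]
  have ha2 : (2 : ℝ)⁻¹ ≤ 1 - Real.exp (-t) := by
    have := half_min_le_one_sub_exp_neg ht0.le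
    rw [min_eq_right ht] at this
    linarith
  rw [kernelFlow_eq_dil _ ht0]
  set b := (1 - Real.exp (-t)) ^ (-(1 / α)) with hb
  have hb0 : 0 < b := by positivity
  have hb1 : 1 ≤ b := Real.one_le_rpow_of_pos_of_le_one_of_nonpos ha ha1 (by simp; positivity)
  have hbb : b ≤ b₁ := by
    have := Real.rpow_le_rpow_of_nonpos (by norm_num : (0 : ℝ) < 2⁻¹) ha2
      (by simp; positivity : -(1 / α) ≤ 0)
    refine this.trans_eq ?_
    rw [Real.inv_rpow zero_le_two, ← Real.rpow_neg zero_le_two, neg_neg]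
  set c := b⁻¹ * Real.exp (t / α) with hc
  have hc0 : 0 < c := by positivity
  set X := Real.exp (-(s / α * t)) with hX
  have hexp : Real.exp (-(t / α)) ≤ X := by
    refine Real.exp_le_exp.2 (neg_le_neg ?_)
    rw [div_mul_eq_mul_div]
    gcongr
    nlinarith
  have hcinv : c⁻¹ ≤ b₁ * X := by
    rw [hc, mul_inv, inv_inv, ← Real.exp_neg]
    gcongr
  have hcs : c ^ (-s) ≤ b₁ * X := by
    have e : c ^ (-s) = b ^ s * X := by
      rw [hc, Real.mul_rpow (by positivity) (by positivity), Real.inv_rpow hb0.le,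
        ← Real.rpow_neg hb0.le, neg_neg, ← Real.exp_mul, hX]
      congr 2
      ring
    rw [e]
    gcongr
    calc b ^ s ≤ b ^ (1 : ℝ) := Real.rpow_le_rpow_of_exponent_le hb1 h1.le
      _ = b := Real.rpow_one b
      _ ≤ b₁ := hbb
  set h := dil c f with hh
  have hz : hat h 0 = 0 := by rw [hh, hat_dil hc0, smul_zero, hf]
  have key := hCh h hz
  rw [hh, eLpNorm_sq_dil hc0, eLpNorm_rpow_one_dil hc0, ← hh, eLpNorm_coe_eq] at key
  have hE : embConst s = ENNReal.ofReal E :=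
    (ENNReal.ofReal_toReal (embConst_ne_top h0 h1)).symm
  have u1 := eLpNorm_sq_le f
  have u2 := eLpNorm_one_rpow_le f s
  rw [eLpNorm_coe_eq] at u1 u2
  have key2 : ‖conv (symbolKernel k) h‖ ≤ C * (b₁ * X * ‖f‖ + b₁ * X * (E * ‖f‖)) := by
    rw [← ENNReal.ofReal_le_ofReal_iff (by positivity)]
    refine key.trans ?_
    rw [ENNReal.ofReal_mul hC, ENNReal.ofReal_add (by positivity) (by positivity),
      ENNReal.ofReal_mul (p := b₁ * X) (q := ‖f‖) (by positivity),
      ENNReal.ofReal_mul (p := b₁ * X) (q := E * ‖f‖) (by positivity),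
      ENNReal.ofReal_mul (p := E) (by positivity), ← hE]
    gcongr
  rw [norm_smul, Complex.norm_real, Real.norm_of_nonneg (Real.exp_pos _).le]
  have hd : ‖dil b (conv (symbolKernel k) h)‖ ≤ b₁ * ‖conv (symbolKernel k) h‖ := by
    refine (norm_dil_apply_le hb0 _).trans ?_
    gcongr
    exact max_le hbb ((inv_le_one_of_one_le₀ hb1).trans hb₁1)
  have e3 : Real.exp ((topRate α β - s / α) * t) = Real.exp (topRate α β * t) * X := by
    rw [hX, ← Real.exp_add]
    ring_nf
  rw [e3]
  calc _ ≤ Real.exp (topRate α β * t) *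
        (b₁ * (C * (b₁ * X * ‖f‖ + b₁ * X * (E * ‖f‖)))) := by
        gcongr
        exact hd.trans (by gcongr)
    _ = _ := by ring

/-- Decay of `kernelFlow` on functions of mean zero. -/
theorem exists_norm_kernelFlow_le {s : ℝ} {k : Plane → ℂ} (hα : 1 < α)
    (hk : IsSymbol α α k) (h0 : 0 ≤ s) (h1 : s < 1) :
    ∃ M : ℝ, 0 ≤ M ∧ ∀ f : L22, hat f 0 = 0 → ∀ t : ℝ, 0 < t →
      ‖kernelFlow α β (symbolKernel k) t f‖ ≤
        M * Real.exp ((topRate α β - s / α) * t) * ‖f‖ := by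
  have hα0 : 0 < α := by linarith
  obtain ⟨M₁, hM₁, hb₁⟩ := exists_norm_kernelFlow_le_of_one_le (β := β) hα hk h0 h1
  obtain ⟨M₂, hM₂, hb₂⟩ := norm_kernelFlow_le (β := β) hα0 (symbolKernel k)
  -- For `t ≤ 1` the general growth bound suffices. Its rate exceeds the desired one by `(1 + s)/α`,
  -- which costs at most `e^{(1+s)/α}`.
  refine ⟨max M₁ (M₂ * Real.exp ((1 + s) / α)), by positivity, fun f hf t ht => ?_⟩
  rcases le_total t 1 with h | h
  · refine ((kernelFlow α β (symbolKernel k) t).le_of_opNorm_le (hb₂ t ht) f).trans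
      (mul_le_mul_of_nonneg_right ?_ (norm_nonneg f))
    calc M₂ * Real.exp ((topRate α β + 1 / α) * t)
        = M₂ * Real.exp ((1 + s) / α * t) * Real.exp ((topRate α β - s / α) * t) := by
          rw [mul_assoc, ← Real.exp_add]
          ring_nf
      _ ≤ M₂ * Real.exp ((1 + s) / α) * Real.exp ((topRate α β - s / α) * t) := by
          gcongr
          exact mul_le_of_le_one_right (by positivity) h
      _ ≤ _ := by
          gcongr
          exact le_max_right _ _
  · refine (hb₁ f hf t h).trans ?_
    gcongr
    exact le_max_left _ _

theorem exists_norm_flow_le_of_hat_zero {s : ℝ} (hα : 1 < α) (h0 : 0 ≤ s) (h1 : s < 1) :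
    ∃ M : ℝ, 0 ≤ M ∧ ∀ f : L22, hat f 0 = 0 → ∀ t : ℝ, 0 ≤ t →
      ‖flow α β t f‖ ≤ M * Real.exp ((topRate α β - s / α) * t) * ‖f‖ := by
  obtain ⟨M, hM, h⟩ := exists_norm_kernelFlow_le (β := β) hα (isSymbol_profileSymbol α) h0 h1
  refine ⟨max M 1, by positivity, fun f hf t ht => ?_⟩
  rcases ht.eq_or_lt with rfl | ht
  · simp only [flow_zero, ContinuousLinearMap.id_apply, mul_zero, Real.exp_zero, mul_one]
    exact le_mul_of_one_le_left (norm_nonneg _) (le_max_right _ _)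
  · rw [flow_of_pos ht]
    refine (h f hf t ht).trans ?_
    gcongr
    exact le_max_left _ _

/-! ### Weak derivatives -/

/-- The derivative `∂_j e^{t𝓛} f`. -/
def gradFlow (α β : ℝ) (j : Fin 2) (t : ℝ) (f : L22) : L22 :=
  (((1 - Real.exp (-t)) ^ (-(1 / α)) : ℝ) : ℂ) •
    kernelFlow α β (symbolKernel (gradSymbol α j)) t f

/-- In the dilated symbol `p_j` appears divided by `b = a(t)^{-1/α}`. The prefactor `b` restores it
and is the whole cost of a derivative. -/
theorem hat_gradFlow (hα : 1 < α) (j : Fin 2) {t : ℝ} (ht : 0 < t) (f : L22) (p : Plane) :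
    hat (gradFlow α β j t f) p = Complex.I * (p j : ℝ) * hat (flow α β t f) p := by
  have hα0 : 0 < α := by linarith
  have ha := one_sub_exp_neg_pos ht
  have hb0 : 0 < (1 - Real.exp (-t)) ^ (-(1 / α)) := by positivity
  rw [gradFlow, hat_smul, flow_of_pos ht, hat_kernelFlow _ ht, hat_kernelFlow _ ht,
    hat_profile hα, (isSymbol_gradSymbol α j).hat_symbolKernel hα0 hα (continuous_gradSymbol hα0 j),
    gradSymbol, PiLp.smul_apply, smul_eq_mul]
  have hbc : (((1 - Real.exp (-t)) ^ (-(1 / α)) : ℝ) : ℂ) ≠ 0 := by exact_mod_cast hb0.ne'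
  push_cast at hbc ⊢
  field_simp

theorem hasDerivAt_fourierHat_line (ψ : 𝓢(Plane, ℂ)) (j : Fin 2) (x : Plane) :
    HasDerivAt (fun t : ℝ => fourierHat ψ (x + t • EuclideanSpace.single j (1 : ℝ)))
      (fourierHat (fun p => -(Complex.I * (p j : ℝ)) * ψ p) x) 0 := by
  have hb : Integrable fun p : Plane => ‖p‖ * ‖ψ p‖ := by
    simpa using ψ.integrable_pow_mul volume 1
  have hin : ∀ (p : Plane) (t : ℝ), (inner ℝ p (x + t • EuclideanSpace.single j (1 : ℝ)) : ℝ) =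
      inner ℝ p x + t * p j := fun p t => by
    rw [inner_add_right, real_inner_smul_right, EuclideanSpace.inner_single_right]
    simp
  have hcont := ψ.continuous
  have h := hasDerivAt_integral_of_dominated_loc_of_deriv_le (μ := (volume : Measure Plane))
    (F := fun (t : ℝ) (p : Plane) =>
      Complex.exp (-(Complex.I * ((inner ℝ p x + t * p j : ℝ) : ℂ))) * ψ p)
    (F' := fun (t : ℝ) (p : Plane) =>
      Complex.exp (-(Complex.I * ((inner ℝ p x + t * p j : ℝ) : ℂ))) *
        (-(Complex.I * (p j : ℝ)) * ψ p)) (x₀ := (0 : ℝ)) (s := Set.univ)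
    (bound := fun p => ‖p‖ * ‖ψ p‖) univ_mem ?_ ?_ ?_ ?_ hb ?_
  · have h2 := h.2
    refine (h2.congr_deriv ?_).congr_of_eventuallyEq (Eventually.of_forall fun t => ?_)
    · simp [fourierHat]
    · simp only [fourierHat, hin]
  · exact Eventually.of_forall fun t => Continuous.aestronglyMeasurable (by fun_prop)
  · refine ψ.integrable.bdd_mul (c := 1) (Continuous.aestronglyMeasurable (by fun_prop))
      (Eventually.of_forall fun p => (norm_exp_neg_I_mul _).le)
  · exact Continuous.aestronglyMeasurable (by fun_prop)
  · refine Eventually.of_forall fun p t _ => ?_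
    rw [norm_mul, norm_exp_neg_I_mul, one_mul, norm_mul, norm_neg, norm_mul, Complex.norm_I,
      one_mul, Complex.norm_real, Real.norm_eq_abs]
    gcongr
    exact abs_coord_le p j
  · refine Eventually.of_forall fun p t _ => ?_
    have h1 : HasDerivAt (fun t : ℝ => inner ℝ p x + t * p j) (p j) t := by
      simpa using ((hasDerivAt_id t).mul_const (p j)).const_add (inner ℝ p x)
    have h2 := ((h1.ofReal_comp.const_mul Complex.I).fun_neg.cexp).mul_const (ψ p)
    refine h2.congr_deriv ?_
    ring

theorem pderiv_fourierHat (ψ φ : 𝓢(Plane, ℂ)) (h : fourierHat ψ = φ) (j : Fin 2) (x : Plane) :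
    pderiv j φ x = fourierHat (fun p => -(Complex.I * (p j : ℝ)) * ψ p) x := by
  have h1 := hasDerivAt_fourierHat_line ψ j x
  rw [h] at h1
  have h2 : HasDerivAt (fun t : ℝ => φ (x + t • EuclideanSpace.single j (1 : ℝ)))
      (fderiv ℝ φ x (EuclideanSpace.single j 1)) 0 := by
    have d : HasDerivAt (fun t : ℝ => x + t • EuclideanSpace.single j (1 : ℝ))
        (EuclideanSpace.single j (1 : ℝ)) 0 := by
      simpa using ((hasDerivAt_id (0 : ℝ)).smul_const
        (EuclideanSpace.single j (1 : ℝ) : Plane)).const_add x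
    refine HasFDerivAt.comp_hasDerivAt (0 : ℝ) (l := φ) ?_ d
    simpa using (φ.differentiable x).hasFDerivAt
  exact h2.unique h1

theorem integral_mul_pderiv {u g : L22} {j : Fin 2}
    (h : ∀ p, hat g p = Complex.I * (p j : ℝ) * hat u p) (φ : 𝓢(Plane, ℂ)) :
    ∫ x, u x * pderiv j φ x = -∫ x, g x * φ x := by
  obtain ⟨ψ, hψ⟩ := exists_schwartz_fourierHat_eq φ
  have hi : Integrable fun p : Plane => -(Complex.I * (p j : ℝ)) * ψ p := by
    have hb : Integrable fun p : Plane => ‖p‖ * ‖ψ p‖ := by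
      simpa using ψ.integrable_pow_mul volume 1
    have := ψ.continuous
    refine hb.mono' (Continuous.aestronglyMeasurable (by fun_prop))
      (Eventually.of_forall fun p => ?_)
    rw [norm_mul, norm_neg, norm_mul, Complex.norm_I, one_mul, Complex.norm_real,
      Real.norm_eq_abs]
    gcongr
    exact abs_coord_le p j
  simp only [pderiv_fourierHat ψ φ hψ]
  rw [← integral_hat_mul u hi, ← hψ, ← integral_hat_mul g ψ.integrable, ← integral_neg]
  congr 1
  ext p
  rw [h]
  ring

theorem isWeakDeriv_of_eq_zero {γ : Fin 2 → ℕ} (hγ : γ 0 + γ 1 = 0) (u : Plane → ℂ) :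
    IsWeakDeriv γ u u := by
  intro φ _ _
  have h0 : γ 0 = 0 := by omega
  have h1 : γ 1 = 0 := by omega
  simp [multiDeriv, h0, h1]

theorem exists_isWeakDeriv_gradFlow (hα : 1 < α) {γ : Fin 2 → ℕ} (hγ : γ 0 + γ 1 = 1) :
    ∃ j, ∀ t : ℝ, 0 < t → ∀ f : L22, IsWeakDeriv γ (flow α β t f) (gradFlow α β j t f) := by
  have hcases : (γ 0 = 1 ∧ γ 1 = 0) ∨ (γ 0 = 0 ∧ γ 1 = 1) := by omega
  rcases hcases with ⟨h0, h1⟩ | ⟨h0, h1⟩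
  · refine ⟨0, fun t ht f φ hφ hc => ?_⟩
    have := integral_mul_pderiv (hat_gradFlow (β := β) hα 0 ht f) (hc.toSchwartzMap hφ)
    have e : (hc.toSchwartzMap hφ : Plane → ℂ) = φ := rfl
    rw [e] at this
    simpa [multiDeriv, h0, h1] using this
  · refine ⟨1, fun t ht f φ hφ hc => ?_⟩
    have := integral_mul_pderiv (hat_gradFlow (β := β) hα 1 ht f) (hc.toSchwartzMap hφ)
    have e : (hc.toSchwartzMap hφ : Plane → ℂ) = φ := rfl
    rw [e] at this
    simpa [multiDeriv, h0, h1] using this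

/-- The smoothing and decay estimate for mean zero data. -/
theorem exists_decay_estimate (hα : 1 < α) {ε : ℝ} (hε : 0 < ε) : ∃ M : ℝ, 0 < M ∧
    ∀ f : L22, ∫ x : Plane, f x = 0 → ∀ γ : Fin 2 → ℕ, γ 0 + γ 1 ≤ 1 → ∀ t : ℝ, 0 < t →
      ∃ g : L22, IsWeakDeriv γ (flow α β t f) g ∧
        ‖g‖ ≤ M * (Real.exp ((1 - (4 - β) / α + ε) * t) /
          (1 - Real.exp (-t)) ^ (((γ 0 + γ 1 : ℕ) : ℝ) / α)) * ‖f‖ := by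
  have hα0 : 0 < α := by linarith
  -- The rate `λ₀ - s/α` equals `1 - (4-β)/α + (1-s)/α`, so `s` must lie within `αε` of `1`.
  obtain ⟨s, h0, h1, hs⟩ : ∃ s : ℝ, 0 ≤ s ∧ s < 1 ∧ 1 - s ≤ α * ε := by
    have : 0 < α * ε := by positivity
    refine ⟨1 - min (α * ε) 1, by simp, by simp [this], by simp⟩
  have hrate : topRate α β - s / α ≤ 1 - (4 - β) / α + ε := by
    have : (1 - s) / α ≤ ε := by
      rw [div_le_iff₀ hα0]
      linarith
    have e : topRate α β - s / α = 1 - (4 - β) / α + (1 - s) / α := by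
      rw [topRate]
      ring
    linarith
  obtain ⟨M, hM, hb⟩ := exists_norm_flow_le_of_hat_zero (β := β) hα h0 h1
  have hg := fun j => exists_norm_kernelFlow_le (β := β) hα (isSymbol_gradSymbol α j) h0 h1
  choose N hN hbN using hg
  have hN0 := hN 0
  have hN1 := hN 1
  have hle : ∀ j, N j ≤ M + N 0 + N 1 + 1 := fun j => by fin_cases j <;> simp <;> linarith
  refine ⟨M + N 0 + N 1 + 1, by positivity, fun f hf γ hγ t ht => ?_⟩
  have ha := one_sub_exp_neg_pos ht
  rw [← hat_zero] at hf
  rcases Nat.le_one_iff_eq_zero_or_eq_one.1 hγ with hγ | hγ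
  · refine ⟨_, isWeakDeriv_of_eq_zero hγ _, (hb f hf t ht.le).trans ?_⟩
    rw [hγ]
    simp only [Nat.cast_zero, zero_div, Real.rpow_zero, div_one]
    gcongr
    linarith
  · obtain ⟨j, hj⟩ := exists_isWeakDeriv_gradFlow (β := β) hα hγ
    refine ⟨_, hj t ht f, ?_⟩
    rw [gradFlow, norm_smul, Complex.norm_real, Real.norm_of_nonneg (by positivity), hγ,
      Nat.cast_one, Real.rpow_neg ha.le]
    calc _ ≤ ((1 - Real.exp (-t)) ^ (1 / α))⁻¹ *
          (N j * Real.exp ((topRate α β - s / α) * t) * ‖f‖) := by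
          gcongr
          exact hbN j f hf t ht
      _ ≤ ((1 - Real.exp (-t)) ^ (1 / α))⁻¹ *
          ((M + N 0 + N 1 + 1) * Real.exp ((1 - (4 - β) / α + ε) * t) * ‖f‖) := by
          gcongr
          exact hle j
      _ = _ := by ring

theorem rpow_one_sub_exp_neg_inv_le {q t : ℝ} (h0 : 0 ≤ q) (h1 : q ≤ 1) (ht : 0 < t) :
    ((1 - Real.exp (-t)) ^ q)⁻¹ ≤ 2 * (min t 1) ^ (-q) := by
  have hm : 0 < min t 1 := lt_min ht one_pos
  rw [← Real.rpow_neg (one_sub_exp_neg_pos ht).le]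
  calc (1 - Real.exp (-t)) ^ (-q) ≤ (min t 1 / 2) ^ (-q) :=
        Real.rpow_le_rpow_of_nonpos (by positivity) (half_min_le_one_sub_exp_neg ht.le)
          (by linarith)
    _ = 2 ^ q * (min t 1) ^ (-q) := by
        rw [Real.div_rpow hm.le zero_le_two, Real.rpow_neg zero_le_two, div_inv_eq_mul, mul_comm]
    _ ≤ 2 ^ (1 : ℝ) * (min t 1) ^ (-q) := by
        gcongr
        exact one_le_two
    _ = _ := by rw [Real.rpow_one]

theorem exists_decay_estimates (hα : 1 < α) {ε : ℝ} (hε : 0 < ε) : ∃ C : ℝ, 0 < C ∧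
    ∀ f : L22, ∫ x : Plane, f x = 0 → ∀ γ : Fin 2 → ℕ, γ 0 + γ 1 ≤ 1 → ∀ t : ℝ, 0 < t →
      ∃ g : L22, IsWeakDeriv γ (flow α β t f) g ∧
        ‖g‖ ≤ C * (Real.exp ((1 - (4 - β) / α + ε) * t) /
          (1 - Real.exp (-t)) ^ (((γ 0 + γ 1 : ℕ) : ℝ) / α)) * ‖f‖ ∧
        ‖g‖ ≤ C * ‖f‖ * (if t ≤ 1 then t ^ (-(((γ 0 + γ 1 : ℕ) : ℝ) / α))
          else Real.exp ((1 - (4 - β) / α + ε) * t)) := by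
  have hα0 : 0 < α := by linarith
  obtain ⟨M, hM, h⟩ := exists_decay_estimate (β := β) hα hε
  set r := 1 - (4 - β) / α + ε
  set L := Real.exp |r| with hL
  have hL1 : 1 ≤ L := Real.one_le_exp (abs_nonneg r)
  -- The factor `2` comes from `a(t)^{-q} ≤ 2 min(t, 1)^{-q}`, and `L = e^{|r|}` bounds the
  -- exponential for `t ≤ 1`. One constant then serves both estimates.
  refine ⟨2 * L * M, by positivity, fun f hf γ hγ t ht => ?_⟩
  obtain ⟨g, hg, hgb⟩ := h f hf γ hγ t ht
  have ha := one_sub_exp_neg_pos ht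
  have hq0 : 0 ≤ ((γ 0 + γ 1 : ℕ) : ℝ) / α := by positivity
  have hq1 : ((γ 0 + γ 1 : ℕ) : ℝ) / α ≤ 1 := by
    rw [div_le_one hα0]
    have : ((γ 0 + γ 1 : ℕ) : ℝ) ≤ 1 := by exact_mod_cast hγ
    linarith
  set q := ((γ 0 + γ 1 : ℕ) : ℝ) / α
  refine ⟨g, hg, hgb.trans ?_, hgb.trans ?_⟩
  · gcongr
    nlinarith
  · have hq := rpow_one_sub_exp_neg_inv_le hq0 hq1 ht
    rw [div_eq_mul_inv]
    split_ifs with ht1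
    · rw [min_eq_left ht1] at hq
      have hr : Real.exp (r * t) ≤ L := by
        refine Real.exp_le_exp.2 ?_
        calc r * t ≤ |r| * t := by gcongr; exact le_abs_self r
          _ ≤ |r| := mul_le_of_le_one_right (abs_nonneg r) ht1
      calc _ ≤ M * (L * (2 * t ^ (-q))) * ‖f‖ := by gcongr
        _ = _ := by ring
    · rw [min_eq_right (le_of_not_ge ht1), Real.one_rpow, mul_one] at hq
      calc _ ≤ M * (Real.exp (r * t) * 2) * ‖f‖ := by gcongr
        _ = 2 * 1 * M * ‖f‖ * Real.exp (r * t) := by ring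
        _ ≤ _ := by gcongr

end ScaledVariables

/-! ### Resolvents of generators which split off an eigenvector. -/

namespace UnboundedOp

variable {X : Type*} [NormedAddCommGroup X] [NormedSpace ℂ X] {S : ℝ → X →L[ℂ] X}
  {A : X →ₗ.[ℂ] X}

theorem InGenerator.add {x y x' y' : X} (h : InGenerator S x y) (h' : InGenerator S x' y') :
    InGenerator S (x + x') (y + y') := by
  refine (Tendsto.add h h').congr fun t => ?_
  rw [← smul_add, map_add]
  congr 1
  abel

theorem InGenerator.smul {x y : X} (c : ℂ) (h : InGenerator S x y) :
    InGenerator S (c • x) (c • y) := by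
  refine (Tendsto.const_smul h c).congr fun t => ?_
  rw [map_smul, ← smul_sub, smul_comm]

theorem InGenerator.of_eigenvector {x : X} {z : ℂ}
    (h : ∀ t : ℝ, 0 < t → S t x = Complex.exp (z * t) • x) : InGenerator S x (z • x) := by
  refine inGenerator_of_hasDerivWithinAt (U := fun t : ℝ => Complex.exp (z * t) • x) h
    (by simp) ?_
  have := (((hasDerivAt_id (0 : ℝ)).ofReal_comp.const_mul z).cexp.smul_const x).hasDerivWithinAt
    (s := Set.Ici 0)
  simpa using this

theorem GeneratesC0.isResolventAt_iff (hA : GeneratesC0 A S) {z : ℂ} {R : X →L[ℂ] X} :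
    IsResolventAt A z R ↔ ∀ x y, R y = x ↔ InGenerator S x (z • x - y) := by
  have key : ∀ x y, (∃ h : x ∈ A.domain, z • x - A ⟨x, h⟩ = y) ↔
      InGenerator S x (z • x - y) := fun x y => by
    refine Iff.trans ?_ (hA.generator x (z • x - y))
    refine exists_congr fun h => ?_
    rw [sub_eq_iff_eq_add, eq_sub_iff_add_eq, eq_comm, add_comm]
  simp only [IsResolventAt, key]

theorem IsResolventAt.unique {z : ℂ} {R R' : X →L[ℂ] X} (h : IsResolventAt A z R)
    (h' : IsResolventAt A z R') : R = R' := by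
  ext y
  exact (h _ y).2 ((h' _ y).1 rfl)

theorem IsResolventAt.resolvent_eq {z : ℂ} {R : X →L[ℂ] X} (h : IsResolventAt A z R) :
    resolvent A z = R := by
  have hz : z ∈ resolventSet A := ⟨R, h⟩
  rw [resolvent, dif_pos hz]
  exact (Classical.choose_spec hz).unique h

/-- The distance from an eigenvalue to a point of the resolvent set. -/
theorem GeneratesC0.one_le_norm_of_eigenvector (hA : GeneratesC0 A S) {z w : ℂ} {R : X →L[ℂ] X}
    (hR : IsResolventAt A z R) {x : X} (hx : x ≠ 0) (hw : InGenerator S x (w • x)) :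
    1 ≤ ‖R‖ * ‖z - w‖ := by
  have h1 : R ((z - w) • x) = x := by
    refine ((hA.isResolventAt_iff.1 hR) x _).2 ?_
    rwa [sub_smul, sub_sub_cancel]
  have h2 : ‖x‖ ≤ ‖R‖ * ‖z - w‖ * ‖x‖ := by
    conv_lhs => rw [← h1]
    refine (R.le_opNorm _).trans_eq ?_
    rw [norm_smul, mul_assoc]
  exact le_of_mul_le_mul_right (by rwa [one_mul]) (norm_pos_iff.2 hx)

/-- The resolvent of a generator which splits off a one-dimensional eigenspace. -/
theorem GeneratesC0.isResolventAt_of_laplace {M κ N ν : ℝ} {P Q R₀ : X →L[ℂ] X} {l : X →L[ℂ] ℂ}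
    {e : X} {z z₀ : ℂ} [CompleteSpace X] (hA : GeneratesC0 A S) (hS : IsC0Semigroup S M κ)
    (hP : ∀ x, P x = l x • e) (hPQ : ∀ x, P x + Q x = x)
    (hl : ∀ x y, InGenerator S x y → l y = z₀ * l x) (he : InGenerator S e (z₀ • e))
    (hb : ∀ t : ℝ, 0 ≤ t → ‖(S t).comp Q‖ ≤ N * Real.exp (ν * t)) (hz : ν < z.re)
    (hQ : ∀ t : ℝ, 0 ≤ t → ∀ x, S t (Q x) = Q (S t x))
    (hR : ∀ x, R₀ x = ∫ t in Set.Ioi (0 : ℝ), Complex.exp (-(z * t)) • S t (Q x))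
    (hzz : z ≠ z₀) : IsResolventAt A z ((z - z₀)⁻¹ • P + R₀) := by
  have hne : z - z₀ ≠ 0 := sub_ne_zero.2 hzz
  refine hA.isResolventAt_iff.2 fun x y => ⟨?_, fun h => ?_⟩
  · rintro rfl
    have h1 := (he.smul ((z - z₀)⁻¹ * l y)).add (hS.inGenerator_laplace hb hz hR y)
    simp only [_root_.add_apply, _root_.smul_apply, hP]
    convert h1 using 1
    · rw [smul_smul]
    · have h2 : Q y = y - l y • e := by
        rw [← hP]
        exact eq_sub_of_add_eq' (hPQ y)
      rw [h2]
      have h3 : z * ((z - z₀)⁻¹ * l y) = (z - z₀)⁻¹ * l y * z₀ + l y := by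
        field_simp
        ring
      simp only [smul_add, smul_smul, h3, add_smul]
      abel
  · have h1 := hS.laplace_apply_generator hb hz hQ hR h
    have h2 := hl _ _ h
    simp only [_root_.add_apply, _root_.smul_apply, hP]
    rw [map_sub, map_smul] at h1 h2
    have h3 : l y = (z - z₀) * l x := by
      rw [smul_eq_mul] at h2
      linear_combination -h2
    have h4 : R₀ y = Q x := by
      rw [← sub_right_inj, h1]
    rw [h4, h3, smul_smul, ← mul_assoc, inv_mul_cancel₀ hne, one_mul, ← hP, hPQ]

end UnboundedOp

/-! ### Spectrum, essential spectrum and Riesz projection of `𝓛`. -/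

namespace ScaledVariables

open scoped ENNReal NNReal
open UnboundedOp

variable {α β : ℝ}

/-! ### The generator -/

theorem scaledL_graph_iff {f g : L22} :
    (∃ h : f ∈ (scaledL α β).domain, scaledL α β ⟨f, h⟩ = g) ↔ IsScaledL α β f g := by
  constructor
  · rintro ⟨h, rfl⟩
    exact Classical.choose_spec h
  · intro h
    have hd : f ∈ (scaledL α β).domain := ⟨g, h⟩
    exact ⟨hd, (Classical.choose_spec hd).unique h⟩

theorem generatesC0_flow (hα : 1 < α) : GeneratesC0 (scaledL α β) (flow α β) where
  map_zero := flow_zero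
  map_add _ _ hs ht := flow_add hα hs ht
  continuous_at_zero f := tendsto_flow hα f
  generator _ _ := scaledL_graph_iff.trans (isScaledL_iff_inGenerator hα)

/-! ### The eigenvalue `λ₀` and its spectral projection -/

theorem hat_profile_zero (hα : 1 < α) : hat (profile α) 0 = 1 := by
  rw [hat_profile hα, profileSymbol, norm_zero, Real.zero_rpow (by linarith)]
  simp

theorem profile_ne_zero (hα : 1 < α) : profile α ≠ 0 := by
  intro h
  have h1 := hat_profile_zero hα
  rw [h, ← hatAt_apply, map_zero] at h1
  exact zero_ne_one h1

/-- The projection `f ↦ (∫ f) G`. -/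
def meanProj (α : ℝ) : L22 →L[ℂ] L22 := (hatAt 0).smulRight (profile α)

theorem meanProj_apply (f : L22) : meanProj α f = hat f 0 • profile α := by
  rw [meanProj, ContinuousLinearMap.smulRight_apply, hatAt_apply]

/-- The projection onto functions of mean zero. -/
def meanZeroProj (α : ℝ) : L22 →L[ℂ] L22 := ContinuousLinearMap.id ℂ L22 - meanProj α

theorem meanZeroProj_apply (f : L22) : meanZeroProj α f = f - hat f 0 • profile α := by
  rw [← meanProj_apply]
  rfl

theorem hat_meanZeroProj_zero (hα : 1 < α) (f : L22) : hat (meanZeroProj α f) 0 = 0 := by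
  rw [meanZeroProj_apply, hat_sub, hat_smul, hat_profile_zero hα, mul_one, sub_self]

theorem hat_flow_zero (hα : 1 < α) {t : ℝ} (ht : 0 ≤ t) (f : L22) :
    hat (flow α β t f) 0 = Complex.exp (topRate α β * t) * hat f 0 := by
  rw [hat_flow hα ht, norm_zero, Real.zero_rpow (by linarith), smul_zero]
  simp

theorem flow_profile (hα : 1 < α) {t : ℝ} (ht : 0 ≤ t) :
    flow α β t (profile α) = Complex.exp (topRate α β * t) • profile α := by
  refine hat_injective (funext fun p => ?_)
  rw [hat_flow hα ht, hat_smul, hat_profile hα, profileSymbol, profileSymbol,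
    norm_exp_neg_smul_rpow (by linarith), ← Complex.ofReal_mul (Real.exp _) (Real.exp _),
    ← Real.exp_add]
  have : -((1 - Real.exp (-t)) * ‖p‖ ^ α) + -(Real.exp (-t) * ‖p‖ ^ α) = -(‖p‖ ^ α) := by ring
  rw [this]
  push_cast
  rfl

theorem flow_meanZeroProj (hα : 1 < α) {t : ℝ} (ht : 0 ≤ t) (f : L22) :
    flow α β t (meanZeroProj α f) = meanZeroProj α (flow α β t f) := by
  rw [meanZeroProj_apply, meanZeroProj_apply, map_sub, map_smul, flow_profile hα ht,
    hat_flow_zero hα ht, smul_smul, mul_comm]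

theorem meanZeroProj_meanZeroProj (hα : 1 < α) (f : L22) :
    meanZeroProj α (meanZeroProj α f) = meanZeroProj α f := by
  rw [meanZeroProj_apply (meanZeroProj α f), hat_meanZeroProj_zero hα, zero_smul, sub_zero]

theorem inGenerator_profile (hα : 1 < α) :
    InGenerator (flow α β) (profile α) ((topRate α β : ℂ) • profile α) :=
  InGenerator.of_eigenvector fun _ ht => flow_profile hα ht.le

/-- The flow multiplies the mean by `e^{λ₀t}`, so the mean is an eigenvector of the dual operator.
This makes the projection onto `G` commute with the generator. -/
theorem hat_zero_of_inGenerator (hα : 1 < α) {f g : L22} (h : InGenerator (flow α β) f g) :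
    hatAt 0 g = topRate α β * hatAt 0 f := by
  have h1 := ((hatAt 0).continuous.tendsto g).comp h
  have hd : HasDerivAt (fun t : ℝ => Complex.exp (topRate α β * t) * hat f 0)
      (topRate α β * hat f 0) 0 := by
    have := (((hasDerivAt_id (0 : ℝ)).ofReal_comp.const_mul (topRate α β : ℂ)).cexp.mul_const
      (hat f 0))
    simpa using this
  have h2 := (hasDerivWithinAt_iff_tendsto_slope' (s := Set.Ioi (0 : ℝ)) (by simp)).1
    (hd.hasDerivWithinAt (s := Set.Ioi 0))
  rw [hatAt_apply 0 f]
  refine tendsto_nhds_unique h1 (h2.congr' ?_)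
  filter_upwards [self_mem_nhdsWithin] with t ht
  rw [Function.comp_apply, map_smul, map_sub, hatAt_apply, hatAt_apply,
    hat_flow_zero hα (le_of_lt ht), slope_def_module, sub_zero, ← Complex.coe_smul]
  simp

theorem exists_norm_flow_comp_meanZeroProj_le {s : ℝ} (hα : 1 < α) (h0 : 0 ≤ s) (h1 : s < 1) :
    ∃ N : ℝ, ∀ t : ℝ, 0 ≤ t →
      ‖(flow α β t).comp (meanZeroProj α)‖ ≤ N * Real.exp ((topRate α β - s / α) * t) := by
  obtain ⟨M, hM, h⟩ := exists_norm_flow_le_of_hat_zero (β := β) hα h0 h1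
  refine ⟨M * ‖meanZeroProj α‖, fun t ht => ?_⟩
  refine ContinuousLinearMap.opNorm_le_bound _ (by positivity) fun f => ?_
  rw [ContinuousLinearMap.comp_apply]
  refine (h _ (hat_meanZeroProj_zero hα f) t ht).trans ?_
  calc _ ≤ M * Real.exp ((topRate α β - s / α) * t) * (‖meanZeroProj α‖ * ‖f‖) := by
        gcongr
        exact (meanZeroProj α).le_opNorm f
    _ = _ := by ring

/-- The reduced resolvent in a half-plane `Re z > λ₀ - s/α`. -/
theorem exists_reduced_resolvent {s : ℝ} (hα : 1 < α) (h0 : 0 ≤ s) (h1 : s < 1) :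
    ∃ R₀ : ℂ → L22 →L[ℂ] L22,
      DifferentiableOn ℂ R₀ {z | topRate α β - s / α < z.re} ∧
      (∀ z : ℂ, topRate α β - s / α < z.re → z ≠ topRate α β →
        IsResolventAt (scaledL α β) z ((z - topRate α β)⁻¹ • meanProj α + R₀ z)) ∧
      ∀ z : ℂ, topRate α β - s / α < z.re → ∀ f g, InGenerator (flow α β) f g →
        R₀ z g = z • R₀ z f - meanZeroProj α f := by
  obtain ⟨M, hS⟩ := exists_isC0Semigroup_flow (β := β) hα
  obtain ⟨N, hN⟩ := exists_norm_flow_comp_meanZeroProj_le (β := β) hα h0 h1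
  set ν := topRate α β - s / α
  have hex := fun (z : ℂ) (hz : ν < z.re) => hS.exists_laplace hN hz
  choose R hR hRn using hex
  classical
  let R₀ : ℂ → L22 →L[ℂ] L22 := fun z => if hz : ν < z.re then R z hz else 0
  have hR₀ : ∀ z (hz : ν < z.re), R₀ z = R z hz := fun z hz => dif_pos hz
  have hQ : ∀ t : ℝ, 0 ≤ t → ∀ f, flow α β t (meanZeroProj α f) = meanZeroProj α (flow α β t f) :=
    fun t ht f => flow_meanZeroProj hα ht f
  have hopen : IsOpen {z : ℂ | ν < z.re} := isOpen_lt continuous_const Complex.continuous_re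
  refine ⟨R₀, ?_, fun z hz hne => ?_, fun z hz f g h => ?_⟩
  · refine differentiableOn_of_resolvent_identity hopen (fun z hz w hw => ?_) fun w hw => ?_
    · rw [hR₀ z hz, hR₀ w hw]
      exact hS.laplace_sub_laplace hN hQ (meanZeroProj_meanZeroProj hα) hz (hR z hz) hw (hR w hw)
    · have hw' : ν < w.re := hw
      have hN0 : 0 ≤ N := by simpa using (norm_nonneg _).trans (hN 0 le_rfl)
      -- Local boundedness: near `w` the real part stays to the right of the midpoint between `ν`
      -- and `Re w`.
      refine ⟨N / ((w.re + ν) / 2 - ν), ?_⟩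
      have ho : IsOpen {z : ℂ | (w.re + ν) / 2 < z.re} :=
        isOpen_lt continuous_const Complex.continuous_re
      filter_upwards [ho.mem_nhds (show (w.re + ν) / 2 < w.re by linarith)] with z hz
      have hz' : (w.re + ν) / 2 < z.re := hz
      have hz2 : ν < z.re := by linarith
      rw [hR₀ z hz2]
      refine (hRn z hz2).trans ?_
      have : 0 < (w.re + ν) / 2 - ν := by linarith
      gcongr
  · rw [hR₀ z hz]
    exact (generatesC0_flow hα).isResolventAt_of_laplace hS (l := hatAt 0) (e := profile α)
      (fun f => by rw [meanProj_apply, hatAt_apply])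
      (fun f => by rw [meanProj_apply, meanZeroProj_apply, add_sub_cancel])
      (fun f g h => hat_zero_of_inGenerator hα h) (inGenerator_profile hα) hN hz hQ (hR z hz) hne
  · rw [hR₀ z hz]
    exact hS.laplace_apply_generator hN hz hQ (hR z hz) h

/-- The reduced resolvent exists at `λ₀` itself. Applied to `𝓛 f = λ₀ f`, it shows that the mean
zero part of `f` vanishes, that is, `f = (∫ f) G`. The choice `s = 1/2` is arbitrary in `(0, 1)`. -/
theorem inGenerator_topRate_iff (hα : 1 < α) (f : L22) :
    InGenerator (flow α β) f ((topRate α β : ℂ) • f) ↔ ∃ c : ℂ, f = c • profile α := by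
  constructor
  · intro h
    obtain ⟨R₀, -, -, hR⟩ := exists_reduced_resolvent (β := β) (s := 1 / 2) hα (by norm_num)
      (by norm_num)
    have hz : topRate α β - 1 / 2 / α < ((topRate α β : ℝ) : ℂ).re := by
      rw [Complex.ofReal_re]
      have : 0 < 1 / 2 / α := by positivity
      linarith
    have h1 := hR _ hz _ _ h
    rw [map_smul, eq_comm, sub_eq_self, meanZeroProj_apply, sub_eq_zero] at h1
    exact ⟨_, h1⟩
  · rintro ⟨c, rfl⟩
    have := (inGenerator_profile (β := β) hα).smul c
    rwa [smul_comm] at this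

/-- The half-planes `Re z > λ₀ - s/α` with `s < 1` exhaust the open half-plane `Re z > λ₀ - 1/α`. -/
theorem exists_between_one {α x y : ℝ} (hα : 0 < α) (h : x - 1 / α < y) :
    ∃ s : ℝ, 0 ≤ s ∧ s < 1 ∧ x - s / α < y := by
  have h1 : (x - y) * α < 1 := by
    have : x - y < 1 / α := by linarith
    rwa [lt_div_iff₀ hα] at this
  obtain ⟨s, hs1, hs2⟩ := exists_between (max_lt h1 one_pos)
  refine ⟨s, (le_max_right _ _).trans hs1.le, hs2, ?_⟩
  have h2 : x - y < s / α := (lt_div_iff₀ hα).2 ((le_max_left _ _).trans_lt hs1)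
  linarith

/-! ### The half-plane of eigenvalues -/

/-- The function `u = |p|^w e^{-|p|^α}` satisfies `p·∇u = (w - α|p|^α) u`, so on the Fourier side `𝓛
u = (λ₀ - w/α) u`. This determines `w = α(λ₀ - z)`, and `Re w > 1` is the condition for the inverse
transform to lie in `L²(2)`. -/
theorem exists_eigenvector (hα : 1 < α) {z : ℂ} (hz : z.re < topRate α β - 1 / α) :
    ∃ e : L22, e ≠ 0 ∧ InGenerator (flow α β) e (z • e) := by
  have hα0 : 0 < α := by linarith
  set w : ℂ := α * (topRate α β - z) with hw
  have hwre : 1 < w.re := by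
    have e : w.re = α * (topRate α β - z.re) := by simp [hw]
    rw [e]
    have h1 : 1 / α < topRate α β - z.re := by linarith
    rwa [div_lt_iff₀ hα0, mul_comm] at h1
  have hk : IsSymbol α w.re (basicSymbol α 0 0 w) := .basic 0 0 w (by simp)
  have hb : ∀ p, basicSymbol α 0 0 w p = ((‖p‖ : ℝ) : ℂ) ^ w * profileSymbol α p := fun p => by
    simp [basicSymbol, profileSymbol]
  have hc : Continuous (basicSymbol α 0 0 w) := by
    rw [funext hb]
    exact ((Complex.continuous_ofReal_cpow_const (by linarith)).comp continuous_norm).mul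
      (continuous_profileSymbol hα0)
  have hhat := hk.hat_symbolKernel hα0 hwre hc
  refine ⟨symbolKernel (basicSymbol α 0 0 w), fun h0 => ?_,
    InGenerator.of_eigenvector fun t ht => ?_⟩
  · have h1 := congrFun hhat (EuclideanSpace.single 0 1)
    rw [h0, ← hatAt_apply, map_zero, hb, profileSymbol, PiLp.norm_single] at h1
    simp only [norm_one, Complex.ofReal_one, Complex.one_cpow, one_mul, Real.one_rpow] at h1
    exact Real.exp_ne_zero _ (by exact_mod_cast h1.symm)
  · refine hat_injective (funext fun p => ?_)
    rw [hat_flow hα ht.le, hat_smul, hhat, hb, hb, profileSymbol, profileSymbol,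
      norm_exp_neg_smul_rpow hα0, norm_smul, Real.norm_of_nonneg (Real.exp_pos _).le]
    have e1 : ((Real.exp (-(t / α)) * ‖p‖ : ℝ) : ℂ) ^ w =
        Complex.exp ((z - topRate α β) * t) * ((‖p‖ : ℝ) : ℂ) ^ w := by
      rw [Complex.ofReal_mul, Complex.mul_cpow_ofReal_nonneg (Real.exp_pos _).le (norm_nonneg _),
        Complex.cpow_def_of_ne_zero (by exact_mod_cast Real.exp_ne_zero _), ← Complex.ofReal_log
        (Real.exp_pos _).le, Real.log_exp, hw]
      congr 2
      have : (α : ℂ) ≠ 0 := by exact_mod_cast hα0.ne'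
      push_cast
      field_simp
      ring
    have e2 : ((Real.exp (topRate α β * t) : ℝ) : ℂ) * Complex.exp ((z - topRate α β) * t) =
        Complex.exp (z * t) := by
      push_cast
      rw [← Complex.exp_add]
      ring_nf
    have e3 : ((Real.exp (-((1 - Real.exp (-t)) * ‖p‖ ^ α)) : ℝ) : ℂ) *
        ((Real.exp (-(Real.exp (-t) * ‖p‖ ^ α)) : ℝ) : ℂ) =
        ((Real.exp (-(‖p‖ ^ α)) : ℝ) : ℂ) := by
      rw [← Complex.ofReal_mul, ← Real.exp_add]
      congr 2
      ring
    rw [e1, ← e2, ← e3]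
    ring

/-! ### The spectrum -/

/-- The boundary line is reached because the spectrum is closed. If `R` were the resolvent at `z`,
the eigenvalue at distance `(‖R‖ + 1)⁻¹` to the left of `z` would be closer than
`one_le_norm_of_eigenvector` permits. -/
theorem mem_spectrum_of_re_le (hα : 1 < α) {z : ℂ} (hz : z.re ≤ topRate α β - 1 / α) :
    z ∈ spectrum (scaledL α β) := by
  rintro ⟨R, hR⟩
  have hδ : 0 < (‖R‖ + 1)⁻¹ := by positivity
  obtain ⟨e, he, hge⟩ := exists_eigenvector (β := β) hα (z := z - (((‖R‖ + 1)⁻¹ : ℝ) : ℂ)) (by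
    rw [Complex.sub_re, Complex.ofReal_re]
    linarith)
  have := (generatesC0_flow hα).one_le_norm_of_eigenvector hR he hge
  rw [sub_sub_cancel, Complex.norm_real, Real.norm_of_nonneg hδ.le, ← div_eq_mul_inv,
    le_div_iff₀ (by positivity)] at this
  linarith

theorem topRate_mem_spectrum (hα : 1 < α) : (topRate α β : ℂ) ∈ spectrum (scaledL α β) := by
  rintro ⟨R, hR⟩
  have := (generatesC0_flow hα).one_le_norm_of_eigenvector hR (profile_ne_zero hα)
    (inGenerator_profile hα)
  rw [sub_self, norm_zero, mul_zero] at this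
  linarith

theorem spectrum_scaledL (hα : 1 < α) :
    spectrum (scaledL α β) = {(topRate α β : ℂ)} ∪ {z : ℂ | z.re ≤ topRate α β - 1 / α} := by
  refine Set.Subset.antisymm (fun z hz => ?_) ?_
  · by_contra hc
    rw [Set.mem_union, Set.mem_singleton_iff, Set.mem_ofPred_eq, not_or, not_le] at hc
    obtain ⟨s, h0, h1, hs⟩ := exists_between_one (by linarith) hc.2
    obtain ⟨R₀, -, hR, -⟩ := exists_reduced_resolvent (β := β) hα h0 h1
    exact hz ⟨_, hR z hs hc.1⟩
  · rintro z (rfl | hz)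
    · exact topRate_mem_spectrum hα
    · exact mem_spectrum_of_re_le hα hz

/-- On the circle the resolvent is `(z - λ₀)⁻¹ P` plus the reduced resolvent, with `s < 1` chosen so
that the closed disc lies in the half-plane of holomorphy. The second term integrates to zero by
Cauchy's theorem. -/
theorem rieszProjection_scaledL (hα : 1 < α) {r : ℝ} (hr : 0 < r) (hrα : r < 1 / α) :
    rieszProjection (scaledL α β) (topRate α β) r = meanProj α := by
  obtain ⟨s, h0, h1, hs⟩ := exists_between_one (x := topRate α β) (y := topRate α β - r)
    (by linarith : 0 < α) (by linarith)
  obtain ⟨R₀, hd, hR, -⟩ := exists_reduced_resolvent (β := β) hα h0 h1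
  have hball : ∀ z ∈ Metric.closedBall ((topRate α β : ℝ) : ℂ) r,
      topRate α β - s / α < z.re := fun z hz => by
    rw [Metric.mem_closedBall, dist_eq_norm] at hz
    have h1 := (abs_le.1 ((Complex.abs_re_le_norm _).trans hz)).1
    rw [Complex.sub_re, Complex.ofReal_re] at h1
    linarith
  have hdc : ContinuousOn R₀ (Metric.closedBall ((topRate α β : ℝ) : ℂ) r) :=
    hd.continuousOn.mono hball
  have hopen : IsOpen {z : ℂ | topRate α β - s / α < z.re} :=
    isOpen_lt continuous_const Complex.continuous_re
  have hzero : (∮ z in C((topRate α β : ℂ), r), R₀ z) = 0 :=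
    Complex.circleIntegral_eq_zero_of_differentiable_on_off_countable hr.le Set.countable_empty
      hdc fun z hz => hd.differentiableAt (hopen.mem_nhds
        (hball z (Metric.ball_subset_closedBall hz.1)))
  have hcongr : (∮ z in C((topRate α β : ℂ), r), resolvent (scaledL α β) z) =
      ∮ z in C((topRate α β : ℂ), r), ((z - topRate α β)⁻¹ • meanProj α + R₀ z) := by
    refine circleIntegral.integral_congr hr.le fun z hz => ?_
    refine (hR z (hball z (Metric.sphere_subset_closedBall hz)) ?_).resolvent_eq
    exact Metric.ne_of_mem_sphere hz hr.ne'
  have hci : CircleIntegrable (fun z => (z - (topRate α β : ℂ))⁻¹ • meanProj α)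
      (topRate α β : ℂ) r := by
    refine ContinuousOn.circleIntegrable hr.le fun z hz => ?_
    have : z - (topRate α β : ℂ) ≠ 0 := sub_ne_zero.2 (Metric.ne_of_mem_sphere hz hr.ne')
    have hsub : ContinuousAt (fun z => z - (topRate α β : ℂ)) z := by fun_prop
    exact ((hsub.inv₀ this).smul continuousAt_const).continuousWithinAt
  have hci' : CircleIntegrable R₀ (topRate α β : ℂ) r :=
    ContinuousOn.circleIntegrable hr.le (hdc.mono Metric.sphere_subset_closedBall)
  rw [rieszProjection, hcongr, circleIntegral.integral_add hci hci', hzero, add_zero,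
    circleIntegral.integral_smul_const, circleIntegral.integral_sub_center_inv _ hr.ne', smul_smul,
    inv_mul_cancel₀ Complex.two_pi_I_ne_zero, one_smul]

theorem essentialSpectrum_scaledL (hα : 1 < α) :
    essentialSpectrum (scaledL α β) = {z : ℂ | z.re ≤ topRate α β - 1 / α} := by
  have hα1 : 0 < 1 / α := by positivity
  ext z
  rw [essentialSpectrum, spectrum_scaledL hα, Set.mem_sdiff, Set.mem_union, Set.mem_singleton_iff,
    Set.mem_ofPred_eq]
  constructor
  · rintro ⟨rfl | hz, hd⟩
    -- Half the gap `1/α` between `λ₀` and the half-plane isolates `λ₀`, and the Riesz projection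
    -- has rank one.
    · refine absurd ⟨1 / (2 * α), by positivity, ?_, ?_⟩ hd
      · refine Set.Subset.antisymm (fun w hw => ?_) ?_
        · rw [spectrum_scaledL hα] at hw
          obtain ⟨hw1, rfl | hw2⟩ := hw
          · rfl
          · rw [Metric.mem_closedBall, dist_eq_norm] at hw1
            have h1 := (abs_le.1 ((Complex.abs_re_le_norm _).trans hw1)).1
            rw [Complex.sub_re, Complex.ofReal_re] at h1
            have h2 : w.re ≤ topRate α β - 1 / α := hw2
            have h3 : 1 / (2 * α) = 1 / α / 2 := by rw [mul_comm, div_mul_eq_div_div]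
            linarith
        · rintro _ rfl
          exact ⟨Metric.mem_closedBall_self (by positivity), topRate_mem_spectrum hα⟩
      · have hlt : 1 / (2 * α) < 1 / α := by
          gcongr
          linarith
        rw [rieszProjection_scaledL hα (by positivity) hlt]
        have hle : (meanProj α).range ≤ Submodule.span ℂ {profile α} := by
          rintro _ ⟨f, rfl⟩
          change meanProj α f ∈ _
          rw [meanProj_apply]
          exact Submodule.smul_mem _ _ (Submodule.mem_span_singleton_self _)
        exact Submodule.finiteDimensional_of_le hle
    · exact hz
  · intro hz
    refine ⟨Or.inr hz, ?_⟩
    rintro ⟨r, hr, hs, -⟩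
    -- Points of the half-plane are not isolated, since moving to the left stays in the spectrum.
    have hm : z - (r : ℂ) ∈ Metric.closedBall z r ∩ spectrum (scaledL α β) := by
      refine ⟨?_, mem_spectrum_of_re_le hα ?_⟩
      · rw [Metric.mem_closedBall, dist_eq_norm]
        simp [abs_of_pos hr]
      · rw [Complex.sub_re, Complex.ofReal_re]
        linarith
    rw [hs, Set.mem_singleton_iff, sub_eq_self] at hm
    exact hr.ne' (by exact_mod_cast hm)

end ScaledVariables

end

/-! ### The main theorem. -/

theorem proposition3p3 (α β : ℝ) (hα : 1 < α) :
    -- the semigroup `e^{τ𝓛}` and its decay on functions of mean zero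
    (∃ S : ℝ → ScaledVariables.L22 →L[ℂ] ScaledVariables.L22,
      UnboundedOp.GeneratesC0 (ScaledVariables.scaledL α β) S ∧
      ∀ ε : ℝ, 0 < ε → ∃ C : ℝ, 0 < C ∧
        ∀ f : ScaledVariables.L22, ∫ x : ScaledVariables.Plane, f x = 0 →
        ∀ γ : Fin 2 → ℕ, γ 0 + γ 1 ≤ 1 →
        ∀ τ : ℝ, 0 < τ →
          ∃ g : ScaledVariables.L22, ScaledVariables.IsWeakDeriv γ (S τ f) g ∧
            ‖g‖ ≤ C * (Real.exp ((1 - (4 - β) / α + ε) * τ) /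
                (1 - Real.exp (-τ)) ^ (((γ 0 + γ 1 : ℕ) : ℝ) / α)) * ‖f‖ ∧
            ‖g‖ ≤ C * ‖f‖ * (if τ ≤ 1 then τ ^ (-(((γ 0 + γ 1 : ℕ) : ℝ) / α))
                else Real.exp ((1 - (4 - β) / α + ε) * τ))) ∧
    -- the spectrum of `𝓛` on `L²(2)`
    UnboundedOp.spectrum (ScaledVariables.scaledL α β) =
      {((1 - (3 - β) / α : ℝ) : ℂ)} ∪ {z : ℂ | z.re ≤ 1 - (4 - β) / α} ∧
    UnboundedOp.essentialSpectrum (ScaledVariables.scaledL α β) =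
      {z : ℂ | z.re ≤ 1 - (4 - β) / α} ∧
    -- the simple eigenvalue, its eigenfunction `G` and its Riesz projection
    ∃ hG : MemLp (ScaledVariables.profileG α) 2 ScaledVariables.wMeasure,
      hG.toLp ≠ 0 ∧
      (∀ f : ScaledVariables.L22,
        (∃ h : f ∈ (ScaledVariables.scaledL α β).domain,
          ScaledVariables.scaledL α β ⟨f, h⟩ = ((1 - (3 - β) / α : ℝ) : ℂ) • f) ↔
        ∃ c : ℂ, f = c • hG.toLp) ∧
      ∀ r : ℝ, 0 < r → r < 1 / α → ∀ f : ScaledVariables.L22,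
        UnboundedOp.rieszProjection (ScaledVariables.scaledL α β)
          ((1 - (3 - β) / α : ℝ) : ℂ) r f =
        (∫ x : ScaledVariables.Plane, f x) • hG.toLp := by
  have hmem : MemLp (ScaledVariables.profileG α) 2 ScaledVariables.wMeasure :=
    (ScaledVariables.isSymbol_profileSymbol α).memLp_fourierInvHat (by linarith) hα
  have hG : hmem.toLp = ScaledVariables.profile α := by
    rw [ScaledVariables.profile, ScaledVariables.symbolKernel]
    exact (dif_pos hmem).symm
  have hrate : ScaledVariables.topRate α β - 1 / α = 1 - (4 - β) / α := by
    rw [ScaledVariables.topRate]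
    ring
  refine ⟨⟨ScaledVariables.flow α β, ScaledVariables.generatesC0_flow hα,
    fun ε hε => ScaledVariables.exists_decay_estimates hα hε⟩, ?_, ?_, hmem, ?_, fun f => ?_,
    fun r hr hrα f => ?_⟩
  · rw [ScaledVariables.spectrum_scaledL hα, hrate]
    rfl
  · rw [ScaledVariables.essentialSpectrum_scaledL hα, hrate]
  · rw [hG]
    exact ScaledVariables.profile_ne_zero hα
  · rw [hG, ScaledVariables.scaledL_graph_iff, ScaledVariables.isScaledL_iff_inGenerator hα]
    exact ScaledVariables.inGenerator_topRate_iff hα f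
  · rw [hG, ← ScaledVariables.hat_zero, ← ScaledVariables.meanProj_apply,
      ← ScaledVariables.rieszProjection_scaledL (β := β) hα hr hrα]
    rfl
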